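/- A marked simplicial set $(X,E_X)$ is a simplicial set $X$ with a set $E_X\subseteq X_1$ of marked edges containing all degenerate edges; morphisms are maps of simplicial sets preserving marked edges. For a simplicial set $K$, write $K^\flat$ (resp. $K^\sharp$) for $K$ with exactly the degenerate edges (resp. all edges) marked. Call a map of marked simplicial sets a monomorphism if its underlying map of simplicial sets is one. For $i\colon K\to L$ put $$\partial_1\boxtimes i\colon\ (\{1\}\times L)\sqcup_{\{1\}\times K}\big((\Delta^1)^\sharp\times K\big)\to(\Delta^1)^\sharp\times L,\qquad \partial I\boxtimes i\colon\ (L\sqcup L)\sqcup_{K\sqcup K}\big((\Delta^1)^\sharp\times K\big)\to(\Delta^1)^\sharp\times L,$$ where $K\sqcup K\to(\Delta^1)^\sharp\times K$ and $L\sqcup L\to(\Delta^1)^\sharp\times L$ are the inclusions of the two ends. The marked right anodyne extensions are the smallest class $\mathcal A$ of monomorphisms such that - $\mathcal A$ is the class of maps with the left lifting property against all maps that have the right lifting property against some small set of monomorphisms; - $\partial_1\boxtimes i\in\mathcal A$ for every monomorphism $i$, and $\partial I\boxtimes i\in\mathcal A$ for every $i\in\mathcal A$; - $\mathcal A$ contains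 $(\Lambda^n_k)^\flat\to(\Delta^n)^\flat$ for $n\ge 2$, $0<k<n$, and $J^\flat\to J^\sharp$, where $J$ is the nerve of the free walking isomorphism. A marked right fibration is a map with the right lifting property against all marked right anodyne extensions. For a map $p\colon X\to A$ of simplicial sets, an edge $f$ of $X$ is $p$-Cartesian if for all $n\ge 2$ every commutative square from $\Lambda^n_n\to\Delta^n$ to $p$ whose top map $\Lambda^n_n\to X$ sends the edge $\Delta^{\{n-1,n\}}$ to $f$ admits a diagonal lift $\Delta^n\to X$. **Proposition.** Let $p\colon (X,E_X)\to (A,E_A)$ be a morphism of marked simplicial sets. Then $p$ is a marked right fibration if and only if the following three conditions hold. 1. The underlying map $p\colon X\to A$ of simplicial sets is an inner fibration. 2. For every vertex $y$ of $X$ and every marked edge $\bar f\colon x\to p(y)$ in $E_A$ there is a marked edge $f\in E_X$ with target $y$ such that $p(f)=\bar f$. 3. An edge $f$ of $X$ is marked if and only if $p(f)\in E_A$ and $f$ is $p$-Cartesian. -/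

import Mathlib

open CategoryTheory CategoryTheory.Limits MonoidalCategory Opposite
open scoped Simplicial

universe w v u

noncomputable section

/-! ### Functorial cylinders and right anodyne extensions -/

/-- A functor `I` with natural transformations `∂₀, ∂₁ : id ⟶ I` and `σ : I ⟶ id` such that
`σ ∘ ∂₀ = id = σ ∘ ∂₁`. The compatibility of a cylinder with a class of cofibrations is not part of
this structure; it is not needed to define the operations below. -/
structure FunctorialCylinder (C : Type u) [Category.{v} C] where
  I : C ⥤ C
  d₀ : 𝟭 C ⟶ I
  d₁ : 𝟭 C ⟶ I
  σ : I ⟶ 𝟭 C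
  d₀_σ : d₀ ≫ σ = 𝟙 (𝟭 C)
  d₁_σ : d₁ ≫ σ = 𝟙 (𝟭 C)

namespace FunctorialCylinder

variable {C : Type u} [Category.{v} C] (cyl : FunctorialCylinder C)

/-- `∂₁ ⊠ i : {1} ⊗ L ⊔_{{1} ⊗ K} I ⊗ K ⟶ I ⊗ L`. -/
def boxOne [HasPushouts C] {K L : C} (i : K ⟶ L) :
    pushout i (cyl.d₁.app K) ⟶ cyl.I.obj L :=
  pushout.desc (cyl.d₁.app L) (cyl.I.map i) (cyl.d₁.naturality i)

/-- `∂₀ ⊔ ∂₁ : ∂I ⊗ K = K ⊔ K ⟶ I ⊗ K`. -/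
def boundaryMap [HasBinaryCoproducts C] (K : C) : K ⨿ K ⟶ cyl.I.obj K :=
  coprod.desc (cyl.d₀.app K) (cyl.d₁.app K)

theorem boundaryMap_naturality [HasBinaryCoproducts C] {K L : C} (i : K ⟶ L) :
    coprod.map i i ≫ cyl.boundaryMap L = cyl.boundaryMap K ≫ cyl.I.map i := by
  have h₀ := cyl.d₀.naturality i
  have h₁ := cyl.d₁.naturality i
  dsimp at h₀ h₁
  ext <;> simp [boundaryMap, h₀, h₁]

/-- `∂I ⊠ i : ∂I ⊗ L ⊔_{∂I ⊗ K} I ⊗ K ⟶ I ⊗ L`. -/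
def boxBoundary [HasPushouts C] [HasBinaryCoproducts C] {K L : C} (i : K ⟶ L) :
    pushout (coprod.map i i) (cyl.boundaryMap K) ⟶ cyl.I.obj L :=
  pushout.desc (cyl.boundaryMap L) (cyl.I.map i) (cyl.boundaryMap_naturality i)

/-- `An` is a class of right `I`-anodyne extensions relative to the left class `𝓛` of a weak
factorization system. "Small set" refers to the universe `w`. -/
structure IsRightAnodyneClass [HasPushouts C] [HasBinaryCoproducts C]
    (𝓛 An : MorphismProperty C) : Prop where
  le : An ≤ 𝓛
  exists_generators : ∃ S : MorphismProperty C,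
    MorphismProperty.IsSmall.{w} S ∧ S ≤ 𝓛 ∧ An = S.rlp.llp
  boxOne_mem : ∀ ⦃K L : C⦄ (i : K ⟶ L), 𝓛 i → An (cyl.boxOne i)
  boxBoundary_mem : ∀ ⦃K L : C⦄ (i : K ⟶ L), An i → An (cyl.boxBoundary i)

/-- The smallest class of right `I`-anodyne extensions containing `S`. -/
def rightAnodyne [HasPushouts C] [HasBinaryCoproducts C]
    (𝓛 S : MorphismProperty C) : MorphismProperty C := fun _ _ f ↦
  ∀ An : MorphismProperty C, IsRightAnodyneClass.{w} cyl 𝓛 An → S ≤ An → An f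

end FunctorialCylinder

/-! ### Marked simplicial sets -/

/-- A simplicial set with a set of marked edges containing all degenerate edges. -/
structure MarkedSSet where
  toSSet : SSet.{u}
  marked : Set (toSSet _⦋1⦌)
  degenerate_mem : ∀ x : toSSet _⦋0⦌, toSSet.σ 0 x ∈ marked

namespace MarkedSSet

/-- A morphism of simplicial sets preserving marked edges. -/
@[ext]
structure Hom (X Y : MarkedSSet.{u}) where
  hom : X.toSSet ⟶ Y.toSSet
  map_marked : ∀ e ∈ X.marked, hom.app (op ⦋1⦌) e ∈ Y.marked

instance : Category MarkedSSet.{u} where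
  Hom X Y := Hom X Y
  id X := ⟨𝟙 _, fun _ he ↦ he⟩
  comp f g := ⟨f.hom ≫ g.hom, fun e he ↦ g.map_marked _ (f.map_marked e he)⟩

@[ext]
theorem hom_ext {X Y : MarkedSSet.{u}} {f g : X ⟶ Y} (h : f.hom = g.hom) : f = g :=
  Hom.ext h

@[simp]
theorem id_hom (X : MarkedSSet.{u}) : Hom.hom (𝟙 X) = 𝟙 X.toSSet := rfl

@[simp]
theorem comp_hom {X Y Z : MarkedSSet.{u}} (f : X ⟶ Y) (g : Y ⟶ Z) :
    Hom.hom (f ≫ g) = f.hom ≫ g.hom := rfl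

/-- The forgetful functor to simplicial sets. -/
def forget : MarkedSSet.{u} ⥤ SSet.{u} where
  obj X := X.toSSet
  map f := f.hom

/-- The colimit of a diagram of marked simplicial sets: the colimit of the underlying simplicial
sets, with the images of marked edges (and the degenerate edges) marked. -/
def colimitCocone {J : Type u} [SmallCategory J] (F : J ⥤ MarkedSSet.{u}) : Cocone F where
  pt :=
    { toSSet := colimit (F ⋙ forget)
      marked := {e | (∃ j, ∃ e' ∈ (F.obj j).marked,
        (colimit.ι (F ⋙ forget) j).app (op ⦋1⦌) e' = e) ∨
        ∃ x, (colimit (F ⋙ forget)).σ (0 : Fin 1) x = e}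
      degenerate_mem := fun x ↦ Or.inr ⟨x, rfl⟩ }
  ι :=
    { app := fun j ↦ ⟨colimit.ι (F ⋙ forget) j, fun e he ↦ Or.inl ⟨j, e, he, rfl⟩⟩
      naturality := fun i j f ↦ by
        ext1
        exact (colimit.cocone (F ⋙ forget)).ι.naturality f }

/-- The universal property of `colimitCocone`. -/
def colimitCoconeIsColimit {J : Type u} [SmallCategory J] (F : J ⥤ MarkedSSet.{u}) :
    IsColimit (colimitCocone F) where
  desc s :=
    { hom := colimit.desc (F ⋙ forget) (forget.mapCocone s)
      map_marked := by
        rintro _ (⟨j, e, he, rfl⟩ | ⟨x, rfl⟩)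
        · have h := congr_arg (fun φ ↦ φ.app (op ⦋1⦌) e)
            (colimit.ι_desc (forget.mapCocone s) j)
          exact h ▸ (s.ι.app j).map_marked e he
        · have h := ConcreteCategory.congr_hom
            (SimplicialObject.σ_naturality
              (colimit.desc (F ⋙ forget) (forget.mapCocone s)) (0 : Fin 1)) x
          exact h ▸ s.pt.degenerate_mem _ }
  fac s j := by
    ext1
    exact colimit.ι_desc (forget.mapCocone s) j
  uniq s m hm := by
    ext1
    refine colimit.hom_ext fun j ↦ ?_
    exact (congr_arg Hom.hom (hm j)).trans (colimit.ι_desc (forget.mapCocone s) j).symm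

instance : HasColimitsOfSize.{u, u} MarkedSSet.{u} where
  has_colimits_of_shape _ _ := ⟨fun F ↦ ⟨⟨⟨_, colimitCoconeIsColimit F⟩⟩⟩⟩

instance : HasPushouts MarkedSSet.{u} :=
  hasColimitsOfShape_of_equivalence (ULiftHomULiftCategory.equiv.{u, u} WalkingSpan).symm

instance : HasBinaryCoproducts MarkedSSet.{u} :=
  hasColimitsOfShape_of_equivalence
    (ULiftHomULiftCategory.equiv.{u, u} (Discrete WalkingPair)).symm

/-- `A^♭`: precisely the degenerate edges are marked. -/
def flat : SSet.{u} ⥤ MarkedSSet.{u} where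
  obj A := ⟨A, Set.range (A.σ (0 : Fin 1)), fun x ↦ ⟨x, rfl⟩⟩
  map {A B} f := ⟨f, by
    rintro _ ⟨x, rfl⟩
    exact ⟨_, (ConcreteCategory.congr_hom (SimplicialObject.σ_naturality f (0 : Fin 1)) x).symm⟩⟩

/-- `A^♯`: all edges are marked. -/
def sharp : SSet.{u} ⥤ MarkedSSet.{u} where
  obj A := ⟨A, Set.univ, fun _ ↦ trivial⟩
  map f := ⟨f, fun _ _ ↦ trivial⟩

/-- The identity of `A` as a map `A^♭ ⟶ A^♯`. -/
def flatToSharp (A : SSet.{u}) : flat.obj A ⟶ sharp.obj A :=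
  ⟨𝟙 A, fun _ _ ↦ trivial⟩

/-- The product: an edge is marked if both of its components are. -/
def prod (X Y : MarkedSSet.{u}) : MarkedSSet.{u} where
  toSSet := X.toSSet ⊗ Y.toSSet
  marked := {e | e.1 ∈ X.marked ∧ e.2 ∈ Y.marked}
  degenerate_mem x := ⟨X.degenerate_mem x.1, Y.degenerate_mem x.2⟩

/-- The map `X = {k} × X ⟶ (Δ¹)^♯ × X` given by the vertex `k` of `Δ¹`. -/
def vertexInclusion (k : Fin 2) (X : MarkedSSet.{u}) : X ⟶ prod (sharp.obj Δ[1]) X :=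
  ⟨CartesianMonoidalCategory.lift (SSet.const (SSet.stdSimplex.obj₀Equiv.symm k)) (𝟙 X.toSSet),
    fun _ he ↦ ⟨trivial, he⟩⟩

/-- The cylinder `(Δ¹)^♯ × -` on marked simplicial sets. -/
def cylinder : FunctorialCylinder MarkedSSet.{u} where
  I :=
    { obj := fun X ↦ prod (sharp.obj Δ[1]) X
      map := fun f ↦ ⟨Δ[1] ◁ f.hom, fun e he ↦ ⟨trivial, f.map_marked e.2 he.2⟩⟩ }
  d₀ := { app := vertexInclusion 0 }
  d₁ := { app := vertexInclusion 1 }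
  σ := { app := fun X ↦ ⟨CartesianMonoidalCategory.snd Δ[1] X.toSSet, fun _ he ↦ he.2⟩ }
  d₀_σ := rfl
  d₁_σ := rfl

/-- The maps whose underlying map of simplicial sets is a monomorphism. -/
def underlyingMono : MorphismProperty MarkedSSet.{u} := fun _ _ f ↦ Mono f.hom

/-- The inner horn inclusions `(Λᵐₖ)^♭ ⟶ (Δᵐ)^♭` for `m = n + 2 ≥ 2` and `0 < k < m`. -/
inductive flatInnerHorns : MorphismProperty MarkedSSet.{u} where
  | intro (n : ℕ) (k : Fin (n + 3)) (h₀ : 0 < k) (hn : k < Fin.last (n + 2)) :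
      flatInnerHorns (flat.map (Λ[n + 2, k]).ι)

/-- The inner horn inclusions `(Λⁿₖ)^♭ ⟶ (Δⁿ)^♭`, together with the map `J^♭ ⟶ J^♯` for `J` the
nerve of the free walking isomorphism. -/
def generators : MorphismProperty MarkedSSet.{u} :=
  flatInnerHorns ⊔ MorphismProperty.ofHoms (fun _ : Unit ↦ flatToSharp SSet.coherentIso)

/-- Marked right anodyne extensions: the smallest class of right anodyne extensions for the
cylinder `(Δ¹)^♯ × -` that contains `generators`. -/
def markedRightAnodyne : MorphismProperty MarkedSSet.{u} :=
  FunctorialCylinder.rightAnodyne.{u} cylinder underlyingMono generators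

/-- Marked right fibrations: the right lifting property against marked right anodyne
extensions. -/
def IsMarkedRightFibration {X A : MarkedSSet.{u}} (p : X ⟶ A) : Prop :=
  markedRightAnodyne.rlp p

end MarkedSSet

/-! ### Cartesian edges -/

namespace SSet

/-- The edge `Δ^{n+1,n+2}` of the horn `Λ^{n+2}_{n+2}`. -/
def hornLastEdge (n : ℕ) : (Λ[n + 2, Fin.last (n + 2)] : SSet.{u}) _⦋1⦌ :=
  horn.edge (n + 2) (Fin.last (n + 2)) (Fin.last (n + 1)).castSucc (Fin.last (n + 2))
    (Fin.le_last _) (by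
      rw [Finset.insert_comm, Finset.pair_eq_singleton]
      exact Finset.card_le_two.trans (by omega))

/-- An edge `f` of `X` is `p`-Cartesian if, for all `m = n + 2 ≥ 2`, every lifting problem of
`Λᵐₘ ⟶ Δᵐ` against `p` in which the edge `Δ^{m-1,m}` is sent to `f` has a solution. -/
def IsCartesianEdge {X A : SSet.{u}} (p : X ⟶ A) (f : X _⦋1⦌) : Prop :=
  ∀ (n : ℕ) (a : (Λ[n + 2, Fin.last (n + 2)] : SSet.{u}) ⟶ X) (b : Δ[n + 2] ⟶ A),
    a ≫ p = (Λ[n + 2, Fin.last (n + 2)]).ι ≫ b →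
    a.app (op ⦋1⦌) (hornLastEdge n) = f →
    ∃ l : Δ[n + 2] ⟶ X, (Λ[n + 2, Fin.last (n + 2)]).ι ≫ l = a ∧ l ≫ p = b

end SSet

end

/-! Marked right fibrations are detected by a small explicit set `basicAnodyne`: the inner horns,
the map `J^♭ → J^♯`, the boxes `∂₁ ⊠ (∂Δⁿ → Δⁿ)^♭`, and the box `∂₁ ⊠ ((Δ¹)^♭ → (Δ¹)^♯)`. The
cylinder has a right adjoint `path`, and lifting against a box transposes to lifting against
`pathOne` or `pathBoundary`. Closure of the generated class under `∂₁ ⊠ -` then reduces to boundary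
inclusions and the marking of one edge, since lifting against these implies lifting against all
monomorphisms; closure under `∂I ⊠ -` reduces to the generators
(`isRightAnodyneClass_basicAnodyne`).

Necessity of the conditions. Inner horns and the box with `n = 0` give the first two. A marked edge
is Cartesian because the last horn, with its last edge marked, is a retract of a box: a contraction
pushes the last but one vertex onto the last one. Conversely, let `f` be Cartesian over a marked
edge and `f'` a marked lift of that edge with the same target. Both are Cartesian, so they are
joined by a homotopy parametrized by `J` (`exists_iso_homotopy`). At the source this is a map from
`J` whose edges become marked by lifting against `J^♭ → J^♯`, and the box on the marking of an edge
carries the marking from `f'` to `f`.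

Sufficiency. The boxes on `∂Δⁿ` for `n ≥ 1` are filled by inner horns and by last horns ending in a
marked edge. The other problems ask for certain edges to be marked, that is, Cartesian: edges in the
image of `J`, and the remaining edges of a square. Here composition and cancellation of Cartesian
edges are needed, but `A` is an arbitrary simplicial set, so a simplex of `A` cannot be enlarged.
Hence these arguments are run for `IsLocallyCartesianEdge`, where the base factors through the image
of the edge. `IsLocallyCartesianEdge.isCartesianEdge` then removes the restriction: the second
condition provides a Cartesian edge with the same image and target, and horn problems are
transported along the `J`-homotopy to it.

The extension arguments for Cartesian edges and for `J`-homotopies rest on one combinatorial device.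
Simplices are encoded as words (`WordModel`), and a `Toggle` pairs the nondegenerate simplices
outside a subcomplex by inserting or deleting a letter `r z` behind the last letter `z` of a set
`Z`. This is a regular pairing, so the inclusion is built from horns; a horn is inner unless the
inserted letter is the last one, and then it is a last horn with last edge `z → r z`, which must be
Cartesian. -/

noncomputable section

/-! ### Gluing, and extension along regular pairings -/

namespace SSet

/-- Maps out of a subcomplex `K` that is covered by the images of maps `m i : B i ⟶ L` can be
glued from compatible maps out of the `B i`. -/
lemma Subcomplex.exists_glue {L X : SSet.{u}} {ι : Type*} (K : L.Subcomplex) (B : ι → SSet.{u})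
    (m : ∀ i, B i ⟶ L) (f : ∀ i, B i ⟶ X)
    (hK : ∀ (d : ℕ) (x : L _⦋d⦌), x ∈ K.obj _ → ∃ i b, (m i).app _ b = x)
    (hf : ∀ (i j : ι) (d : ℕ) (b : B i _⦋d⦌) (c : B j _⦋d⦌),
      (m i).app _ b = (m j).app _ c → (f i).app _ b = (f j).app _ c) :
    ∃ g : (K : SSet.{u}) ⟶ X, ∀ (i : ι) (d : ℕ) (b : B i _⦋d⦌) (hb : (m i).app _ b ∈ K.obj _),
      g.app _ ⟨(m i).app _ b, hb⟩ = (f i).app _ b := by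
  choose i b hib using hK
  refine ⟨{
    app d := ↾fun x ↦ (f (i d.unop.len x.1 x.2)).app _ (b d.unop.len x.1 x.2)
    naturality d e φ := ?_ }, fun j d c hc ↦ ?_⟩
  · ext x
    dsimp
    have := hf (i e.unop.len (L.map φ x.1) (K.map φ x.2)) (i d.unop.len x.1 x.2) e.unop.len
      (b e.unop.len (L.map φ x.1) (K.map φ x.2)) ((B _).map φ (b d.unop.len x.1 x.2)) (by
        refine (hib _ _ _).trans ?_
        refine Eq.trans ?_ (NatTrans.naturality_apply (m _) φ _).symm
        exact congr_arg _ (hib _ _ _).symm)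
    exact this.trans (NatTrans.naturality_apply (f _) φ _)
  · exact hf _ _ _ _ _ (hib _ _ _)

namespace Subcomplex.PairingCore

variable {L : SSet.{u}} {A : L.Subcomplex} (C : A.PairingCore)

/-- Extension along a regular pairing, where only those horn filling problems have to be solved
which are compatible with the given data. -/
lemma exists_lift [C.IsRegular] {X Y : SSet.{u}} (p : X ⟶ Y) (f : (A : SSet.{u}) ⟶ X) (g : L ⟶ Y)
    (comm : f ≫ p = A.ι ≫ g)
    (h : ∀ (s : C.ι) (φ : (Λ[C.dim s + 1, C.index s] : SSet.{u}) ⟶ X),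
      φ ≫ p = Λ[C.dim s + 1, C.index s].ι ≫ yonedaEquiv.symm (C.simplex s) ≫ g →
      (∀ (d : ℕ) (x : Δ[C.dim s + 1] _⦋d⦌) (hx : x ∈ Λ[C.dim s + 1, C.index s].obj _)
        (hx' : (yonedaEquiv.symm (C.simplex s)).app _ x ∈ A.obj _),
        φ.app _ ⟨x, hx⟩ = f.app _ ⟨_, hx'⟩) →
      ∃ l : Δ[C.dim s + 1] ⟶ X, Λ[C.dim s + 1, C.index s].ι ≫ l = φ ∧
        l ≫ p = yonedaEquiv.symm (C.simplex s) ≫ g) :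
    ∃ l : L ⟶ X, A.ι ≫ l = f ∧ l ≫ p = g := by
  let F := C.pairing.rankFunction
  -- A stage carries its compatibilities along, so that stages can be chosen recursively.
  let T (i : ℕ) := {l : (F.filtration i : SSet.{u}) ⟶ X //
    homOfLE (F.le_filtration i) ≫ l = f ∧ l ≫ p = (F.filtration i).ι ≫ g}
  have hcell : ∀ (i : ℕ) (c : F.Cell i) (φ : (c.horn : SSet.{u}) ⟶ X),
      φ ≫ p = c.horn.ι ≫ c.map ≫ g →
      (∀ (d : ℕ) (x : Δ[c.dim + 1] _⦋d⦌) (hx : x ∈ c.horn.obj _) (hx' : c.map.app _ x ∈ A.obj _),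
        φ.app _ ⟨x, hx⟩ = f.app _ ⟨_, hx'⟩) →
      ∃ l : Δ[c.dim + 1] ⟶ X, c.horn.ι ≫ l = φ ∧ l ≫ p = c.map ≫ g := by
    rintro i ⟨s', hs'⟩
    obtain ⟨s, rfl⟩ := C.equivII.surjective s'
    have h₀ : ((C.pairing.p (C.equivII s)).val.cast
        (C.pairing.isUniquelyCodimOneFace (C.equivII s)).dim_eq).simplex = C.simplex s := by
      have (n : A.N) (hn : n = C.type₁ s) (h : n.dim = C.dim s + 1) :
          (n.cast h).simplex = C.simplex s := by
        subst hn
        rfl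
      exact this _ (C.type₁_pairing s).symm _
    have h₁ : Pairing.RankFunction.Cell.index (f := F) ⟨C.equivII s, hs'⟩ = C.index s := by
      refine (((C.pairing.isUniquelyCodimOneFace (C.equivII s)).δ_eq_iff rfl _).1 ?_).symm
      exact congr_arg (L.δ (C.index s)) h₀
    have h₂ : Pairing.RankFunction.Cell.map (f := F) ⟨C.equivII s, hs'⟩ =
        yonedaEquiv.symm (C.simplex s) := congr_arg _ h₀
    have key := h s
    rw [← h₁, ← h₂] at key
    exact key
  have step : ∀ (i : ℕ) (l : T i), ∃ l' : T (Order.succ i),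
      homOfLE (F.filtration_monotone (Order.le_succ i)) ≫ l'.1 = l.1 := by
    rintro i ⟨l, hl₁, hl₂⟩
    -- As `l` extends `f`, the horn it induces agrees with `f` on `A`; this is the extra information
    -- offered to `h`.
    have hex (c : F.Cell i) := hcell i c (c.mapHorn ≫ l) (by
      rw [Category.assoc, hl₂, c.mapHorn_ι_assoc]) (fun d x hx hx' ↦ by
        rw [← hl₁]; rfl)
    choose m hm₁ hm₂ using hex
    let l' : (F.filtration (Order.succ i) : SSet.{u}) ⟶ X :=
      (F.isPushout i).desc l (Sigma.desc m) (by
        ext c : 1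
        simp [hm₁])
    have h₁ : homOfLE (F.filtration_monotone (Order.le_succ i)) ≫ l' = l :=
      (F.isPushout i).inl_desc _ _ _
    have h₂ : F.b i ≫ l' = Sigma.desc m := (F.isPushout i).inr_desc _ _ _
    refine ⟨⟨l', ?_, ?_⟩, h₁⟩
    · rw [← hl₁, ← h₁]
      rfl
    · refine (F.isPushout i).hom_ext ?_ ?_
      · refine (congr_arg (· ≫ p) h₁).trans ?_
        exact hl₂
      · rw [reassoc_of% h₂]
        ext c : 1
        refine (Sigma.ι_desc_assoc _ _ _).trans ?_
        rw [hm₂]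
        exact (c.ι_b_assoc ((F.filtration (Order.succ i)).ι ≫ g)).symm
  choose next hnext using step
  have h0 : F.filtration 0 = A := F.filtration_bot
  let l0 : T 0 := ⟨homOfLE h0.le ≫ f, by rw [← Category.assoc, homOfLE_comp]; rfl, by
    rw [Category.assoc, comm]; rfl⟩
  let l (i : ℕ) : T i := Nat.rec l0 next i
  have hl (i j : ℕ) (hij : i ≤ j) : homOfLE (F.filtration_monotone hij) ≫ (l j).1 = (l i).1 := by
    induction j, hij using Nat.le_induction with
    | base => rfl
    | succ j hij ih =>
      rw [← ih, ← hnext j (l j)]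
      rfl
  -- The filtration exhausts `L` and the stages restrict to one another, so they glue.
  obtain ⟨k, hk⟩ := exists_glue (⊤ : L.Subcomplex) (fun i : ℕ ↦ (F.filtration i : SSet.{u}))
    (fun i ↦ (F.filtration i).ι) (fun i ↦ (l i).1) (fun d x _ ↦ by
      have : x ∈ (⨆ i, F.filtration i).obj _ := by rw [F.iSup_filtration]; trivial
      simp only [Subfunctor.iSup_obj, Set.mem_iUnion] at this
      obtain ⟨i, hi⟩ := this
      exact ⟨i, ⟨x, hi⟩, rfl⟩) (by
      rintro i j d ⟨b, hb⟩ ⟨c, hc⟩ (rfl : b = c)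
      rw [← hl i (max i j) (le_max_left _ _), ← hl j (max i j) (le_max_right _ _)]
      rfl)
  refine ⟨(topIso L).inv ≫ k, ?_, ?_⟩
  · ext ⟨⟨d⟩⟩ x
    refine (hk 0 d ⟨x.1, F.le_filtration 0 _ x.2⟩ trivial).trans ?_
    exact ConcreteCategory.congr_hom (congr_app (l 0).2.1 (op ⦋d⦌)) x
  · ext ⟨⟨d⟩⟩ x
    have : x ∈ (⨆ i, F.filtration i).obj _ := by rw [F.iSup_filtration]; trivial
    simp only [Subfunctor.iSup_obj, Set.mem_iUnion] at this
    obtain ⟨i, hi⟩ := this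
    refine (congr_arg (p.app _) (hk i d ⟨x, hi⟩ trivial)).trans ?_
    exact ConcreteCategory.congr_hom (congr_app (l i).2.2 (op ⦋d⦌)) ⟨x, hi⟩
end Subcomplex.PairingCore

end SSet

/-! ### Words as simplices, and the toggling of a letter -/

namespace SSet

/-- The restriction of `IsCartesianEdge` to those lifting problems whose base is the image under
`q` of a simplex of `B` with last edge `e`. -/
def IsCartesianAlong {X A B : SSet.{u}} (p : X ⟶ A) (q : B ⟶ A) (e : B _⦋1⦌) (f : X _⦋1⦌) : Prop :=
  ∀ (n : ℕ) (a : (Λ[n + 2, Fin.last (n + 2)] : SSet.{u}) ⟶ X) (t : Δ[n + 2] ⟶ B),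
    a ≫ p = (Λ[n + 2, Fin.last (n + 2)]).ι ≫ t ≫ q →
    t.app (op ⦋1⦌) (hornLastEdge n).1 = e →
    a.app (op ⦋1⦌) (hornLastEdge n) = f →
    ∃ l : Δ[n + 2] ⟶ X, (Λ[n + 2, Fin.last (n + 2)]).ι ≫ l = a ∧ l ≫ p = t ≫ q

lemma IsCartesianEdge.along {X A B : SSet.{u}} {p : X ⟶ A} {f : X _⦋1⦌} (hf : IsCartesianEdge p f)
    (q : B ⟶ A) (e : B _⦋1⦌) : IsCartesianAlong p q e f :=
  fun n a t h _ h' ↦ hf n a (t ≫ q) h h'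

lemma IsCartesianAlong.precomp {X A B B' : SSet.{u}} {p : X ⟶ A} {q : B ⟶ A} {e : B _⦋1⦌}
    {f : X _⦋1⦌} (hf : IsCartesianAlong p q e f) (r : B' ⟶ B) (e' : B' _⦋1⦌)
    (he' : r.app _ e' = e) : IsCartesianAlong p (r ≫ q) e' f := by
  intro n a t h h' h''
  obtain ⟨l, hl, hl'⟩ := hf n a (t ≫ r) (by simpa using h) (by rw [← he', ← h']; rfl) h''
  exact ⟨l, hl, by simpa using hl'⟩

/-- A description of the simplices of `L` as those words in the alphabet `P` that are chains for
a preorder `rel` and whose set of letters is `good`. -/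
structure WordModel (L : SSet.{u}) (P : Type*) where
  rel : P → P → Prop
  rel_refl (a : P) : rel a a
  rel_trans {a b c : P} : rel a b → rel b c → rel a c
  good : Set P → Prop
  good_mono {S T : Set P} : S ⊆ T → good T → good S
  word {d : ℕ} (x : L _⦋d⦌) : Fin (d + 1) → P
  word_map {d e : ℕ} (φ : ⦋d⦌ ⟶ ⦋e⦌) (x : L _⦋e⦌) (i : Fin (d + 1)) :
    word (L.map φ.op x) i = word x (φ.toOrderHom i)
  word_injective {d : ℕ} : Function.Injective (word (d := d))
  exists_word {d : ℕ} (a : Fin (d + 1) → P) (ha : ∀ i j, i ≤ j → rel (a i) (a j))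
    (hg : good (Set.range a)) : ∃ x : L _⦋d⦌, word x = a
  rel_word {d : ℕ} (x : L _⦋d⦌) (i j : Fin (d + 1)) : i ≤ j → rel (word x i) (word x j)
  good_word {d : ℕ} (x : L _⦋d⦌) : good (Set.range (word x))

namespace WordModel

variable {L : SSet.{u}} {P : Type*} (W : WordModel L P)

lemma word_δ {d : ℕ} (i : Fin (d + 2)) (x : L _⦋d + 1⦌) (j : Fin (d + 1)) :
    W.word (L.δ i x) j = W.word x (i.succAbove j) :=
  W.word_map (SimplexCategory.δ i) x j

lemma word_σ {d : ℕ} (i : Fin (d + 1)) (x : L _⦋d⦌) (j : Fin (d + 2)) :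
    W.word (L.σ i x) j = W.word x (i.predAbove j) :=
  W.word_map (SimplexCategory.σ i) x j

/-- If the letters `i` and `i + 1` agree, then the simplex is `σ i` of its face `δ i`. Words
determine simplices, so it suffices to compare words. -/
lemma mem_nonDegenerate_iff {d : ℕ} (x : L _⦋d⦌) :
    x ∈ L.nonDegenerate d ↔ ∀ i j : Fin (d + 1), j.val = i.val + 1 → W.word x i ≠ W.word x j := by
  obtain _ | d := d
  · simp only [nondegenerate_zero, Set.mem_univ, true_iff]
    intro i j h
    omega
  rw [mem_nonDegenerate_iff_notMem_degenerate, degenerate_eq_iUnion_range_σ]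
  simp only [Set.mem_iUnion, Set.mem_range, not_exists]
  constructor
  · intro h i j hij heq
    refine h ⟨i.val, by omega⟩ (L.δ i x) (W.word_injective (funext fun k ↦ ?_))
    rw [word_σ, word_δ]
    by_cases hk : k = i
    · subst hk
      have : k.succAbove ((⟨k.val, by omega⟩ : Fin (d + 1)).predAbove k) = j := by
        ext
        simp [Fin.predAbove, Fin.succAbove]
        omega
      rw [this, heq]
    · congr 1
      have hk' : k.val ≠ i.val := fun h ↦ hk (Fin.ext h)
      ext
      simp only [Fin.predAbove, Fin.succAbove, Fin.lt_def, Fin.val_castSucc]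
      split_ifs <;> simp_all only [Fin.val_castSucc, Fin.val_succ, Fin.val_pred,
        Fin.coe_castPred] <;> omega
  · rintro h i y rfl
    refine h i.castSucc i.succ (by simp) ?_
    rw [word_σ, word_σ]
    simp

/-- The position of the last letter belonging to `Z`. -/
def IsLast (Z : Set P) {d : ℕ} (a : Fin (d + 1) → P) (i : Fin (d + 1)) : Prop :=
  a i ∈ Z ∧ ∀ j, i < j → a j ∉ Z

lemma IsLast.unique {Z : Set P} {d : ℕ} {a : Fin (d + 1) → P} {i j : Fin (d + 1)}
    (hi : IsLast Z a i) (hj : IsLast Z a j) : i = j := by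
  rcases lt_trichotomy i j with h | h | h
  · exact (hi.2 _ h hj.1).elim
  · exact h
  · exact (hj.2 _ h hi.1).elim

lemma exists_isLast {Z : Set P} {d : ℕ} {a : Fin (d + 1) → P} (h : ∃ i, a i ∈ Z) :
    ∃ i, IsLast Z a i := by
  classical
  let s : Finset (Fin (d + 1)) := Finset.univ.filter (a · ∈ Z)
  have hs : s.Nonempty := by
    obtain ⟨i, hi⟩ := h
    exact ⟨i, by simpa [s] using hi⟩
  refine ⟨s.max' hs, by simpa [s] using s.max'_mem hs, fun j hj hj' ↦ ?_⟩
  exact absurd (s.le_max' j (by simpa [s] using hj')) (not_le.2 hj)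

/-- The last letter in `Z` is immediately followed by its image under `r`. -/
def IsToggled (Z : Set P) (r : P → P) {d : ℕ} (a : Fin (d + 1) → P) : Prop :=
  ∃ i j : Fin (d + 1), IsLast Z a i ∧ j.val = i.val + 1 ∧ a j = r (a i)

/-- A rule to pair the words whose letters are not `κ`: insert or delete `r z` behind the last
letter `z` belonging to `Z`. -/
structure Toggle (κ : Set P → Prop) (Z : Set P) (r : P → P) : Prop where
  mono {S T : Set P} : S ⊆ T → κ T → κ S
  exists_mem {S : Set P} : W.good S → ¬ κ S → (∀ a ∈ S, ∀ b ∈ S, W.rel a b ∨ W.rel b a) →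
    ∃ z ∈ S, z ∈ Z
  step {S : Set P} : W.good S → ¬ κ S → (∀ a ∈ S, ∀ b ∈ S, W.rel a b ∨ W.rel b a) →
    ∀ z ∈ S, z ∈ Z → (∀ a ∈ S, a ∈ Z → W.rel a z) →
      W.rel z (r z) ∧ r z ∉ Z ∧ W.good (insert (r z) S) ∧ ¬ κ (S \ {r z}) ∧
        ∀ b ∈ S, b ∉ Z → W.rel z b → W.rel (r z) b

lemma total_range {d : ℕ} (x : L _⦋d⦌) :
    ∀ a ∈ Set.range (W.word x), ∀ b ∈ Set.range (W.word x), W.rel a b ∨ W.rel b a := by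
  rintro _ ⟨i, rfl⟩ _ ⟨j, rfl⟩
  exact (le_total i j).imp (W.rel_word x _ _) (W.rel_word x _ _)

lemma rel_of_isLast {Z : Set P} {d : ℕ} {x : L _⦋d⦌} {i : Fin (d + 1)}
    (hi : IsLast Z (W.word x) i) : ∀ a ∈ Set.range (W.word x), a ∈ Z → W.rel a (W.word x i) := by
  rintro _ ⟨j, rfl⟩ hj
  exact W.rel_word x _ _ (not_lt.1 fun h ↦ hi.2 j h hj)

lemma IsLast.δ {Z : Set P} {d : ℕ} {y : L _⦋d + 1⦌} {i : Fin (d + 1)}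
    (hi : IsLast Z (W.word y) i.castSucc) : IsLast Z (W.word (L.δ i.succ y)) i := by
  refine ⟨?_, fun j hj ↦ ?_⟩
  · rw [word_δ, Fin.succAbove_succ_self]
    exact hi.1
  · rw [word_δ, Fin.succAbove_of_lt_succ _ _ (by simpa using hj)]
    exact hi.2 _ (by simp only [Fin.lt_def, Fin.val_castSucc, Fin.val_succ] at hj ⊢; omega)

/-- `y` is obtained from `x` by inserting `r z` behind the last letter `z` in `Z`. -/
structure IsInsertion (Z : Set P) (r : P → P) {d : ℕ} (x : L _⦋d⦌) (y : L _⦋d + 1⦌)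
    (i : Fin (d + 1)) : Prop where
  isLast : IsLast Z (W.word y) i.castSucc
  word_succ : W.word y i.succ = r (W.word y i.castSucc)
  δ_eq : L.δ i.succ y = x
  nonDegenerate : y ∈ L.nonDegenerate _

namespace IsInsertion

variable {W} {Z : Set P} {r : P → P} {d : ℕ} {x : L _⦋d⦌} {y : L _⦋d + 1⦌} {i : Fin (d + 1)}
  (h : W.IsInsertion Z r x y i)

include h

lemma isToggled : IsToggled Z r (W.word y) :=
  ⟨i.castSucc, i.succ, h.isLast, by simp, h.word_succ⟩

lemma word_castSucc : W.word y i.castSucc = W.word x i := by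
  rw [← h.δ_eq, word_δ]
  simp

lemma isLast' : IsLast Z (W.word x) i := by
  rw [← h.δ_eq]
  exact IsLast.δ W h.isLast

lemma unique {y' : L _⦋d + 1⦌} {i' : Fin (d + 1)} (h' : W.IsInsertion Z r x y' i') : y = y' := by
  obtain rfl := h.isLast'.unique h'.isLast'
  refine W.word_injective (funext fun j ↦ ?_)
  rcases Fin.eq_self_or_eq_succAbove i.succ j with rfl | ⟨j, rfl⟩
  · rw [h.word_succ, h'.word_succ, h.word_castSucc, h'.word_castSucc]
  · rw [← word_δ, ← word_δ, h.δ_eq, h'.δ_eq]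

end IsInsertion

include W in
-- For `i < j`, comparing the two faces at position `i` yields the equality of the letters `i` and
-- `i + 1` of `y`. This makes every codimension-one face of a pair unique.
lemma eq_of_δ_eq {d : ℕ} {y : L _⦋d + 1⦌} (hy : y ∈ L.nonDegenerate _) {i j : Fin (d + 2)}
    (h : L.δ i y = L.δ j y) : i = j := by
  wlog hij : i ≤ j generalizing i j
  · exact (this h.symm (le_of_not_ge hij)).symm
  by_contra hne
  have hlt : i < j := lt_of_le_of_ne hij hne
  rw [W.mem_nonDegenerate_iff] at hy
  have hi : i.val < d + 1 := by omega
  refine hy i ⟨i.val + 1, by omega⟩ rfl ?_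
  have := congr_arg (fun z ↦ W.word z ⟨i.val, hi⟩) h
  simp only [word_δ] at this
  rw [Fin.succAbove_of_le_castSucc _ _ (by simp),
    Fin.succAbove_of_castSucc_lt _ _ hlt] at this
  exact this.symm

variable {W} {κ : Set P → Prop} {Z : Set P} {r : P → P}

/-- The last clause of `step` makes the longer word a chain: every letter behind `z` is outside of
`Z`, hence may follow `r z`. -/
lemma Toggle.exists_isInsertion (T : W.Toggle κ Z r) {d : ℕ} (x : L _⦋d⦌)
    (hx : x ∈ L.nonDegenerate _) (hκ : ¬ κ (Set.range (W.word x)))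
    (hx' : ¬ IsToggled Z r (W.word x)) : ∃ y i, W.IsInsertion Z r x y i := by
  obtain ⟨_, ⟨k, rfl⟩, hk⟩ := T.exists_mem (W.good_word x) hκ (W.total_range x)
  obtain ⟨i, hi⟩ := exists_isLast ⟨k, hk⟩
  obtain ⟨h1, h2, h3, h4, h5⟩ := T.step (W.good_word x) hκ (W.total_range x) _ ⟨i, rfl⟩ hi.1
    (W.rel_of_isLast hi)
  let a : Fin (d + 2) → P := Fin.insertNth i.succ (r (W.word x i)) (W.word x)
  have ha : a i.succ = r (W.word x i) := by simp [a]
  have ha' (j : Fin (d + 1)) : a (i.succ.succAbove j) = W.word x j := by simp [a]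
  have hai : a i.castSucc = W.word x i := by
    rw [← ha' i, Fin.succAbove_succ_self]
  have hle : ∀ j : Fin (d + 1), i.succ.succAbove j < i.succ → j ≤ i := by
    intro j hj
    rw [Fin.succAbove_lt_iff_castSucc_lt] at hj
    simp only [Fin.lt_def, Fin.le_def, Fin.val_castSucc, Fin.val_succ] at hj ⊢
    omega
  have hlt : ∀ j : Fin (d + 1), i.succ < i.succ.succAbove j → i < j := by
    intro j hj
    rw [Fin.lt_succAbove_iff_le_castSucc] at hj
    simp only [Fin.lt_def, Fin.le_def, Fin.val_castSucc, Fin.val_succ] at hj ⊢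
    omega
  obtain ⟨y, hy⟩ := W.exists_word a (by
    intro j k hjk
    rcases Fin.eq_self_or_eq_succAbove i.succ j with rfl | ⟨j, rfl⟩ <;>
    rcases Fin.eq_self_or_eq_succAbove i.succ k with rfl | ⟨k, rfl⟩
    · exact W.rel_refl _
    · have hk := hlt k (lt_of_le_of_ne hjk (Fin.succAbove_ne _ _).symm)
      rw [ha, ha']
      exact h5 _ ⟨k, rfl⟩ (hi.2 _ hk) (W.rel_word x _ _ hk.le)
    · have hj := hle j (lt_of_le_of_ne hjk (Fin.succAbove_ne _ _))
      rw [ha, ha']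
      exact W.rel_trans (W.rel_word x _ _ hj) h1
    · rw [ha', ha']
      exact W.rel_word x _ _ ((Fin.strictMono_succAbove i.succ).le_iff_le.1 hjk)) (by
    convert h3
    ext b
    simp only [Set.mem_range, Set.mem_insert_iff]
    rw [Fin.exists_iff_succAbove i.succ, ha]
    simp only [ha', eq_comm])
  refine ⟨y, i, ⟨?_, fun j hj ↦ ?_⟩, by rw [hy, ha, hai], W.word_injective (funext fun j ↦ ?_), ?_⟩
  · rw [hy, hai]
    exact hi.1
  · rw [hy]
    rcases Fin.eq_self_or_eq_succAbove i.succ j with rfl | ⟨j, rfl⟩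
    · rwa [ha]
    · rw [ha']
      refine hi.2 _ (hlt j (lt_of_le_of_ne ?_ (Fin.succAbove_ne _ _).symm))
      simpa [Fin.le_def, Fin.lt_def, Nat.succ_le_iff] using hj
  · rw [word_δ, hy, ha']
  · rw [W.mem_nonDegenerate_iff] at hx ⊢
    rw [hy]
    intro j k hjk heq
    rcases Fin.eq_self_or_eq_succAbove i.succ j with rfl | ⟨j, rfl⟩ <;>
    rcases Fin.eq_self_or_eq_succAbove i.succ k with rfl | ⟨k, rfl⟩
    · omega
    · rw [ha, ha'] at heq
      -- A repetition directly behind the new letter would mean that `x` is already toggled; one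
      -- directly before it would put `r z` into `Z`.
      refine hx' ⟨i, k, hi, ?_, heq.symm⟩
      rw [Fin.succAbove_of_lt_succ _ _ (by
        have := hlt k (by simp only [Fin.lt_def]; omega)
        simp only [Fin.lt_def, Fin.val_succ] at this ⊢
        omega)] at hjk
      simpa using hjk
    · have hj := hle j (by simp only [Fin.lt_def]; omega)
      rw [Fin.succAbove_of_castSucc_lt _ _ (by
        simp only [Fin.lt_def, Fin.le_def, Fin.val_castSucc, Fin.val_succ] at hj ⊢
        omega)] at hjk
      have : j = i := by
        ext
        simpa using hjk.symm
      subst this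
      rw [ha, ha'] at heq
      exact h2 (heq ▸ hi.1)
    · rw [ha', ha'] at heq
      refine hx j k ?_ heq
      have hjk' : j < k := (Fin.strictMono_succAbove i.succ).lt_iff_lt.1 (by
        simp only [Fin.lt_def]; omega)
      simp only [Fin.succAbove, Fin.lt_def, Fin.val_castSucc, Fin.val_succ] at hjk hjk'
      split_ifs at hjk <;> simp only [Fin.val_castSucc, Fin.val_succ] at hjk <;> omega

/-- Inverse to insertion. After deleting `r z` the next letter is outside of `Z`, hence different
from `z`; and it is not `r z`, because `y` is nondegenerate. The clause `¬ κ (S \ {r z})` keeps the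
shorter word outside the subcomplex. -/
lemma Toggle.isInsertion_δ (T : W.Toggle κ Z r) {d : ℕ} {y : L _⦋d + 1⦌} {i : Fin (d + 1)}
    (hy : y ∈ L.nonDegenerate _) (hκ : ¬ κ (Set.range (W.word y)))
    (hi : IsLast Z (W.word y) i.castSucc) (hi' : W.word y i.succ = r (W.word y i.castSucc)) :
    L.δ i.succ y ∈ L.nonDegenerate _ ∧ ¬ κ (Set.range (W.word (L.δ i.succ y))) ∧
      ¬ IsToggled Z r (W.word (L.δ i.succ y)) := by
  obtain ⟨h1, h2, h3, h4, h5⟩ := T.step (W.good_word y) hκ (W.total_range y) _ ⟨_, rfl⟩ hi.1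
    (W.rel_of_isLast hi)
  have hlast := IsLast.δ W hi
  rw [W.mem_nonDegenerate_iff] at hy ⊢
  refine ⟨fun j k hjk heq ↦ ?_, fun h ↦ h4 (T.mono ?_ h), ?_⟩
  · by_cases hji : j = i
    · subst hji
      refine hlast.2 k (by simp only [Fin.lt_def]; omega) ?_
      rw [← heq]
      exact hlast.1
    · rw [word_δ, word_δ] at heq
      refine hy _ _ ?_ heq
      have hji' : j.val ≠ i.val := fun h ↦ hji (Fin.ext h)
      simp only [Fin.succAbove, Fin.lt_def, Fin.val_castSucc, Fin.val_succ]
      split_ifs <;> simp only [Fin.val_castSucc, Fin.val_succ] <;> omega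
  · rintro _ ⟨⟨j, rfl⟩, hj⟩
    rcases Fin.eq_self_or_eq_succAbove i.succ j with rfl | ⟨j, rfl⟩
    · exact (hj hi').elim
    · exact ⟨j, W.word_δ _ _ _⟩
  · rintro ⟨j, k, hj, hjk, heq⟩
    obtain rfl := hlast.unique hj
    rw [word_δ, word_δ, Fin.succAbove_succ_self, Fin.succAbove_of_lt_succ _ _ (by
      simp only [Fin.lt_def, Fin.val_succ]; omega), ← hi'] at heq
    exact hy i.succ k.succ (by simp [hjk]) heq.symm

end WordModel

end SSet

/-! ### The regular pairing of a toggle -/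

namespace SSet

namespace WordModel

variable {L : SSet.{u}} {P : Type*} {W : WordModel L P} {κ : Set P → Prop} {Z : Set P} {r : P → P}

namespace Toggle

variable (T : W.Toggle κ Z r) {A : L.Subcomplex}
  (hA : ∀ (d : ℕ) (x : L _⦋d⦌), x ∈ A.obj _ ↔ κ (Set.range (W.word x)))

/-- The nondegenerate simplices outside of `A` to which a letter gets inserted. -/
abbrev Index (W : WordModel L P) (Z : Set P) (r : P → P) (A : L.Subcomplex) : Type u :=
  Σ d : ℕ, {x : L _⦋d⦌ // x ∈ L.nonDegenerate _ ∧ x ∉ A.obj _ ∧ ¬ IsToggled Z r (W.word x)}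

include T hA in
lemma exists_insertion (s : Index W Z r A) : ∃ y i, W.IsInsertion Z r s.2.1 y i :=
  T.exists_isInsertion _ s.2.2.1 (by rw [← hA]; exact s.2.2.2.1) s.2.2.2.2

/-- The pairing of the simplices outside of `A` given by a toggle. -/
@[simps ι dim]
def pairingCore : A.PairingCore where
  ι := Index W Z r A
  dim s := s.1
  simplex s := (T.exists_insertion hA s).choose
  index s := (T.exists_insertion hA s).choose_spec.choose.succ
  nonDegenerate₁ s := (T.exists_insertion hA s).choose_spec.choose_spec.nonDegenerate
  nonDegenerate₂ s := by
    rw [(T.exists_insertion hA s).choose_spec.choose_spec.δ_eq]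
    exact s.2.2.1
  notMem₁ s h := by
    refine s.2.2.2.1 ?_
    rw [← (T.exists_insertion hA s).choose_spec.choose_spec.δ_eq]
    exact A.map _ h
  notMem₂ s := by
    rw [(T.exists_insertion hA s).choose_spec.choose_spec.δ_eq]
    exact s.2.2.2.1
  injective_type₁' {s t} h := by
    have hs := (T.exists_insertion hA s).choose_spec.choose_spec
    have ht := (T.exists_insertion hA t).choose_spec.choose_spec
    generalize (T.exists_insertion hA s).choose_spec.choose = i at *
    generalize (T.exists_insertion hA t).choose_spec.choose = j at *
    generalize (T.exists_insertion hA s).choose = y at *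
    generalize (T.exists_insertion hA t).choose = z at *
    obtain ⟨d, x, hx⟩ := s
    obtain ⟨e, x', hx'⟩ := t
    obtain rfl : d = e := by simpa using S.dim_eq_of_mk_eq h
    rw [S.ext_iff] at h
    subst h
    obtain rfl : i = j := Fin.castSucc_injective _ (hs.isLast.unique ht.isLast)
    obtain rfl : x = x' := hs.δ_eq.symm.trans ht.δ_eq
    rfl
  injective_type₂' {s t} h := by
    rw [(T.exists_insertion hA s).choose_spec.choose_spec.δ_eq,
      (T.exists_insertion hA t).choose_spec.choose_spec.δ_eq] at h
    obtain ⟨d, x, hx⟩ := s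
    obtain ⟨e, x', hx'⟩ := t
    obtain rfl : d = e := S.dim_eq_of_mk_eq h
    rw [S.ext_iff] at h
    subst h
    rfl
  type₁_ne_type₂' s t h := by
    rw [(T.exists_insertion hA t).choose_spec.choose_spec.δ_eq] at h
    have hs := (T.exists_insertion hA s).choose_spec.choose_spec
    generalize (T.exists_insertion hA s).choose_spec.choose = i at *
    generalize (T.exists_insertion hA s).choose = y at *
    obtain ⟨d, x, hx⟩ := s
    obtain ⟨e, x', hx'⟩ := t
    obtain rfl : d + 1 = e := S.dim_eq_of_mk_eq h
    rw [S.ext_iff] at h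
    subst h
    exact hx'.2.2 hs.isToggled
  surjective' x := by
    obtain ⟨d, y, hy, hyA, rfl⟩ := x.mk_surjective
    by_cases ht : IsToggled Z r (W.word y)
    · obtain ⟨i, j, hi, hij, h⟩ := ht
      obtain _ | d := d
      · omega
      obtain ⟨i, rfl⟩ : ∃ k : Fin (d + 1), k.castSucc = i := ⟨⟨i.val, by omega⟩, rfl⟩
      obtain rfl : j = i.succ := by ext; simpa using hij
      have hδ := T.isInsertion_δ hy (by rwa [← hA]) hi h
      let s : Index W Z r A := ⟨d, L.δ i.succ y, hδ.1, by rw [hA]; exact hδ.2.1, hδ.2.2⟩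
      refine ⟨s, Or.inl ?_⟩
      have hs := (T.exists_insertion hA s).choose_spec.choose_spec
      generalize (T.exists_insertion hA s).choose_spec.choose = k at *
      generalize (T.exists_insertion hA s).choose = z at *
      exact congr_arg S.mk (IsInsertion.unique ⟨hi, h, rfl, hy⟩ hs)
    · refine ⟨⟨d, y, hy, hyA, ht⟩, Or.inr ?_⟩
      rw [(T.exists_insertion hA ⟨d, y, hy, hyA, ht⟩).choose_spec.choose_spec.δ_eq]
      rfl

lemma isInsertion_pairingCore (s : (T.pairingCore hA).ι) :
    ∃ i : Fin (s.1 + 1), (T.pairingCore hA).index s = i.succ ∧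
      W.IsInsertion Z r s.2.1 ((T.pairingCore hA).simplex s) i :=
  ⟨_, rfl, (T.exists_insertion hA s).choose_spec.choose_spec⟩

instance : (T.pairingCore hA).IsProper where
  isUniquelyCodimOneFace s :=
    (S.IsUniquelyCodimOneFace.iff _ _).2 ⟨_, rfl, fun _ hj ↦
      W.eq_of_δ_eq ((T.pairingCore hA).nonDegenerate₁ s) hj⟩

-- A face of `y` other than `x'` arises by deleting a letter different from `r z`. If `z` itself
-- goes, one letter of `Z` is lost, whereas `x'` keeps all of them since `r z ∉ Z`. If another
-- letter goes, then `z` and `r z` remain adjacent and the face is toggled, contrary to `hx`.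
open Classical in
lemma _root_.SSet.WordModel.IsInsertion.sum_lt {d : ℕ} {x x' : L _⦋d⦌} {y : L _⦋d + 1⦌}
    {j : Fin (d + 1)} (h : W.IsInsertion Z r x' y j) (φ : ⦋d⦌ ⟶ ⦋d + 1⦌) (_ : Mono φ)
    (hφ : L.map φ.op y = x) (hne : x ≠ x') (hx : ¬ IsToggled Z r (W.word x)) :
    (∑ k, if W.word x k ∈ Z then 1 else 0) < ∑ k, if W.word x' k ∈ Z then 1 else 0 := by
  obtain ⟨k, rfl⟩ := SimplexCategory.eq_δ_of_mono φ
  replace hφ : L.δ k y = x := hφ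
  have hk : k ≠ j.succ := by
    rintro rfl
    exact hne (hφ.symm.trans h.δ_eq)
  by_cases hk' : k = j.castSucc
  · have h1 := Fin.sum_univ_succAbove (fun k ↦ if W.word y k ∈ Z then 1 else 0) k
    have h2 := Fin.sum_univ_succAbove (fun k ↦ if W.word y k ∈ Z then 1 else 0) j.succ
    simp only [← word_δ] at h1 h2
    rw [hφ, if_pos (by rw [hk']; exact h.isLast.1)] at h1
    rw [h.δ_eq, if_neg (h.isLast.2 _ (by simp [Fin.lt_def]))] at h2
    omega
  · obtain ⟨a, ha⟩ := Fin.exists_succAbove_eq (Ne.symm hk')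
    obtain ⟨b, hb⟩ := Fin.exists_succAbove_eq (Ne.symm hk)
    have hmono := Fin.strictMono_succAbove k
    have ha' : W.word x a = W.word y j.castSucc := by rw [← hφ, word_δ, ha]
    refine (hx ⟨a, b, ⟨?_, fun c hc ↦ ?_⟩, ?_, ?_⟩).elim
    · rw [ha']
      exact h.isLast.1
    · rw [← hφ, word_δ]
      refine h.isLast.2 _ ?_
      rw [← ha]
      exact hmono hc
    · replace ha := congr_arg Fin.val ha
      replace hb := congr_arg Fin.val hb
      have hk₁ : k.val ≠ j.val := fun h ↦ hk' (Fin.ext h)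
      have hk₂ : k.val ≠ j.val + 1 := fun h ↦ hk (Fin.ext h)
      simp only [Fin.succAbove, Fin.lt_def, Fin.val_castSucc, Fin.val_succ] at ha hb
      split_ifs at ha hb <;> simp only [Fin.val_castSucc, Fin.val_succ] at ha hb <;> omega
    · rw [ha', ← h.word_succ, ← hφ, word_δ, hb]

open Classical in
/-- The number of letters in `Z`, as a weak rank function. -/
def weakRankFunction : (T.pairingCore hA).WeakRankFunction ℕ where
  rank s := ∑ k, if W.word s.2.1 k ∈ Z then 1 else 0
  lt {s t} h hd := by
    obtain ⟨i, hi, hs⟩ := T.isInsertion_pairingCore hA s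
    obtain ⟨j, -, ht⟩ := T.isInsertion_pairingCore hA t
    have hle := h.2.le
    rw [Subcomplex.N.le_iff, SSet.N.le_iff_exists_mono] at hle
    obtain ⟨φ, hφ, hφ'⟩ := hle
    replace hφ' : L.map φ.op ((T.pairingCore hA).simplex t) = s.2.1 := by
      refine hφ'.trans ?_
      rw [← hs.δ_eq, ← hi]
      rfl
    have hne := h.1
    clear h hs hi
    generalize (T.pairingCore hA).simplex t = y at *
    obtain ⟨d, x, hx⟩ := s
    obtain ⟨e, x', hx'⟩ := t
    obtain rfl : d = e := hd
    exact ht.sum_lt φ hφ hφ' (fun h ↦ hne (by subst h; rfl)) hx.2.2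

instance : (T.pairingCore hA).IsRegular := (T.weakRankFunction hA).isRegular

lemma _root_.SSet.InnerFibration.exists_lift {X Y : SSet.{u}} (p : X ⟶ Y) [InnerFibration p]
    {n : ℕ} {k : Fin (n + 2)} (h₀ : 0 < k) (h₁ : k < Fin.last _)
    (φ : (Λ[n + 1, k] : SSet.{u}) ⟶ X) (g : Δ[n + 1] ⟶ Y) (comm : φ ≫ p = Λ[n + 1, k].ι ≫ g) :
    ∃ l : Δ[n + 1] ⟶ X, Λ[n + 1, k].ι ≫ l = φ ∧ l ≫ p = g := by
  have := mem_innerFibrations p _ (horn_ι_mem_innerHornInclusions h₀ h₁)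
  let sq : CommSq φ Λ[n + 1, k].ι p g := ⟨comm⟩
  exact ⟨sq.lift, sq.fac_left, sq.fac_right⟩

lemma _root_.SSet.WordModel.word_yonedaEquiv_symm (W : WordModel L P) {n d : ℕ} (y : L _⦋n⦌)
    (z : Δ[n] _⦋d⦌) (j : Fin (d + 1)) :
    W.word ((yonedaEquiv.symm y).app _ z) j = W.word y (z j) :=
  W.word_map (stdSimplex.objEquiv z) y j

@[simp]
lemma _root_.SSet.hornLastEdge_zero (n : ℕ) :
    (hornLastEdge.{u} n).1 0 = (Fin.last (n + 1)).castSucc := rfl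

@[simp]
lemma _root_.SSet.hornLastEdge_one (n : ℕ) :
    (hornLastEdge.{u} n).1 1 = Fin.last (n + 2) := rfl

-- The horn lacks the face opposite to the inserted letter, so it is inner unless `z` is the last
-- letter of `x`. In that case every letter of `x` precedes `z`, the first alternative of `h` is
-- impossible, and the horn is a last horn whose last edge is the Cartesian edge `z → r z`.
include hA in
lemma _root_.SSet.WordModel.IsInsertion.exists_lift {X Y : SSet.{u}} (p : X ⟶ Y) [InnerFibration p]
    (f : (A : SSet.{u}) ⟶ X) (g : L ⟶ Y)
    (h : ∀ S : Set P, W.good S → ¬ κ S → (∀ a ∈ S, ∀ b ∈ S, W.rel a b ∨ W.rel b a) →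
      ∀ z ∈ S, z ∈ Z → (∀ a ∈ S, a ∈ Z → W.rel a z) →
      (∃ b ∈ S, ¬ W.rel b z) ∨ ∃ (e : L _⦋1⦌) (he : e ∈ A.obj _),
        W.word e = ![z, r z] ∧ IsCartesianAlong p g e (f.app _ ⟨e, he⟩))
    {d : ℕ} {x : L _⦋d⦌} {y : L _⦋d + 1⦌} {i : Fin (d + 1)} (hs : W.IsInsertion Z r x y i)
    (hx : x ∉ A.obj _) (φ : (Λ[d + 1, i.succ] : SSet.{u}) ⟶ X)
    (hφ : φ ≫ p = Λ[d + 1, i.succ].ι ≫ yonedaEquiv.symm y ≫ g)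
    (hφ' : ∀ (e : ℕ) (x : Δ[d + 1] _⦋e⦌) (hx : x ∈ Λ[d + 1, i.succ].obj _)
        (hx' : (yonedaEquiv.symm y).app _ x ∈ A.obj _), φ.app _ ⟨x, hx⟩ = f.app _ ⟨_, hx'⟩) :
      ∃ l : Δ[d + 1] ⟶ X, Λ[d + 1, i.succ].ι ≫ l = φ ∧ l ≫ p = yonedaEquiv.symm y ≫ g := by
  by_cases hi : i = Fin.last d
  · subst hi
    obtain ⟨_, ⟨k, rfl⟩, hk⟩ | ⟨e, he, he', hcart⟩ := h _ (W.good_word x)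
      (by rwa [← hA]) (W.total_range x) _ ⟨_, rfl⟩ hs.isLast'.1 (W.rel_of_isLast hs.isLast')
    · exact (hk (W.rel_word x _ _ (Fin.le_last _))).elim
    -- For `d = 0` the simplex `y` would be the edge `e` itself, and its face `x` would lie in `A`.
    obtain _ | n := d
    · obtain rfl : e = y := W.word_injective (by
        rw [he', ← hs.word_castSucc]
        ext j
        fin_cases j
        · rfl
        · exact hs.word_succ.symm)
      refine (hx ?_).elim
      rw [← hs.δ_eq]
      exact A.map _ he
    · have hw : (yonedaEquiv.symm y).app (op ⦋1⦌) (hornLastEdge n).1 = e :=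
        W.word_injective (by
          rw [he', ← hs.word_castSucc]
          ext j
          refine (W.word_yonedaEquiv_symm y _ j).trans ?_
          fin_cases j
          · rfl
          · exact hs.word_succ)
      subst hw
      exact hcart n φ (yonedaEquiv.symm y) hφ rfl
        (hφ' 1 (hornLastEdge n).1 (hornLastEdge n).2 he)
  · exact InnerFibration.exists_lift p (Fin.succ_pos i)
      (by rw [← Fin.succ_last, Fin.succ_lt_succ_iff]; exact Fin.lt_last_iff_ne_last.2 hi) φ _ hφ

include T hA in
/-- Extension along the inclusion of a subcomplex whose complement has a toggle. -/
theorem exists_lift {X Y : SSet.{u}} (p : X ⟶ Y) [InnerFibration p] (f : (A : SSet.{u}) ⟶ X)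
    (g : L ⟶ Y) (comm : f ≫ p = A.ι ≫ g)
    (h : ∀ S : Set P, W.good S → ¬ κ S → (∀ a ∈ S, ∀ b ∈ S, W.rel a b ∨ W.rel b a) →
      ∀ z ∈ S, z ∈ Z → (∀ a ∈ S, a ∈ Z → W.rel a z) →
      (∃ b ∈ S, ¬ W.rel b z) ∨ ∃ (e : L _⦋1⦌) (he : e ∈ A.obj _),
        W.word e = ![z, r z] ∧ IsCartesianAlong p g e (f.app _ ⟨e, he⟩)) :
    ∃ l : L ⟶ X, A.ι ≫ l = f ∧ l ≫ p = g :=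
  (T.pairingCore hA).exists_lift p f g comm fun s φ hφ hφ' ↦
    (T.exists_insertion hA s).choose_spec.choose_spec.exists_lift hA p f g h s.2.2.2.1 φ hφ hφ'

end Toggle
end WordModel
end SSet

/-! ### Word models of simplices, of the walking isomorphism, of products and of subcomplexes -/

namespace SSet

/-- The simplices of `Δ[n]` are the chains in `Fin (n + 1)`. -/
@[simps rel good]
def stdWord (n : ℕ) : WordModel (Δ[n] : SSet.{u}) (Fin (n + 1)) where
  rel a b := a ≤ b
  rel_refl _ := le_rfl
  rel_trans := le_trans
  good _ := True
  good_mono _ _ := trivial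
  word x := x
  word_map _ _ _ := rfl
  word_injective h := DFunLike.coe_injective h
  exists_word a ha _ := ⟨stdSimplex.objMk ⟨a, fun i j h ↦ ha i j h⟩, rfl⟩
  rel_word x _ _ h := stdSimplex.monotone_apply x h
  good_word _ := trivial

@[simp]
lemma stdWord_word {n d : ℕ} (x : (Δ[n] : SSet.{u}) _⦋d⦌) : (stdWord n).word x = x := rfl

/-- The simplices of `coherentIso` are arbitrary words in two letters. -/
@[simps rel good]
def isoWord : WordModel coherentIso.{u} Bool where
  rel _ _ := True
  rel_refl _ := trivial
  rel_trans _ _ := trivial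
  good _ := True
  good_mono _ _ := trivial
  word x i := (x.obj i).as.down
  word_map _ _ _ := rfl
  word_injective h := nerve.ext_of_isThin (funext fun i ↦
    Codiscrete.ext (ULift.ext _ _ (congr_fun h i)))
  exists_word a _ _ := ⟨Codiscrete.functor fun i ↦ ULift.up (a i), rfl⟩
  rel_word _ _ _ _ := trivial
  good_word _ := trivial

namespace WordModel

variable {L M : SSet.{u}} {P Q : Type*} (W : WordModel L P) (V : WordModel M Q)

/-- The word model of a product. -/
@[simps rel good]
def prod : WordModel (L ⊗ M) (P × Q) where
  rel a b := W.rel a.1 b.1 ∧ V.rel a.2 b.2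
  rel_refl _ := ⟨W.rel_refl _, V.rel_refl _⟩
  rel_trans h h' := ⟨W.rel_trans h.1 h'.1, V.rel_trans h.2 h'.2⟩
  good S := W.good (Prod.fst '' S) ∧ V.good (Prod.snd '' S)
  good_mono h h' := ⟨W.good_mono (Set.image_mono h) h'.1, V.good_mono (Set.image_mono h) h'.2⟩
  word x i := (W.word x.1 i, V.word x.2 i)
  word_map φ x i := Prod.ext (W.word_map φ x.1 i) (V.word_map φ x.2 i)
  word_injective h := Prod.ext
    (W.word_injective (funext fun i ↦ congr_arg Prod.fst (congr_fun h i)))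
    (V.word_injective (funext fun i ↦ congr_arg Prod.snd (congr_fun h i)))
  exists_word a ha hg := by
    obtain ⟨x, hx⟩ := W.exists_word (fun i ↦ (a i).1) (fun i j h ↦ (ha i j h).1)
      (by simpa only [← Set.range_comp] using! hg.1)
    obtain ⟨y, hy⟩ := V.exists_word (fun i ↦ (a i).2) (fun i j h ↦ (ha i j h).2)
      (by simpa only [← Set.range_comp] using! hg.2)
    exact ⟨(x, y), funext fun i ↦ Prod.ext (congr_fun hx i) (congr_fun hy i)⟩
  rel_word x i j h := ⟨W.rel_word _ _ _ h, V.rel_word _ _ _ h⟩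
  good_word x := ⟨by simpa only [← Set.range_comp] using! W.good_word x.1,
    by simpa only [← Set.range_comp] using! V.good_word x.2⟩

@[simp]
lemma prod_word {d : ℕ} (x : (L ⊗ M : SSet.{u}) _⦋d⦌) (i : Fin (d + 1)) :
    (W.prod V).word x i = (W.word x.1 i, V.word x.2 i) := rfl

/-- The simplex with a given word. -/
def ofWord {d : ℕ} (a : Fin (d + 1) → P) (ha : ∀ i j, i ≤ j → W.rel (a i) (a j))
    (hg : W.good (Set.range a)) : L _⦋d⦌ :=
  (W.exists_word a ha hg).choose

@[simp]
lemma word_ofWord {d : ℕ} (a : Fin (d + 1) → P) (ha : ∀ i j, i ≤ j → W.rel (a i) (a j))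
    (hg : W.good (Set.range a)) : W.word (W.ofWord a ha hg) = a :=
  (W.exists_word a ha hg).choose_spec

/-- A map of alphabets induces a map of simplicial sets. -/
def hom (θ : P → Q) (hθ : ∀ a b, W.rel a b → V.rel (θ a) (θ b))
    (hg : ∀ S, W.good S → V.good (θ '' S)) : L ⟶ M where
  app d := ↾fun x ↦ V.ofWord (d := d.unop.len) (fun i ↦ θ (W.word (d := d.unop.len) x i))
    (fun i j h ↦ hθ _ _ (W.rel_word _ i j h))
    (by simpa only [← Set.range_comp] using! hg _ (W.good_word (d := d.unop.len) x))
  naturality d e φ := by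
    ext x
    refine V.word_injective (d := e.unop.len) (funext fun i ↦ ?_)
    dsimp
    erw [word_ofWord]
    refine Eq.trans ?_ (V.word_map (d := e.unop.len) (e := d.unop.len) φ.unop _ i).symm
    erw [word_ofWord]
    exact congr_arg θ (W.word_map (d := e.unop.len) (e := d.unop.len) φ.unop _ i)

@[simp]
lemma word_hom (θ : P → Q) (hθ : ∀ a b, W.rel a b → V.rel (θ a) (θ b))
    (hg : ∀ S, W.good S → V.good (θ '' S)) {d : ℕ} (x : L _⦋d⦌) :
    V.word ((W.hom V θ hθ hg).app _ x) = fun i ↦ θ (W.word x i) :=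
  V.word_ofWord _ (fun i j h ↦ hθ _ _ (W.rel_word _ i j h))
    (by simpa only [← Set.range_comp] using! hg _ (W.good_word x))

include V in
lemma hom_ext {f g : L ⟶ M} (h : ∀ (d : ℕ) (x : L _⦋d⦌) (i : Fin (d + 1)),
    V.word (f.app _ x) i = V.word (g.app _ x) i) : f = g := by
  ext ⟨⟨d⟩⟩ x
  exact V.word_injective (funext fun i ↦ h d x i)

/-- The subcomplex of those simplices whose set of letters satisfies `κ`. -/
@[simps]
def sub (κ : Set P → Prop) (hκ : ∀ {S T : Set P}, S ⊆ T → κ T → κ S) : L.Subcomplex where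
  obj d := {x | κ (Set.range (W.word (d := d.unop.len) x))}
  map {d e} φ x hx := by
    refine hκ ?_ hx
    rintro _ ⟨i, rfl⟩
    exact ⟨_, (W.word_map (d := e.unop.len) (e := d.unop.len) φ.unop x i).symm⟩

/-- The word model of the subcomplex `W.sub κ`. -/
@[simps rel good]
def restrict (κ : Set P → Prop) (hκ : ∀ {S T : Set P}, S ⊆ T → κ T → κ S) :
    WordModel (W.sub κ hκ : SSet.{u}) P where
  rel := W.rel
  rel_refl := W.rel_refl
  rel_trans := W.rel_trans
  good S := W.good S ∧ κ S
  good_mono h h' := ⟨W.good_mono h h'.1, hκ h h'.2⟩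
  word x := W.word x.1
  word_map φ x i := W.word_map φ x.1 i
  word_injective h := Subtype.ext (W.word_injective h)
  exists_word a ha hg := ⟨⟨W.ofWord a ha hg.1, by
    change κ _
    rw [W.word_ofWord]
    exact hg.2⟩, W.word_ofWord a ha hg.1⟩
  rel_word x := W.rel_word x.1
  good_word x := ⟨W.good_word x.1, x.2⟩

@[simp]
lemma restrict_word (κ : Set P → Prop) (hκ : ∀ {S T : Set P}, S ⊆ T → κ T → κ S) {d : ℕ}
    (x : (W.sub κ hκ : SSet.{u}) _⦋d⦌) : (W.restrict κ hκ).word x = W.word x.1 := rfl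

variable {W}

/-- Extension from one subcomplex to another when the complement has a toggle. -/
theorem Toggle.exists_lift_sub {κ κ' : Set P → Prop} {hκ : ∀ {S T : Set P}, S ⊆ T → κ T → κ S}
    {hκ' : ∀ {S T : Set P}, S ⊆ T → κ' T → κ' S} {Z : Set P} {r : P → P}
    (T : (W.restrict κ' hκ').Toggle κ Z r) (hle : ∀ S, κ S → κ' S)
    {X Y : SSet.{u}} (p : X ⟶ Y) [InnerFibration p] (f : (W.sub κ hκ : SSet.{u}) ⟶ X)
    (g : L ⟶ Y) (comm : f ≫ p = (W.sub κ hκ).ι ≫ g)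
    (h : ∀ S : Set P, W.good S → κ' S → ¬ κ S → (∀ a ∈ S, ∀ b ∈ S, W.rel a b ∨ W.rel b a) →
      ∀ z ∈ S, z ∈ Z → (∀ a ∈ S, a ∈ Z → W.rel a z) →
      (∃ b ∈ S, ¬ W.rel b z) ∨ ∃ (e : L _⦋1⦌) (he : κ (Set.range (W.word e))),
        W.word e = ![z, r z] ∧ IsCartesianAlong p g e (f.app _ ⟨e, he⟩)) :
    ∃ l : (W.sub κ' hκ' : SSet.{u}) ⟶ X,
      (∀ (d : ℕ) (x : L _⦋d⦌) (hx : κ (Set.range (W.word x))),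
        l.app _ ⟨x, hle _ hx⟩ = f.app (op ⦋d⦌) ⟨x, hx⟩) ∧ l ≫ p = (W.sub κ' hκ').ι ≫ g := by
  let A := (W.sub κ hκ).preimage (W.sub κ' hκ').ι
  obtain ⟨l, hl, hl'⟩ := T.exists_lift (A := A) (fun d x ↦ Iff.rfl) p
    ((W.sub κ hκ).fromPreimage _ ≫ f) ((W.sub κ' hκ').ι ≫ g)
    (by rw [Category.assoc, comm]; rfl) (by
      intro S hS hS' hS'' z hz hz' hz''
      refine (h S hS.1 hS.2 hS' hS'' z hz hz' hz'').imp_right ?_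
      rintro ⟨e, he, hw, hc⟩
      exact ⟨⟨e, hle _ he⟩, he, hw, hc.precomp (W.sub κ' hκ').ι ⟨e, hle _ he⟩ rfl⟩)
  exact ⟨l, fun d x hx ↦
    ConcreteCategory.congr_hom (congr_app hl (op ⦋d⦌)) (⟨⟨x, hle _ hx⟩, hx⟩ : A.toSSet _⦋d⦌), hl'⟩

end WordModel

end SSet

/-! ### Gluing a horn to a triangle along an edge -/

namespace SSet

/-- Gluing of two maps. -/
lemma Subcomplex.exists_glue₂ {L X B₀ B₁ : SSet.{u}} (K : L.Subcomplex) (m₀ : B₀ ⟶ L) (m₁ : B₁ ⟶ L)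
    (f₀ : B₀ ⟶ X) (f₁ : B₁ ⟶ X)
    (hK : ∀ (d : ℕ) (x : L _⦋d⦌), x ∈ K.obj _ → (∃ b, m₀.app _ b = x) ∨ ∃ b, m₁.app _ b = x)
    (h₀ : ∀ (d : ℕ) (b c : B₀ _⦋d⦌), m₀.app _ b = m₀.app _ c → f₀.app _ b = f₀.app _ c)
    (h₁ : ∀ (d : ℕ) (b c : B₁ _⦋d⦌), m₁.app _ b = m₁.app _ c → f₁.app _ b = f₁.app _ c)
    (h₀₁ : ∀ (d : ℕ) (b : B₀ _⦋d⦌) (c : B₁ _⦋d⦌), m₀.app _ b = m₁.app _ c →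
      f₀.app _ b = f₁.app _ c) :
    ∃ g : (K : SSet.{u}) ⟶ X,
      (∀ (d : ℕ) (b : B₀ _⦋d⦌) (hb : m₀.app _ b ∈ K.obj _),
        g.app _ ⟨m₀.app _ b, hb⟩ = f₀.app _ b) ∧
      ∀ (d : ℕ) (b : B₁ _⦋d⦌) (hb : m₁.app _ b ∈ K.obj _),
        g.app _ ⟨m₁.app _ b, hb⟩ = f₁.app _ b := by
  let B (i : Bool) : SSet.{u} := i.rec B₀ B₁
  let m (i : Bool) : B i ⟶ L := i.rec m₀ m₁
  let f (i : Bool) : B i ⟶ X := i.rec f₀ f₁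
  obtain ⟨g, hg⟩ := K.exists_glue B m f
    (fun d x hx ↦ (hK d x hx).elim (fun h ↦ ⟨false, h⟩) (fun h ↦ ⟨true, h⟩)) (by
      rintro (_ | _) (_ | _) d b c h
      exacts [h₀ d b c h, h₀₁ d b c h, (h₀₁ d c b h.symm).symm, h₁ d b c h])
  exact ⟨g, fun d b hb ↦ hg false d b hb, fun d b hb ↦ hg true d b hb⟩

lemma app_app_eq {K L L' M : SSet.{u}} {f : K ⟶ L} {g : L ⟶ M} {f' : K ⟶ L'} {g' : L' ⟶ M}
    (h : f ≫ g = f' ≫ g') {d : ℕ} (x : K _⦋d⦌) :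
    g.app _ (f.app _ x) = g'.app _ (f'.app (op ⦋d⦌) x) :=
  ConcreteCategory.congr_hom (congr_app h (op ⦋d⦌)) x

/-- The map of standard simplices given by a monotone map. -/
def stdMap {m n : ℕ} (θ : Fin (m + 1) → Fin (n + 1)) (hθ : Monotone θ) :
    (Δ[m] : SSet.{u}) ⟶ Δ[n] :=
  SSet.stdSimplex.{u}.map (SimplexCategory.mkHom ⟨θ, hθ⟩)

@[simp]
lemma stdMap_app_apply {m n : ℕ} (θ : Fin (m + 1) → Fin (n + 1)) (hθ : Monotone θ) {d : ℕ}
    (x : (Δ[m] : SSet.{u}) _⦋d⦌) (i : Fin (d + 1)) : (stdMap θ hθ).app _ x i = θ (x i) := rfl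

/-- The edge `f` is Cartesian for those lifting problems whose base factors through `p f`. -/
def IsLocallyCartesianEdge {X A : SSet.{u}} (p : X ⟶ A) (f : X _⦋1⦌) : Prop :=
  IsCartesianAlong p (yonedaEquiv.symm (p.app _ f)) (yonedaEquiv (𝟙 Δ[1])) f

section

variable (n : ℕ)

/-- The inclusion of the last three vertices. -/
def lastThree (j : Fin 3) : Fin (n + 4) := ⟨n + 1 + j, by omega⟩

lemma lastThree_monotone : Monotone (lastThree n) := fun i j h ↦ by
  simp only [lastThree, Fin.le_def] at h ⊢
  omega

/-- The retraction onto the last three vertices. -/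
def toThree (j : Fin (n + 4)) : Fin 3 := ⟨j - (n + 1), by omega⟩

lemma toThree_monotone : Monotone (toThree n) := fun i j h ↦ by
  simp only [toThree, Fin.le_def] at h ⊢
  omega

/-- The union of the face spanned by the last three vertices with the image of the horn under the
`i`-th of the corresponding face inclusions. -/
def spineFamily (i : Fin 3) (S : Set (Fin (n + 4))) : Prop :=
  (lastThree n i ∉ S ∧ ∃ j : Fin (n + 4), j.val < n + 2 ∧ j ∉ S) ∨ ∀ j ∈ S, n + 1 ≤ j.val

lemma spineFamily_mono (i : Fin 3) {S T : Set (Fin (n + 4))} (h : S ⊆ T) :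
    spineFamily n i T → spineFamily n i S := by
  rintro (⟨h₁, j, h₂, h₃⟩ | h₁)
  · exact Or.inl ⟨fun hi ↦ h₁ (h hi), j, h₂, fun hi ↦ h₃ (h hi)⟩
  · exact Or.inr fun j hj ↦ h₁ j (h hj)

variable {n}

lemma app_apply_eq {m n d : ℕ} (t : (Δ[m] : SSet.{u}) ⟶ Δ[n]) (x : Δ[m] _⦋d⦌) (k : Fin (d + 1)) :
    t.app _ x k = yonedaEquiv t (x k) := by
  obtain ⟨z, rfl⟩ := yonedaEquiv.symm.surjective t
  rw [Equiv.apply_symm_apply]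
  exact (stdWord n).word_yonedaEquiv_symm z x k

lemma yonedaEquiv_symm_δ {X : SSet.{u}} {m : ℕ} (i : Fin (m + 2)) (x : X _⦋m + 1⦌) :
    yonedaEquiv.symm (X.δ i x) =
      stdMap i.succAbove (Fin.strictMono_succAbove i).monotone ≫ yonedaEquiv.symm x :=
  (stdSimplex.δ_comp_yonedaEquiv_symm x i).symm

/-- Place `Δⁿ⁺²` as the face of `Δⁿ⁺³` opposite to `lastThree n i`. Its last edge is then an edge of
the final triangle, where the horn and `σ` agree. The base extends over `Δⁿ⁺³` through `toThree`
because it factors through `Δ¹`, and a lift on `Δⁿ⁺³` restricts to one for the horn. For `i = 0` the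
bases would not match: the first vertices would have to go to the vertex `1` of the triangle, but
`toThree` sends them to `0`. -/
lemma exists_spine_glue {X A : SSet.{u}} (p : X ⟶ A) (σ : X _⦋2⦌) (i : Fin 3) (hi : i ≠ 0)
    (a : (Λ[n + 2, Fin.last (n + 2)] : SSet.{u}) ⟶ X) (t : Δ[n + 2] ⟶ Δ[1])
    (comm : a ≫ p = (Λ[n + 2, Fin.last (n + 2)]).ι ≫ t ≫ yonedaEquiv.symm (p.app _ (X.δ i σ)))
    (ht : t.app (op ⦋1⦌) (hornLastEdge n).1 = yonedaEquiv (𝟙 Δ[1]))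
    (ha : a.app (op ⦋1⦌) (hornLastEdge n) = X.δ i σ) :
    ∃ f : ((stdWord (n + 3)).sub (spineFamily n i) (spineFamily_mono n i) : SSet.{u}) ⟶ X,
      (∀ (d : ℕ) (c : Δ[2] _⦋d⦌) (hc), f.app (op ⦋d⦌)
        ⟨(stdMap (lastThree n) (lastThree_monotone n)).app _ c, hc⟩ =
          (yonedaEquiv.symm σ).app _ c) ∧
      f ≫ p = ((stdWord (n + 3)).sub (spineFamily n i) (spineFamily_mono n i)).ι ≫
        stdMap (toThree n) (toThree_monotone n) ≫ yonedaEquiv.symm (p.app _ σ) ∧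
      ∀ l : Δ[n + 3] ⟶ X,
        ((stdWord (n + 3)).sub (spineFamily n i) (spineFamily_mono n i)).ι ≫ l = f →
        l ≫ p = stdMap (toThree n) (toThree_monotone n) ≫ yonedaEquiv.symm (p.app _ σ) →
        ∃ l' : Δ[n + 2] ⟶ X, (Λ[n + 2, Fin.last (n + 2)]).ι ≫ l' = a ∧
          l' ≫ p = t ≫ yonedaEquiv.symm (p.app _ (X.δ i σ)) := by
  let m₀ : (Λ[n + 2, Fin.last (n + 2)] : SSet.{u}) ⟶ Δ[n + 3] := (Λ[n + 2, Fin.last (n + 2)]).ι ≫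
    stdMap (lastThree n i).succAbove (Fin.strictMono_succAbove _).monotone
  let m₁ : Δ[2] ⟶ Δ[n + 3] := stdMap (lastThree n) (lastThree_monotone n)
  have hi' : i.val ≠ 0 := fun h ↦ hi (Fin.ext h)
  have hm₀ (d : ℕ) (b : (Λ[n + 2, Fin.last (n + 2)] : SSet.{u}) _⦋d⦌) (k : Fin (d + 1)) :
      m₀.app _ b k = (lastThree n i).succAbove (b.1 k) := rfl
  have hm₁ (d : ℕ) (c : Δ[2] _⦋d⦌) (k : Fin (d + 1)) : m₁.app _ c k = lastThree n (c k) := rfl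
  -- By monotonicity, the value of `t` on the last edge forces all vertices before the last one to
  -- go to `0`.
  have ht' (v : Fin (n + 3)) : (yonedaEquiv t v).val = v.val - (n + 1) := by
    have h₀ := congr_arg (fun z : (Δ[1] : SSet.{u}) _⦋1⦌ ↦ (z 0).val) ht
    have h₁ := congr_arg (fun z : (Δ[1] : SSet.{u}) _⦋1⦌ ↦ (z 1).val) ht
    dsimp only at h₀ h₁
    rw [app_apply_eq, hornLastEdge_zero] at h₀
    rw [app_apply_eq, hornLastEdge_one] at h₁
    replace h₀ : (yonedaEquiv t (Fin.last (n + 1)).castSucc).val = 0 := h₀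
    replace h₁ : (yonedaEquiv t (Fin.last (n + 2))).val = 1 := h₁
    by_cases hv : v = Fin.last (n + 2)
    · subst hv
      rw [h₁]
      simp
    · have hv' : v.val < n + 2 := by
        have : v.val ≠ n + 2 := fun h ↦ hv (Fin.ext h)
        omega
      have h₂ : yonedaEquiv t v ≤ yonedaEquiv t (Fin.last (n + 1)).castSucc :=
        stdSimplex.monotone_apply (yonedaEquiv t) (Fin.le_def.2 (by simp; omega))
      have : (yonedaEquiv t v).val ≤ 0 := h₀ ▸ Fin.le_def.1 h₂
      omega
  have hbase : stdMap (lastThree n i).succAbove (Fin.strictMono_succAbove _).monotone ≫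
      stdMap (toThree n) (toThree_monotone n) ≫ yonedaEquiv.symm (p.app _ σ) =
        t ≫ yonedaEquiv.symm (p.app _ (X.δ i σ)) := by
    have : p.app _ (X.δ i σ) = A.δ i (p.app _ σ) := NatTrans.naturality_apply p _ _
    rw [this, yonedaEquiv_symm_δ, ← Category.assoc, ← Category.assoc]
    congr 1
    refine (stdWord 2).hom_ext fun d x k ↦ ?_
    refine Fin.ext ?_
    change (toThree n ((lastThree n i).succAbove (x k))).val = (i.succAbove (t.app _ x k)).val
    rw [app_apply_eq]
    have := ht' (x k)
    generalize yonedaEquiv t (x k) = z at this ⊢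
    generalize x k = y at this ⊢
    simp only [toThree, lastThree, Fin.succAbove, Fin.lt_def, Fin.val_castSucc]
    split_ifs <;> simp only [Fin.val_castSucc, Fin.val_succ] <;> omega
  have hcover : ∀ (d : ℕ) (x : (Δ[n + 3] : SSet.{u}) _⦋d⦌),
      spineFamily n i (Set.range x) → (∃ b, m₀.app _ b = x) ∨ ∃ b, m₁.app _ b = x := by
    rintro d x (⟨h₁, j, h₂, h₃⟩ | h)
    · left
      have hx (k : Fin (d + 1)) : ∃ y, (lastThree n i).succAbove y = x k :=
        Fin.exists_succAbove_eq fun h ↦ h₁ ⟨k, h⟩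
      choose y hy using hx
      have hy' : Monotone y := fun k l hkl ↦ by
        rw [← (Fin.strictMono_succAbove (lastThree n i)).le_iff_le, hy, hy]
        exact stdSimplex.monotone_apply x hkl
      refine ⟨⟨stdSimplex.objMk ⟨y, hy'⟩, ?_⟩, stdSimplex.ext _ _ fun k ↦ hy k⟩
      rw [mem_horn_iff_notMem_range]
      refine ⟨⟨j.val, by omega⟩, fun h ↦ ?_, ?_⟩
      · have := congr_arg Fin.val h
        simp at this
        omega
      · rintro ⟨k, hk⟩
        refine h₃ ⟨k, ?_⟩
        rw [← hy]
        replace hk : y k = _ := hk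
        rw [hk, Fin.succAbove_of_castSucc_lt]
        · rfl
        · simp only [lastThree, Fin.lt_def, Fin.val_castSucc]
          omega
    · right
      refine ⟨stdSimplex.objMk ⟨fun k ↦ toThree n (x k),
        (toThree_monotone n).comp (stdSimplex.monotone_apply x)⟩, stdSimplex.ext _ _ fun k ↦ ?_⟩
      have := h _ ⟨k, rfl⟩
      rw [hm₁]
      ext
      change n + 1 + ((x k).val - (n + 1)) = _
      omega
  obtain ⟨f, hf₀, hf₁⟩ := ((stdWord (n + 3)).sub (spineFamily n i)
      (spineFamily_mono n i)).exists_glue₂ m₀ m₁ a (yonedaEquiv.symm σ) hcover (by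
    intro d b c h
    congr 1
    refine Subtype.ext (stdSimplex.ext _ _ fun k ↦ ?_)
    exact Fin.succAbove_right_injective (p := lastThree n i)
      (congr_arg (fun z : (Δ[n + 3] : SSet.{u}) _⦋d⦌ ↦ z k) h)) (by
    intro d b c h
    congr 1
    refine stdSimplex.ext _ _ fun k ↦ ?_
    have := congr_arg (fun z : (Δ[n + 3] : SSet.{u}) _⦋d⦌ ↦ (z k).val) h
    dsimp only at this
    rw [hm₁, hm₁] at this
    simp only [lastThree] at this
    omega) (by
    intro d b c h
    -- On the overlap of the two pieces everything lies on the common edge, and `t` recovers the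
    -- coordinate along it.
    let c' : Δ[1] _⦋d⦌ := t.app _ b.1
    have hbc (k : Fin (d + 1)) : ((lastThree n i).succAbove (b.1 k)).val = (lastThree n (c k)).val :=
      congr_arg (fun z : (Δ[n + 3] : SSet.{u}) _⦋d⦌ ↦ (z k).val) h
    have hc' (k : Fin (d + 1)) : (c' k).val = (b.1 k).val - (n + 1) := by
      rw [← ht']
      exact congr_arg Fin.val (app_apply_eq t b.1 k)
    have h₁ : b = (yonedaEquiv.symm (hornLastEdge n)).app _ c' := by
      refine Subtype.ext (stdSimplex.ext _ _ fun k ↦ ?_)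
      have h₂ : ((yonedaEquiv.symm (hornLastEdge n)).app (op ⦋d⦌) c').1 k =
          (hornLastEdge n).1 (c' k) := by
        have h₃ : yonedaEquiv.symm (hornLastEdge n) ≫ (Λ[n + 2, Fin.last (n + 2)]).ι =
          yonedaEquiv.symm (hornLastEdge n).1 := yonedaEquiv_symm_comp _ _
        refine Eq.trans ?_ ((stdWord (n + 2)).word_yonedaEquiv_symm (hornLastEdge n).1 c' k)
        rw [← h₃]
        rfl
      rw [h₂]
      have h₃ := hbc k
      have h₄ := hc' k
      have h₅ : ((hornLastEdge.{u} n).1 (c' k)).val = n + 1 + (c' k).val := by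
        generalize c' k = z
        fin_cases z <;> rfl
      ext
      rw [h₅, h₄]
      simp only [lastThree, Fin.succAbove, Fin.lt_def, Fin.val_castSucc] at h₃
      split_ifs at h₃ <;> simp only [Fin.val_castSucc, Fin.val_succ] at h₃ <;> omega
    have h₂ : c = (stdMap i.succAbove (Fin.strictMono_succAbove i).monotone).app _ c' := by
      refine stdSimplex.ext _ _ fun k ↦ ?_
      rw [stdMap_app_apply]
      have h₃ := hbc k
      have h₄ := hc' k
      generalize c' k = z at h₄ ⊢
      ext
      simp only [lastThree, Fin.succAbove, Fin.lt_def, Fin.val_castSucc] at h₃ ⊢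
      split_ifs at h₃ ⊢ <;> simp only [Fin.val_castSucc, Fin.val_succ] at h₃ ⊢ <;> omega
    have h₃ : yonedaEquiv.symm (hornLastEdge n) ≫ a =
        stdMap i.succAbove (Fin.strictMono_succAbove i).monotone ≫ yonedaEquiv.symm σ := by
      rw [← yonedaEquiv_symm_δ, ← ha, yonedaEquiv_symm_comp]
    exact (congr_arg (a.app _) h₁).trans ((app_app_eq h₃ c').trans
      (congr_arg ((yonedaEquiv.symm σ).app _) h₂.symm)))
  refine ⟨f, hf₁, ?_, fun l hl hl' ↦
    ⟨stdMap (lastThree n i).succAbove (Fin.strictMono_succAbove _).monotone ≫ l, ?_, ?_⟩⟩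
  · ext ⟨⟨d⟩⟩ ⟨x, hx⟩
    obtain ⟨b, rfl⟩ | ⟨c, rfl⟩ := hcover d x hx
    · refine (congr_arg (p.app _) (hf₀ d b hx)).trans ?_
      refine (ConcreteCategory.congr_hom (congr_app comm (op ⦋d⦌)) b).trans ?_
      exact (ConcreteCategory.congr_hom (congr_app hbase (op ⦋d⦌)) b.1).symm
    · refine (congr_arg (p.app _) (hf₁ d c hx)).trans ?_
      have : stdMap (lastThree n) (lastThree_monotone n) ≫ stdMap (toThree n) (toThree_monotone n) =
          𝟙 (Δ[2] : SSet.{u}) := by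
        refine (stdWord 2).hom_ext fun d x k ↦ Fin.ext ?_
        change n + 1 + (x k).val - (n + 1) = (x k).val
        omega
      have h₁ : yonedaEquiv.symm σ ≫ p = stdMap (lastThree n) (lastThree_monotone n) ≫
          stdMap (toThree n) (toThree_monotone n) ≫ yonedaEquiv.symm (p.app _ σ) := by
        rw [reassoc_of% this, yonedaEquiv_symm_comp]
      exact ConcreteCategory.congr_hom (congr_app h₁ (op ⦋d⦌)) c
  · ext ⟨⟨d⟩⟩ x
    have hx : spineFamily n i (Set.range (m₀.app (op ⦋d⦌) x)) := by
      obtain ⟨j, hj, hj'⟩ := (mem_horn_iff_notMem_range _ _).1 x.2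
      refine Or.inl ⟨?_, ⟨j.val, by omega⟩, ?_, ?_⟩
      · rintro ⟨k, hk⟩
        exact Fin.succAbove_ne _ _ hk
      · have : j.val ≠ n + 2 := fun h ↦ hj (Fin.ext h)
        dsimp only
        omega
      · rintro ⟨k, hk⟩
        refine hj' ⟨k, ?_⟩
        have hj'' : j.val ≠ n + 2 := fun h ↦ hj (Fin.ext h)
        replace hk := congr_arg Fin.val hk
        rw [hm₀] at hk
        ext
        simp only [lastThree, Fin.succAbove, Fin.lt_def, Fin.val_castSucc] at hk
        split_ifs at hk <;> simp only [Fin.val_castSucc, Fin.val_succ] at hk <;> omega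
    refine Eq.trans ?_ (hf₀ d x hx)
    exact (ConcreteCategory.congr_hom (congr_app hl (op ⦋d⦌)) ⟨m₀.app _ x, hx⟩)
  · rw [Category.assoc, hl', hbase]

end

end SSet

/-! ### Composition and cancellation of Cartesian edges -/

namespace SSet

namespace Subcomplex

variable {L X : SSet.{u}} {K : L.Subcomplex}

lemma hom_ext {f g : (K : SSet.{u}) ⟶ X}
    (h : ∀ (d : ℕ) (x : L _⦋d⦌) (hx : x ∈ K.obj _), f.app _ ⟨x, hx⟩ = g.app _ ⟨x, hx⟩) : f = g := by
  ext ⟨⟨d⟩⟩ x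
  exact h d x.1 x.2

lemma app_of_ι_comp_eq {f : (K : SSet.{u}) ⟶ X} {l : L ⟶ X} (h : K.ι ≫ l = f) {d : ℕ}
    (x : L _⦋d⦌) (hx : x ∈ K.obj _) : l.app _ x = f.app _ ⟨x, hx⟩ :=
  ConcreteCategory.congr_hom (congr_app h (op ⦋d⦌)) ⟨x, hx⟩

end Subcomplex

section

variable (n : ℕ)

lemma lastThree_zero : (lastThree n 0).val = n + 1 := rfl

lemma lastThree_one : (lastThree n 1).val = n + 2 := rfl

lemma lastThree_two : (lastThree n 2).val = n + 3 := rfl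

/-- The edge opposite to `i` of the face spanned by the last three vertices. -/
def lastThreeEdge (i : Fin 3) : (Δ[n + 3] : SSet.{u}) _⦋1⦌ :=
  (stdMap (lastThree n) (lastThree_monotone n)).app _
    ((stdMap i.succAbove (Fin.strictMono_succAbove i).monotone).app _ (yonedaEquiv (𝟙 Δ[1])))

lemma lastThreeEdge_word (i : Fin 3) : (stdWord (n + 3)).word (lastThreeEdge.{u} n i) =
    ![lastThree n (i.succAbove 0), lastThree n (i.succAbove 1)] := by
  ext k
  fin_cases k <;> rfl

lemma spineFamily_lastThreeEdge (i j : Fin 3) :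
    spineFamily n i (Set.range ((stdWord (n + 3)).word (lastThreeEdge.{u} n j))) := by
  right
  rintro _ ⟨k, rfl⟩
  exact Nat.le_add_right _ _

/-- The simplices which do not contain all of the vertices `0, …, n + 1`. -/
def partialFamily (S : Set (Fin (n + 4))) : Prop := ∃ j : Fin (n + 4), j.val < n + 2 ∧ j ∉ S

lemma partialFamily_mono {S T : Set (Fin (n + 4))} (h : S ⊆ T) :
    partialFamily n T → partialFamily n S :=
  fun ⟨j, h₁, h₂⟩ ↦ ⟨j, h₁, fun hj ↦ h₂ (h hj)⟩

lemma partialFamily_of_spineFamily (i : Fin 3) (S : Set (Fin (n + 4))) :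
    spineFamily n i S → partialFamily n S :=
  fun h ↦ h.elim (fun h ↦ h.2) fun h ↦ ⟨0, by simp, fun h₀ ↦ by simpa using h _ h₀⟩

variable {n}

lemma yonedaEquiv_symm_app_δ {X : SSet.{u}} {m : ℕ} (i : Fin (m + 2)) (x : X _⦋m + 1⦌) :
    (yonedaEquiv.symm x).app _
      ((stdMap i.succAbove (Fin.strictMono_succAbove i).monotone).app _ (yonedaEquiv (𝟙 Δ[m]))) =
      X.δ i x := by
  have h := yonedaEquiv_symm_δ i x
  have := congr_arg yonedaEquiv h
  rw [Equiv.apply_symm_apply] at this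
  rw [this]
  rfl

variable {X A : SSet.{u}} (p : X ⟶ A) [InnerFibration p]

/-- In a triangle, if the edges `0 ⟶ 1` and `1 ⟶ 2` are Cartesian, then so is `0 ⟶ 2`, locally. -/
lemma IsCartesianEdge.isLocallyCartesianEdge_δ_one (σ : X _⦋2⦌)
    (h₀ : IsCartesianEdge p (X.δ 0 σ)) (h₂ : IsCartesianEdge p (X.δ 2 σ)) :
    IsLocallyCartesianEdge p (X.δ 1 σ) := by
  intro n a t comm ht ha
  obtain ⟨f, hf, hf', hf''⟩ := exists_spine_glue p σ 1 (by simp) a t comm ht ha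
  -- Among the simplices missing one of `0, …, n + 1`, toggle `n + 3` behind `n + 2`. Last horns end
  -- in the edge `n + 2 → n + 3`, which is `δ 0 σ`.
  have T₁ : ((stdWord.{u} (n + 3)).restrict (partialFamily n) (partialFamily_mono n)).Toggle
      (spineFamily n 1) {lastThree n 1} (fun _ ↦ lastThree n 2) :=
    { mono := spineFamily_mono n 1
      exists_mem := by
        rintro S ⟨-, hS⟩ hS' -
        by_contra! h
        exact hS' (Or.inl ⟨fun h' ↦ h _ h' rfl, hS⟩)
      step := by
        rintro S ⟨-, hS⟩ hS' - z hz rfl -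
        refine ⟨?_, ?_, ⟨trivial, ?_⟩, ?_, ?_⟩
        · exact lastThree_monotone n (by simp [Fin.le_def])
        · simp [lastThree]
        · obtain ⟨j, h₁, h₂⟩ := hS
          refine ⟨j, h₁, fun h ↦ h.elim (fun h ↦ ?_) h₂⟩
          rw [h] at h₁
          simp [lastThree] at h₁
        · rintro (⟨h₁, -⟩ | h)
          · exact h₁ ⟨hz, by simp [lastThree]⟩
          · refine hS' (Or.inr fun j hj ↦ ?_)
            by_cases hj' : j = lastThree n 2
            · rw [hj']
              exact Nat.le_add_right _ _
            · exact h j ⟨hj, hj'⟩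
        · intro b _ hb hb'
          simp only [WordModel.restrict_rel, stdWord_rel, Fin.le_def, lastThree_one, lastThree_two,
            Set.mem_singleton_iff, Fin.ext_iff] at hb hb' ⊢
          omega }
  obtain ⟨l₁, hl₁, hl₁'⟩ := T₁.exists_lift_sub (partialFamily_of_spineFamily n 1) p f _ hf' (by
    rintro S - - - - z - rfl -
    refine Or.inr ⟨lastThreeEdge n 0, spineFamily_lastThreeEdge.{u} n _ _, lastThreeEdge_word n _, ?_⟩
    refine IsCartesianEdge.along ?_ _ _
    have := hf 1 _ (spineFamily_lastThreeEdge.{u} n 1 0)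
    rw [yonedaEquiv_symm_app_δ] at this
    exact this.symm ▸ h₀)
  -- The remaining simplices contain `0, …, n + 1`; toggle `n + 2` behind `n + 1`. Last horns end in
  -- `n + 1 → n + 2`, which is `δ 2 σ`.
  have T₂ : (stdWord.{u} (n + 3)).Toggle (partialFamily n) {j | j.val < n + 2}
      (fun _ ↦ lastThree n 1) :=
    { mono := partialFamily_mono n
      exists_mem := by
        rintro S - hS -
        simp only [partialFamily, not_exists, not_and, not_not] at hS
        exact ⟨0, hS 0 (by simp), by simp⟩
      step := by
        rintro S - hS - z hz hz' -
        refine ⟨?_, ?_, trivial, ?_, ?_⟩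
        · simp only [stdWord_rel, Fin.le_def, lastThree_one, Set.mem_ofPred_eq] at hz' ⊢
          omega
        · simp [lastThree]
        · rintro ⟨j, hj, hj'⟩
          refine hS ⟨j, hj, fun h ↦ hj' ⟨h, ?_⟩⟩
          rintro rfl
          simp [lastThree] at hj
        · intro b _ hb hb'
          simp only [stdWord_rel, Fin.le_def, lastThree_one, Set.mem_ofPred_eq] at hb hb' ⊢
          omega }
  obtain ⟨l, hl, hl'⟩ := T₂.exists_lift (A := (stdWord (n + 3)).sub (partialFamily n)
    (partialFamily_mono n)) (fun d x ↦ Iff.rfl) p l₁ _ hl₁' (by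
    rintro S - hS - z - hz hz'
    simp only [partialFamily, not_exists, not_and, not_not] at hS
    obtain rfl : z = lastThree n 0 := by
      have := hz' (lastThree n 0) (hS _ (by simp [lastThree])) (by simp [lastThree])
      simp only [stdWord_rel, Fin.le_def, lastThree_zero, Fin.ext_iff, Set.mem_ofPred_eq] at this hz ⊢
      omega
    refine Or.inr ⟨lastThreeEdge n 2, partialFamily_of_spineFamily n 1 _
      (spineFamily_lastThreeEdge.{u} n _ _), lastThreeEdge_word n _, ?_⟩
    refine IsCartesianEdge.along ?_ _ _
    have := hf 1 _ (spineFamily_lastThreeEdge.{u} n 1 2)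
    rw [yonedaEquiv_symm_app_δ] at this
    rw [hl₁ 1 (lastThreeEdge n 2) (spineFamily_lastThreeEdge.{u} n 1 2)]
    exact this.symm ▸ h₂)
  refine hf'' l ?_ hl'
  exact Subcomplex.hom_ext fun d x hx ↦
    (Subcomplex.app_of_ι_comp_eq hl x (partialFamily_of_spineFamily n 1 _ hx)).trans (hl₁ d x hx)

/-- In a triangle, if the edges `0 ⟶ 2` and `1 ⟶ 2` are Cartesian, then so is `0 ⟶ 1`, locally. -/
lemma IsCartesianEdge.isLocallyCartesianEdge_δ_two (σ : X _⦋2⦌)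
    (h₀ : IsCartesianEdge p (X.δ 0 σ)) (h₁ : IsCartesianEdge p (X.δ 1 σ)) :
    IsLocallyCartesianEdge p (X.δ 2 σ) := by
  intro n a t comm ht ha
  obtain ⟨f, hf, hf', hf''⟩ := exists_spine_glue p σ 2 (by simp) a t comm ht ha
  -- Only inner horns occur here: a partial simplex outside the glued subcomplex contains `n + 3`,
  -- which comes behind the inserted `n + 2`.
  have T₁ : ((stdWord.{u} (n + 3)).restrict (partialFamily n) (partialFamily_mono n)).Toggle
      (spineFamily n 2) {j | j.val < n + 2} (fun _ ↦ lastThree n 1) :=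
    { mono := spineFamily_mono n 2
      exists_mem := by
        rintro S - hS -
        by_contra! h
        exact hS (Or.inr fun j hj ↦ (by simpa using h j hj : n + 2 ≤ j.val).trans' (by simp))
      step := by
        rintro S ⟨-, hS⟩ hS' - z hz hz' -
        refine ⟨?_, ?_, ⟨trivial, ?_⟩, ?_, ?_⟩
        · simp only [WordModel.restrict_rel, stdWord_rel, Fin.le_def, lastThree_one,
            Set.mem_ofPred_eq] at hz' ⊢
          omega
        · simp [lastThree_one]
        · obtain ⟨j, h₁, h₂⟩ := hS
          refine ⟨j, h₁, fun h ↦ h.elim (fun h ↦ ?_) h₂⟩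
          rw [h, lastThree_one] at h₁
          omega
        · rintro (⟨h₁, -⟩ | h)
          · exact hS' (Or.inl ⟨fun h ↦ h₁ ⟨h, by simp [lastThree]⟩, hS⟩)
          · refine hS' (Or.inr fun j hj ↦ ?_)
            by_cases hj' : j = lastThree n 1
            · rw [hj']
              exact Nat.le_add_right _ _
            · exact h j ⟨hj, hj'⟩
        · intro b _ hb hb'
          simp only [WordModel.restrict_rel, stdWord_rel, Fin.le_def, lastThree_one,
            Set.mem_ofPred_eq] at hb hb' ⊢
          omega }
  obtain ⟨l₁, hl₁, hl₁'⟩ := T₁.exists_lift_sub (partialFamily_of_spineFamily n 2) p f _ hf' (by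
    rintro S - hS hS' - z - hz -
    refine Or.inl ⟨lastThree n 2, ?_, ?_⟩
    · by_contra h
      exact hS' (Or.inl ⟨h, hS⟩)
    · simp only [stdWord_rel, Fin.le_def, lastThree_two, Set.mem_ofPred_eq] at hz ⊢
      omega)
  -- Here `n + 3` is toggled behind `n + 1` or `n + 2`, so last horns end in `δ 1 σ` or `δ 0 σ`.
  have T₂ : (stdWord.{u} (n + 3)).Toggle (partialFamily n) {j | j.val < n + 3}
      (fun _ ↦ lastThree n 2) :=
    { mono := partialFamily_mono n
      exists_mem := by
        rintro S - hS -
        simp only [partialFamily, not_exists, not_and, not_not] at hS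
        exact ⟨0, hS 0 (by simp), by simp⟩
      step := by
        rintro S - hS - z hz hz' -
        refine ⟨?_, ?_, trivial, ?_, ?_⟩
        · simp only [stdWord_rel, Fin.le_def, lastThree_two, Set.mem_ofPred_eq] at hz' ⊢
          omega
        · simp [lastThree_two]
        · rintro ⟨j, hj, hj'⟩
          refine hS ⟨j, hj, fun h ↦ hj' ⟨h, ?_⟩⟩
          rintro rfl
          rw [lastThree_two] at hj
          omega
        · intro b _ hb hb'
          simp only [stdWord_rel, Fin.le_def, lastThree_two, Set.mem_ofPred_eq] at hb hb' ⊢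
          omega }
  obtain ⟨l, hl, hl'⟩ := T₂.exists_lift (A := (stdWord (n + 3)).sub (partialFamily n)
    (partialFamily_mono n)) (fun d x ↦ Iff.rfl) p l₁ _ hl₁' (by
    rintro S - hS - z - hz hz'
    simp only [partialFamily, not_exists, not_and, not_not] at hS
    have : z = lastThree n 0 ∨ z = lastThree n 1 := by
      have := hz' (lastThree n 0) (hS _ (by simp [lastThree])) (by simp [lastThree])
      simp only [stdWord_rel, Fin.le_def, lastThree_zero, lastThree_one, Fin.ext_iff,
        Set.mem_ofPred_eq] at this hz ⊢
      omega
    obtain ⟨i, hi, hi'⟩ : ∃ i : Fin 3, IsCartesianEdge p (X.δ i σ) ∧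
        ![lastThree n (i.succAbove 0), lastThree n (i.succAbove 1)] = ![z, lastThree n 2] := by
      obtain rfl | rfl := this
      exacts [⟨1, h₁, rfl⟩, ⟨0, h₀, rfl⟩]
    refine Or.inr ⟨lastThreeEdge n i, partialFamily_of_spineFamily n 2 _
      (spineFamily_lastThreeEdge.{u} n _ _), (lastThreeEdge_word n _).trans hi', ?_⟩
    refine IsCartesianEdge.along ?_ _ _
    have := hf 1 _ (spineFamily_lastThreeEdge.{u} n 2 i)
    rw [yonedaEquiv_symm_app_δ] at this
    rw [hl₁ 1 (lastThreeEdge n i) (spineFamily_lastThreeEdge.{u} n 2 i)]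
    exact this.symm ▸ hi)
  refine hf'' l ?_ hl'
  exact Subcomplex.hom_ext fun d x hx ↦
    (Subcomplex.app_of_ι_comp_eq hl x (partialFamily_of_spineFamily n 2 _ hx)).trans (hl₁ d x hx)

end

end SSet

/-! ### Homotopies between Cartesian edges, and filling of boxes -/

namespace SSet

lemma yonedaEquiv_symm_app_const_one {X : SSet.{u}} {f f' : X _⦋1⦌} (h : X.δ 0 f = X.δ 0 f')
    {d : ℕ} (x : Δ[1] _⦋d⦌) (hx : ∀ k, x k = 1) :
    (yonedaEquiv.symm f).app _ x = (yonedaEquiv.symm f').app _ x := by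
  have hx' : x = (stdMap (0 : Fin 2).succAbove (Fin.strictMono_succAbove _).monotone).app _
      (stdSimplex.objMk ⟨fun _ ↦ (0 : Fin 1), fun _ _ _ ↦ le_rfl⟩) :=
    stdSimplex.ext _ _ fun k ↦ by rw [hx]; rfl
  rw [hx']
  refine app_app_eq ?_ _
  rw [← yonedaEquiv_symm_δ, ← yonedaEquiv_symm_δ, h]

lemma yonedaEquiv_symm_app_yonedaEquiv_id {X : SSet.{u}} {n : ℕ} (x : X _⦋n⦌) :
    (yonedaEquiv.symm x).app _ (yonedaEquiv (𝟙 Δ[n])) = x := by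
  conv_rhs => rw [← yonedaEquiv.apply_symm_apply x]
  rfl

/-- The constant simplices of `coherentIso`. -/
def isoConst (ε : Bool) (d : ℕ) : coherentIso.{u} _⦋d⦌ :=
  isoWord.ofWord (fun _ ↦ ε) (fun _ _ _ ↦ trivial) trivial

@[simp]
lemma word_isoConst (ε : Bool) (d : ℕ) (k : Fin (d + 1)) :
    isoWord.word (isoConst.{u} ε d) k = ε :=
  congr_fun (isoWord.word_ofWord _ _ _) k

/-- The union of the ends and of `coherentIso × {1}` in `coherentIso × Δ¹`. -/
def isoCylinderFamily (S : Set (Bool × Fin 2)) : Prop :=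
  (∀ a ∈ S, a.2 = 1) ∨ ∃ ε, ∀ a ∈ S, a.1 = ε

lemma isoCylinderFamily_mono {S T : Set (Bool × Fin 2)} (h : S ⊆ T) :
    isoCylinderFamily T → isoCylinderFamily S :=
  Or.imp (fun h' a ha ↦ h' a (h ha)) fun ⟨ε, h'⟩ ↦ ⟨ε, fun a ha ↦ h' a (h ha)⟩

/-- When `(ε, 1)` is deleted, the letter `(ε, 0)` remains. It still witnesses the height `0` and the
value `ε`, so the word stays outside the subcomplex. -/
lemma isoCylinderToggle : (isoWord.{u}.prod (stdWord 1)).Toggle isoCylinderFamily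
    {a | a.2 = 0} (fun a ↦ (a.1, 1)) where
  mono := isoCylinderFamily_mono
  exists_mem := by
    rintro S - hS -
    simp only [isoCylinderFamily, not_or, not_forall] at hS
    obtain ⟨a, ha, ha'⟩ := hS.1
    exact ⟨a, ha, by_contra fun h ↦ ha' (Fin.eq_one_of_ne_zero _ h)⟩
  step := by
    rintro S - hS - ⟨ε, j⟩ hz (rfl : j = 0) -
    refine ⟨⟨trivial, by simp⟩, by simp, ⟨trivial, trivial⟩, ?_, ?_⟩
    · have hz' : (ε, 0) ∈ S \ {(ε, (1 : Fin 2))} := ⟨hz, by simp⟩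
      rintro (h | ⟨ε', h⟩)
      · simpa using h _ hz'
      · obtain rfl := h _ hz'
        refine hS (Or.inr ⟨ε, fun a ha ↦ ?_⟩)
        by_cases ha' : a = (ε, 1)
        · rw [ha']
        · exact h a ⟨ha, ha'⟩
    · rintro ⟨ε', j⟩ - hj -
      have hj' : j = 1 := Fin.eq_one_of_ne_zero j hj
      exact ⟨trivial, by simp [hj']⟩

/-- Two Cartesian edges with the same target and the same image are connected by a homotopy
parametrized by `coherentIso` which is constant on the target. -/
lemma exists_iso_homotopy {X A : SSet.{u}} (p : X ⟶ A) [InnerFibration p] (F : Bool → X _⦋1⦌)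
    (g : A _⦋1⦌) (hF : ∀ ε, p.app _ (F ε) = g) (hδ : X.δ 0 (F true) = X.δ 0 (F false))
    (hc : ∀ ε, IsLocallyCartesianEdge p (F ε)) :
    ∃ H : coherentIso.{u} ⊗ Δ[1] ⟶ X,
      H ≫ p = CartesianMonoidalCategory.snd _ _ ≫ yonedaEquiv.symm g ∧
      ∀ (d : ℕ) (z : (coherentIso.{u} ⊗ Δ[1] : SSet.{u}) _⦋d⦌) (ε : Bool),
        ((∀ k, isoWord.word z.1 k = ε) ∨ ∀ k, z.2 k = 1) →
          H.app _ z = (yonedaEquiv.symm (F ε)).app _ z.2 := by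
  have hδ' (ε ε' : Bool) : X.δ 0 (F ε) = X.δ 0 (F ε') := by
    cases ε <;> cases ε' <;> simp [hδ]
  let K := (isoWord.{u}.prod (stdWord 1)).sub isoCylinderFamily isoCylinderFamily_mono
  -- On `K` it does not matter at which letter `F` is evaluated: either the first coordinate is
  -- constant, or `z` lies over the common target. Hence evaluation at the first letter is natural.
  have hK (d : ℕ) (z : (coherentIso.{u} ⊗ Δ[1] : SSet.{u}) _⦋d⦌) (hz : z ∈ K.obj _) (i j) :
      (yonedaEquiv.symm (F (isoWord.word z.1 i))).app _ z.2 =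
        (yonedaEquiv.symm (F (isoWord.word z.1 j))).app _ z.2 := by
    obtain h | ⟨ε, h⟩ := hz
    · exact yonedaEquiv_symm_app_const_one (hδ' _ _) _ fun k ↦ h _ ⟨k, rfl⟩
    · have h₁ : isoWord.word z.1 i = ε := h _ ⟨i, rfl⟩
      have h₂ : isoWord.word z.1 j = ε := h _ ⟨j, rfl⟩
      rw [h₁, h₂]
  let f : (K : SSet.{u}) ⟶ X :=
    { app d := ↾fun z ↦
        (yonedaEquiv.symm (F (isoWord.word (d := d.unop.len) z.1.1 0))).app _ z.1.2
      naturality d e φ := by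
        ext z
        dsimp
        refine (hK e.unop.len _ (K.map φ z.2) 0 0).trans ?_
        have := hK d.unop.len z.1 z.2 (φ.unop.toOrderHom 0) 0
        refine Eq.trans ?_ (congr_arg (X.map φ) this)
        refine Eq.trans ?_ (NatTrans.naturality_apply (yonedaEquiv.symm _) φ z.1.2)
        rfl }
  have hf (d : ℕ) (z : (coherentIso.{u} ⊗ Δ[1] : SSet.{u}) _⦋d⦌) (hz : z ∈ K.obj _) :
      f.app _ ⟨z, hz⟩ = (yonedaEquiv.symm (F (isoWord.word z.1 0))).app _ z.2 := rfl
  obtain ⟨H, hH, hH'⟩ := isoCylinderToggle.exists_lift (A := K) (fun _ _ ↦ Iff.rfl) p f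
    (CartesianMonoidalCategory.snd _ _ ≫ yonedaEquiv.symm g) (by
      refine Subcomplex.hom_ext fun d z hz ↦ ?_
      refine (congr_arg (p.app _) (hf d z hz)).trans ?_
      have : yonedaEquiv.symm (F (isoWord.word z.1 0)) ≫ p = yonedaEquiv.symm g := by
        rw [yonedaEquiv_symm_comp, hF]
      exact ConcreteCategory.congr_hom (congr_app this (op ⦋d⦌)) z.2) (by
      rintro S - - - ⟨ε, j⟩ - (rfl : j = 0) -
      let e : (coherentIso.{u} ⊗ Δ[1] : SSet.{u}) _⦋1⦌ :=
        (isoConst ε 1, yonedaEquiv (𝟙 Δ[1]))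
      have he (k : Fin 2) : isoWord.word e.1 k = ε := word_isoConst ε 1 k
      have heK : e ∈ K.obj _ := Or.inr ⟨ε, by rintro _ ⟨k, rfl⟩; exact he k⟩
      refine Or.inr ⟨e, heK, ?_, ?_⟩
      · ext k : 1
        have : (isoWord.prod (stdWord 1)).word e k = (ε, k) := Prod.ext (he k) rfl
        rw [this]
        fin_cases k <;> rfl
      · have := hc ε
        rw [IsLocallyCartesianEdge, hF] at this
        rw [hf, he, yonedaEquiv_symm_app_yonedaEquiv_id]
        exact this.precomp _ _ rfl)
  refine ⟨H, hH', fun d z ε h ↦ ?_⟩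
  have hz : z ∈ K.obj _ := by
    refine h.symm.imp (fun h ↦ ?_) (fun h ↦ ⟨ε, ?_⟩)
    all_goals
      rintro _ ⟨k, rfl⟩
      exact h k
  rw [Subcomplex.app_of_ι_comp_eq hH z hz, hf]
  obtain h | h := h
  · rw [h]
  · exact yonedaEquiv_symm_app_const_one (hδ' _ _) _ h

/-- The inclusion of the end `{k}` into `Δ¹ × X`. -/
abbrev endInclusion (k : Fin 2) (X : SSet.{u}) : X ⟶ Δ[1] ⊗ X :=
  CartesianMonoidalCategory.lift (SSet.const (stdSimplex.obj₀Equiv.symm k)) (𝟙 X)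

/-- The union of `{1} × Δⁿ` and `Δ¹ × ∂Δⁿ`. -/
def boxFamily (n : ℕ) (S : Set (Fin 2 × Fin (n + 1))) : Prop :=
  (∀ a ∈ S, a.1 = 1) ∨ ∃ j, ∀ a ∈ S, a.2 ≠ j

lemma boxFamily_mono (n : ℕ) {S T : Set (Fin 2 × Fin (n + 1))} (h : S ⊆ T) :
    boxFamily n T → boxFamily n S :=
  Or.imp (fun h' a ha ↦ h' a (h ha)) fun ⟨ε, h'⟩ ↦ ⟨ε, fun a ha ↦ h' a (h ha)⟩

/-- The letter `(0, j)` has the same projection to `Δⁿ` as `(1, j)`, so toggling the latter does not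
change which vertices of `Δⁿ` are hit. -/
lemma boxToggle (n : ℕ) : ((stdWord.{u} 1).prod (stdWord n)).Toggle (boxFamily n)
    {a | a.1 = 0} (fun a ↦ (1, a.2)) where
  mono := boxFamily_mono n
  exists_mem := by
    rintro S - hS -
    simp only [boxFamily, not_or, not_forall] at hS
    obtain ⟨a, ha, ha'⟩ := hS.1
    exact ⟨a, ha, by_contra fun h ↦ ha' (Fin.eq_one_of_ne_zero _ h)⟩
  step := by
    rintro S - hS - ⟨ε, j⟩ hz (rfl : ε = 0) -
    refine ⟨⟨by simp, le_rfl⟩, by simp, ⟨trivial, trivial⟩, ?_, ?_⟩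
    · have hz' : (0, j) ∈ S \ {((1 : Fin 2), j)} := ⟨hz, by simp⟩
      rintro (h | ⟨j', h⟩)
      · simpa using h _ hz'
      · refine hS (Or.inr ⟨j', fun a ha ↦ ?_⟩)
        by_cases ha' : a = (1, j)
        · have : (0, j).2 ≠ j' := h _ hz'
          subst ha'
          exact this
        · exact h a ⟨ha, ha'⟩
    · rintro ⟨ε', j⟩ - hj ⟨-, hj'⟩
      have : ε' = 1 := Fin.eq_one_of_ne_zero _ hj
      exact ⟨by simp [this], hj'⟩

/-- Extension of maps from `{1} × Δⁿ ∪ Δ¹ × ∂Δⁿ` to `Δ¹ × Δⁿ` for `n ≥ 1`. -/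
lemma exists_lift_box {X A : SSet.{u}} (p : X ⟶ A) [InnerFibration p] {n : ℕ}
    (a : Δ[1] ⊗ (∂Δ[n + 1] : SSet.{u}) ⟶ X) (c : Δ[n + 1] ⟶ X) (b : Δ[1] ⊗ Δ[n + 1] ⟶ A)
    (hac : endInclusion 1 _ ≫ a = ∂Δ[n + 1].ι ≫ c) (ha : a ≫ p = (Δ[1] ◁ ∂Δ[n + 1].ι) ≫ b)
    (hc : c ≫ p = endInclusion 1 _ ≫ b)
    (hcart : ∀ e : (Δ[1] ⊗ (∂Δ[n + 1] : SSet.{u}) : SSet.{u}) _⦋1⦌,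
      (∀ k, e.1 k = k) → (∀ k, e.2.1 k = Fin.last (n + 1)) → IsCartesianEdge p (a.app _ e)) :
    ∃ l : Δ[1] ⊗ Δ[n + 1] ⟶ X, (Δ[1] ◁ ∂Δ[n + 1].ι) ≫ l = a ∧ endInclusion 1 _ ≫ l = c ∧
      l ≫ p = b := by
  let W := (stdWord.{u} 1).prod (stdWord (n + 1))
  let K := W.sub (boxFamily (n + 1)) (boxFamily_mono (n + 1))
  have hcover (d : ℕ) (x : (Δ[1] ⊗ Δ[n + 1] : SSet.{u}) _⦋d⦌) (hx : x ∈ K.obj _) :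
      (∃ y, (Δ[1] ◁ ∂Δ[n + 1].ι).app _ y = x) ∨ ∃ y, (endInclusion 1 _).app _ y = x := by
    obtain h | ⟨j, h⟩ := hx
    swap
    · refine Or.inl ⟨(x.1, ⟨x.2, ?_⟩), rfl⟩
      rw [mem_boundary_iff_notMem_range]
      refine ⟨j, ?_⟩
      rintro ⟨k, hk⟩
      exact h _ ⟨k, rfl⟩ hk
    · refine Or.inr ⟨x.2, W.word_injective (funext fun k ↦ Prod.ext ?_ rfl)⟩
      exact (h _ ⟨k, rfl⟩).symm
  have hm₀ (d : ℕ) (y : (Δ[1] ⊗ (∂Δ[n + 1] : SSet.{u}) : SSet.{u}) _⦋d⦌) :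
      (Δ[1] ◁ ∂Δ[n + 1].ι).app _ y ∈ K.obj _ := by
    obtain ⟨j, hj⟩ := (mem_boundary_iff_notMem_range _).1 y.2.2
    refine Or.inr ⟨j, ?_⟩
    rintro _ ⟨k, rfl⟩ hk
    exact hj ⟨k, hk⟩
  have hm₁ (d : ℕ) (y : Δ[n + 1] _⦋d⦌) : (endInclusion.{u} 1 _).app _ y ∈ K.obj _ := by
    left
    rintro _ ⟨k, rfl⟩
    rfl
  obtain ⟨f, hf₀, hf₁⟩ := K.exists_glue₂ (Δ[1] ◁ ∂Δ[n + 1].ι) (endInclusion 1 _) a c hcover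
    (fun d y z h ↦ by
      have h₁ : y.1 = z.1 := congr_arg (fun q : (Δ[1] ⊗ Δ[n + 1] : SSet.{u}) _⦋d⦌ ↦ q.1) h
      have h₂ : y.2.1 = z.2.1 := congr_arg (fun q : (Δ[1] ⊗ Δ[n + 1] : SSet.{u}) _⦋d⦌ ↦ q.2) h
      exact congr_arg (a.app _) (Prod.ext h₁ (Subtype.ext h₂)))
    (fun d y z h ↦ congr_arg (c.app _) (congr_arg Prod.snd h)) (fun d y z h ↦ by
      have h₀ : y.1 = ((endInclusion 1 _).app _ z).1 := congr_arg Prod.fst h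
      have h₁ : y = (endInclusion 1 _).app _ y.2 := Prod.ext h₀ rfl
      have h₂ : z = ∂Δ[n + 1].ι.app _ y.2 := (congr_arg Prod.snd h).symm
      exact (congr_arg (a.app _) h₁).trans ((app_app_eq hac y.2).trans
        (congr_arg (c.app _) h₂.symm)))
  obtain ⟨l, hl, hl'⟩ := (boxToggle (n + 1)).exists_lift (A := K) (fun _ _ ↦ Iff.rfl) p f b (by
    refine Subcomplex.hom_ext fun d x hx ↦ ?_
    obtain ⟨y, rfl⟩ | ⟨y, rfl⟩ := hcover d x hx
    · exact (congr_arg (p.app _) (hf₀ d y hx)).trans (app_app_eq ha y)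
    · exact (congr_arg (p.app _) (hf₁ d y hx)).trans (app_app_eq hc y)) (by
    rintro S - hS - ⟨ε, j⟩ hz (rfl : ε = 0) -
    -- The words in question hit every vertex of `Δⁿ⁺¹`. If `j` is not the last one, a later letter
    -- follows and the horn is inner. If it is, the last edge lies over a single vertex, which
    -- belongs to the boundary because `n + 1 ≥ 1`.
    by_cases hj : j = Fin.last (n + 1)
    · subst hj
      let e : (Δ[1] ⊗ (∂Δ[n + 1] : SSet.{u}) : SSet.{u}) _⦋1⦌ :=
        (yonedaEquiv (𝟙 Δ[1]), ⟨stdSimplex.const _ (Fin.last (n + 1)) _, by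
          rw [mem_boundary_iff_notMem_range]
          refine ⟨0, ?_⟩
          rintro ⟨k, hk⟩
          exact (Fin.last_pos).ne hk.symm⟩)
      refine Or.inr ⟨(Δ[1] ◁ ∂Δ[n + 1].ι).app _ e, hm₀ 1 e, ?_, ?_⟩
      · ext k : 1
        fin_cases k <;> rfl
      · rw [hf₀]
        exact (hcart e (fun _ ↦ rfl) (fun _ ↦ rfl)).along _ _
    · simp only [boxFamily, not_or, not_exists, not_forall, not_not] at hS
      obtain ⟨a, ha, ha'⟩ := hS.2 (Fin.last (n + 1))
      refine Or.inl ⟨a, ha, fun h ↦ hj ?_⟩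
      exact le_antisymm (Fin.le_last _) (ha' ▸ h.2))
  refine ⟨l, ?_, ?_, hl'⟩
  · ext ⟨⟨d⟩⟩ y
    exact (Subcomplex.app_of_ι_comp_eq hl _ (hm₀ d y)).trans (hf₀ d y _)
  · ext ⟨⟨d⟩⟩ y
    exact (Subcomplex.app_of_ι_comp_eq hl _ (hm₁ d y)).trans (hf₁ d y _)

end SSet

/-! ### Homotopy extension along the walking isomorphism -/

namespace SSet

section HomotopyExtension

variable {n : ℕ} (v : Bool) (𝓚 𝓚' : Set (Fin (n + 1)) → Prop)

/-- Words in `coherentIso × Δⁿ` with support in `𝓚'` that are constant with value `v`, have support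
in `𝓚`, or have support in `{0, …, m - 1}`. -/
def hepFamily (m : ℕ) (S : Set (Bool × Fin (n + 1))) : Prop :=
  𝓚' (Prod.snd '' S) ∧ ((∀ a ∈ S, a.1 = v) ∨ 𝓚 (Prod.snd '' S) ∨ ∀ a ∈ S, a.2.val < m)

/-- An intermediate step between `hepFamily m` and `hepFamily (m + 1)`. -/
def hepMidFamily (m : ℕ) (S : Set (Bool × Fin (n + 1))) : Prop :=
  𝓚' (Prod.snd '' S) ∧ ((∀ a ∈ S, a.1 = v) ∨ 𝓚 (Prod.snd '' S) ∨ (∀ a ∈ S, a.2.val < m) ∨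
    ((∀ a ∈ S, a.2.val ≤ m) ∧ ∀ a ∈ S, a.2.val < m → a.1 = v))

variable (h𝓚 : ∀ {S T : Set (Fin (n + 1))}, S ⊆ T → 𝓚 T → 𝓚 S)
  (h𝓚' : ∀ {S T : Set (Fin (n + 1))}, S ⊆ T → 𝓚' T → 𝓚' S)
  (hs : ∀ S : Set (Fin (n + 1)), S.Subsingleton → 𝓚 S)

include h𝓚 h𝓚' in
lemma hepFamily_mono (m : ℕ) {S T : Set (Bool × Fin (n + 1))} (h : S ⊆ T) :
    hepFamily v 𝓚 𝓚' m T → hepFamily v 𝓚 𝓚' m S :=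
  And.imp (h𝓚' (Set.image_mono h)) (Or.imp (fun h' a ha ↦ h' a (h ha))
    (Or.imp (h𝓚 (Set.image_mono h)) (fun h' a ha ↦ h' a (h ha))))

include h𝓚 h𝓚' in
lemma hepMidFamily_mono (m : ℕ) {S T : Set (Bool × Fin (n + 1))} (h : S ⊆ T) :
    hepMidFamily v 𝓚 𝓚' m T → hepMidFamily v 𝓚 𝓚' m S :=
  And.imp (h𝓚' (Set.image_mono h)) (Or.imp (fun h' a ha ↦ h' a (h ha))
    (Or.imp (h𝓚 (Set.image_mono h)) (Or.imp (fun h' a ha ↦ h' a (h ha))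
      (And.imp (fun h' a ha ↦ h' a (h ha)) (fun h' a ha ↦ h' a (h ha))))))

lemma image_snd_diff {S : Set (Bool × Fin (n + 1))} {a b : Bool × Fin (n + 1)} (hb : b ∈ S)
    (hab : b.2 = a.2) (hne : b ≠ a) : Prod.snd '' (S \ {a}) = Prod.snd '' S := by
  refine (Set.image_mono Set.sdiff_subset).antisymm ?_
  rintro _ ⟨c, hc, rfl⟩
  by_cases hca : c = a
  · exact ⟨b, ⟨hb, hne⟩, by rw [hca, hab]⟩
  · exact ⟨c, ⟨hc, hca⟩, rfl⟩

lemma image_snd_insert {S : Set (Bool × Fin (n + 1))} {a b : Bool × Fin (n + 1)} (hb : b ∈ S)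
    (hab : b.2 = a.2) : Prod.snd '' (insert a S) = Prod.snd '' S := by
  rw [Set.image_insert_eq]
  exact Set.insert_eq_of_mem ⟨b, hb, hab⟩

variable {v 𝓚 𝓚'}

-- A letter `(v, c)` with `c < m` must occur: otherwise the support would be the single vertex `m`,
-- which belongs to `𝓚` by `hs`.
include hs in
lemma of_hepMidFamily {m : ℕ} {S : Set (Bool × Fin (n + 1))} (hS : hepMidFamily v 𝓚 𝓚' m S)
    (hS' : ¬ hepFamily v 𝓚 𝓚' m S) :
    𝓚' (Prod.snd '' S) ∧ ¬ 𝓚 (Prod.snd '' S) ∧ (∀ a ∈ S, a.2.val ≤ m) ∧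
      (∀ a ∈ S, a.2.val < m → a.1 = v) ∧ (∃ a ∈ S, a.1 = !v ∧ a.2.val = m) ∧
      ∃ a ∈ S, a.1 = v ∧ a.2.val < m := by
  obtain ⟨h₀, h₁ | h₁ | h₁ | ⟨h₁, h₂⟩⟩ := hS
  · exact (hS' ⟨h₀, Or.inl h₁⟩).elim
  · exact (hS' ⟨h₀, Or.inr (Or.inl h₁)⟩).elim
  · exact (hS' ⟨h₀, Or.inr (Or.inr h₁)⟩).elim
  simp only [hepFamily, not_and, not_or, not_forall] at hS'
  obtain ⟨⟨a, ha, ha'⟩, h₃, -⟩ := hS' h₀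
  refine ⟨h₀, h₃, h₁, h₂, ⟨a, ha, ?_, ?_⟩, ?_⟩
  · cases h : a.1 <;> cases v <;> simp_all
  · exact le_antisymm (h₁ a ha) (not_lt.1 fun h ↦ ha' (h₂ a ha h))
  · by_contra! h₄
    refine h₃ (hs _ ?_)
    rintro _ ⟨b, hb, rfl⟩ _ ⟨c, hc, rfl⟩
    have key : ∀ b ∈ S, b.2.val = m := fun b hb ↦ le_antisymm (h₁ b hb) (not_lt.1 fun h ↦
      absurd h (not_lt.2 (h₄ b hb (h₂ b hb h))))
    exact Fin.ext ((key b hb).trans (key c hc).symm)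

lemma of_hepFamily_succ {m : ℕ} {S : Set (Bool × Fin (n + 1))} (hS : hepFamily v 𝓚 𝓚' (m + 1) S)
    (hS' : ¬ hepMidFamily v 𝓚 𝓚' m S) :
    𝓚' (Prod.snd '' S) ∧ ¬ 𝓚 (Prod.snd '' S) ∧ (∀ a ∈ S, a.2.val ≤ m) ∧
      (∃ a ∈ S, a.2.val = m) ∧ ∃ a ∈ S, a.1 = !v ∧ a.2.val < m := by
  obtain ⟨h₀, h₁ | h₁ | h₁⟩ := hS
  · exact (hS' ⟨h₀, Or.inl h₁⟩).elim
  · exact (hS' ⟨h₀, Or.inr (Or.inl h₁)⟩).elim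
  simp only [hepMidFamily, not_and, not_or, not_forall] at hS'
  obtain ⟨h₂, h₃, ⟨a, ha, ha'⟩, h₄⟩ := hS' h₀
  have h₁' (a) (ha : a ∈ S) : a.2.val ≤ m := Nat.lt_succ_iff.1 (h₁ a ha)
  obtain ⟨b, hb, hb', hb''⟩ := h₄ h₁'
  refine ⟨h₀, h₃, h₁', ⟨a, ha, le_antisymm (h₁' a ha) (not_lt.1 ha')⟩, b, hb, ?_, hb'⟩
  cases h : b.1 <;> cases v <;> simp_all

-- A letter `(!v, m)` is always present. It lies over the same vertex as the toggled `(v, m)`, so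
-- supports do not change, and it comes behind the last letter of `Z`, so only inner horns are
-- needed.
include hs in
lemma hepMidToggle {m : ℕ} (hm : m < n + 1) :
    ((isoWord.{u}.prod (stdWord n)).restrict (hepMidFamily v 𝓚 𝓚' m)
      (hepMidFamily_mono v 𝓚 𝓚' h𝓚 h𝓚' m)).Toggle (hepFamily v 𝓚 𝓚' m)
      {a | a.1 = v ∧ a.2.val < m} (fun _ ↦ (v, ⟨m, hm⟩)) where
  mono := hepFamily_mono v 𝓚 𝓚' h𝓚 h𝓚' m
  exists_mem := by
    rintro S ⟨-, hS⟩ hS' -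
    exact (of_hepMidFamily hs hS hS').2.2.2.2.2
  step := by
    rintro S ⟨-, hS⟩ hS' - z hz ⟨hz', hz''⟩ -
    obtain ⟨h₀, h₁, h₂, h₃, ⟨a, ha, ha', ha''⟩, -⟩ := of_hepMidFamily hs hS hS'
    have hne : a ≠ (v, ⟨m, hm⟩) := fun h ↦ by simp [h] at ha'
    have ham : a.2 = (v, (⟨m, hm⟩ : Fin (n + 1))).2 := Fin.ext ha''
    refine ⟨⟨trivial, Fin.le_def.2 hz''.le⟩, fun h ↦ lt_irrefl _ h.2,
      ⟨⟨trivial, trivial⟩, ?_, Or.inr (Or.inr (Or.inr ⟨?_, ?_⟩))⟩, ?_, ?_⟩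
    · rwa [image_snd_insert ha ham]
    · rintro b (rfl | hb)
      exacts [le_rfl, h₂ b hb]
    · rintro b (rfl | hb) hb'
      exacts [rfl, h₃ b hb hb']
    · rintro ⟨-, h | h | h⟩
      · simp [h a ⟨ha, hne⟩] at ha'
      · rw [image_snd_diff ha ham hne] at h
        exact h₁ h
      · exact (h a ⟨ha, hne⟩).ne ha''
    · rintro b hb hb' -
      refine ⟨trivial, Fin.le_def.2 (not_lt.1 fun h ↦ hb' ⟨h₃ b hb h, h⟩)⟩

/-- The toggled letter lies over the same vertex as the letter before it, so supports do not change;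
a letter over `m` comes later, so again only inner horns are needed. -/
lemma hepSuccToggle {m : ℕ} :
    ((isoWord.{u}.prod (stdWord n)).restrict (hepFamily v 𝓚 𝓚' (m + 1))
      (hepFamily_mono v 𝓚 𝓚' h𝓚 h𝓚' (m + 1))).Toggle (hepMidFamily v 𝓚 𝓚' m)
      {a | a.1 = !v ∧ a.2.val < m} (fun a ↦ (v, a.2)) where
  mono := hepMidFamily_mono v 𝓚 𝓚' h𝓚 h𝓚' m
  exists_mem := by
    rintro S ⟨-, hS⟩ hS' -
    exact (of_hepFamily_succ hS hS').2.2.2.2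
  step := by
    rintro S ⟨-, hS⟩ hS' - z hz ⟨hz', hz''⟩ -
    obtain ⟨h₀, h₁, h₂, ⟨a, ha, ha'⟩, -⟩ := of_hepFamily_succ hS hS'
    have hne : z ≠ (v, z.2) := fun h ↦ by rw [h] at hz'; simp at hz'
    have hne' : a ≠ (v, z.2) := fun h ↦ by rw [h] at ha'; exact hz''.ne ha'
    refine ⟨⟨trivial, le_rfl⟩, fun h ↦ by simpa using h.1,
      ⟨⟨trivial, trivial⟩, ?_, Or.inr (Or.inr ?_)⟩, ?_, ?_⟩
    · rwa [image_snd_insert (a := (v, z.2)) hz rfl]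
    · rintro b (rfl | hb)
      exacts [Nat.lt_succ_of_lt hz'', Nat.lt_succ_of_le (h₂ b hb)]
    · rintro ⟨-, h | h | h | ⟨-, h⟩⟩
      · simp [h z ⟨hz, hne⟩] at hz'
      · rw [image_snd_diff (a := (v, z.2)) hz rfl hne] at h
        exact h₁ h
      · exact (h a ⟨ha, hne'⟩).ne ha'
      · simp [h z ⟨hz, hne⟩ hz''] at hz'
    · rintro b hb hb' h
      exact ⟨trivial, h.2⟩

variable (v)

/-- The words with support in `𝓚'` which are constant with value `v` or have support in `𝓚`. -/
def isoBoxFamily (𝓚 𝓚' : Set (Fin (n + 1)) → Prop) (S : Set (Bool × Fin (n + 1))) : Prop :=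
  𝓚' (Prod.snd '' S) ∧ ((∀ a ∈ S, a.1 = v) ∨ 𝓚 (Prod.snd '' S))

include h𝓚 h𝓚' in
lemma isoBoxFamily_mono {S T : Set (Bool × Fin (n + 1))} (h : S ⊆ T) :
    isoBoxFamily v 𝓚 𝓚' T → isoBoxFamily v 𝓚 𝓚' S :=
  And.imp (h𝓚' (Set.image_mono h)) (Or.imp (fun h' a ha ↦ h' a (h ha)) (h𝓚 (Set.image_mono h)))

include hs in
/-- Homotopy extension for homotopies parametrized by `coherentIso`. -/
theorem exists_iso_homotopy_extension {X A : SSet.{u}} (p : X ⟶ A) [InnerFibration p]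
    (f : ((isoWord.{u}.prod (stdWord n)).sub (isoBoxFamily v 𝓚 𝓚')
      (isoBoxFamily_mono v h𝓚 h𝓚') : SSet.{u}) ⟶ X)
    (g : coherentIso.{u} ⊗ Δ[n] ⟶ A)
    (comm : f ≫ p = ((isoWord.{u}.prod (stdWord n)).sub (isoBoxFamily v 𝓚 𝓚')
      (isoBoxFamily_mono v h𝓚 h𝓚')).ι ≫ g) :
    ∃ l : ((isoWord.{u}.prod (stdWord n)).sub (fun S ↦ 𝓚' (Prod.snd '' S))
        (fun h ↦ h𝓚' (Set.image_mono h)) : SSet.{u}) ⟶ X,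
      (∀ (d : ℕ) (x : (coherentIso.{u} ⊗ Δ[n] : SSet.{u}) _⦋d⦌)
        (hx : isoBoxFamily v 𝓚 𝓚' (Set.range ((isoWord.{u}.prod (stdWord n)).word x))),
        l.app _ ⟨x, hx.1⟩ = f.app (op ⦋d⦌) ⟨x, hx⟩) ∧
      l ≫ p = ((isoWord.{u}.prod (stdWord n)).sub (fun S ↦ 𝓚' (Prod.snd '' S))
        (fun h ↦ h𝓚' (Set.image_mono h))).ι ≫ g := by
  have hle (m : ℕ) (S : Set (Bool × Fin (n + 1))) :
      isoBoxFamily v 𝓚 𝓚' S → hepFamily v 𝓚 𝓚' m S := And.imp_right (Or.imp_right Or.inl)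
  have key (m : ℕ) (hm : m ≤ n + 1) :
      ∃ l : ((isoWord.{u}.prod (stdWord n)).sub (hepFamily v 𝓚 𝓚' m)
        (hepFamily_mono v 𝓚 𝓚' h𝓚 h𝓚' m) : SSet.{u}) ⟶ X,
      (∀ (d : ℕ) (x : (coherentIso.{u} ⊗ Δ[n] : SSet.{u}) _⦋d⦌)
        (hx : isoBoxFamily v 𝓚 𝓚' (Set.range ((isoWord.{u}.prod (stdWord n)).word x))),
        l.app _ ⟨x, hle m _ hx⟩ = f.app (op ⦋d⦌) ⟨x, hx⟩) ∧
      l ≫ p = ((isoWord.{u}.prod (stdWord n)).sub (hepFamily v 𝓚 𝓚' m)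
        (hepFamily_mono v 𝓚 𝓚' h𝓚 h𝓚' m)).ι ≫ g := by
    induction m with
    | zero =>
      -- Words are nonempty, so for `m = 0` the third alternative of `hepFamily` is void.
      refine ⟨Subcomplex.homOfLE ?_ ≫ f, fun d x hx ↦ rfl, by rw [Category.assoc, comm]; rfl⟩
      rintro d x ⟨h₀, h₁ | h₁ | h₁⟩
      · exact ⟨h₀, Or.inl h₁⟩
      · exact ⟨h₀, Or.inr h₁⟩
      · exact (Nat.not_lt_zero _ (h₁ _ ⟨0, rfl⟩)).elim
    | succ m ih =>
      obtain ⟨l₀, hl₀, hl₀'⟩ := ih (by omega)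
      obtain ⟨l₁, hl₁, hl₁'⟩ := (hepMidToggle h𝓚 h𝓚' hs (v := v) (m := m) hm).exists_lift_sub
        (κ := hepFamily v 𝓚 𝓚' m) (fun S ↦ And.imp_right (Or.imp_right (Or.imp_right Or.inl))) p l₀ g
        hl₀' (by
          rintro S - hS hS' - z - ⟨-, hz⟩ -
          obtain ⟨h₀, h₁, h₂, h₃, ⟨a, ha, ha', ha''⟩, -⟩ := of_hepMidFamily hs hS hS'
          refine Or.inl ⟨a, ha, fun h ↦ absurd (Fin.le_def.1 h.2) ?_⟩
          omega)
      obtain ⟨l₂, hl₂, hl₂'⟩ := (hepSuccToggle h𝓚 h𝓚' (v := v) (m := m)).exists_lift_sub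
        (κ := hepMidFamily v 𝓚 𝓚' m) (by
          rintro S ⟨h₀, h₁ | h₁ | h₁ | ⟨h₁, -⟩⟩
          · exact ⟨h₀, Or.inl h₁⟩
          · exact ⟨h₀, Or.inr (Or.inl h₁)⟩
          · exact ⟨h₀, Or.inr (Or.inr fun a ha ↦ Nat.lt_succ_of_lt (h₁ a ha))⟩
          · exact ⟨h₀, Or.inr (Or.inr fun a ha ↦ Nat.lt_succ_of_le (h₁ a ha))⟩) p l₁ g
        hl₁' (by
          rintro S - hS hS' - z - ⟨-, hz⟩ -
          obtain ⟨h₀, h₁, h₂, ⟨a, ha, ha'⟩, -⟩ := of_hepFamily_succ hS hS'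
          refine Or.inl ⟨a, ha, fun h ↦ absurd (Fin.le_def.1 h.2) ?_⟩
          omega)
      refine ⟨l₂, fun d x hx ↦ ?_, hl₂'⟩
      exact (hl₂ d x (And.imp_right (Or.imp_right Or.inl) hx)).trans
        ((hl₁ d x (hle m _ hx)).trans (hl₀ d x hx))
  obtain ⟨l, hl, hl'⟩ := key (n + 1) le_rfl
  have hle' : (isoWord.{u}.prod (stdWord n)).sub (fun S ↦ 𝓚' (Prod.snd '' S))
        (fun h ↦ h𝓚' (Set.image_mono h)) ≤ (isoWord.{u}.prod (stdWord n)).sub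
          (hepFamily v 𝓚 𝓚' (n + 1)) (hepFamily_mono v 𝓚 𝓚' h𝓚 h𝓚' (n + 1)) :=
    fun d x hx ↦ ⟨hx, Or.inr (Or.inr fun a _ ↦ a.2.isLt)⟩
  exact ⟨Subcomplex.homOfLE hle' ≫ l, hl, by rw [Category.assoc, hl']; rfl⟩

end HomotopyExtension

end SSet

/-! ### Transport of horn problems along homotopies -/

namespace SSet

/-- A map with image in a subcomplex, as a map to the subcomplex. -/
@[simps]
def Subcomplex.factor {K L : SSet.{u}} (f : K ⟶ L) (B : L.Subcomplex)
    (h : ∀ (d : ℕ) (x : K _⦋d⦌), f.app _ x ∈ B.obj _) : K ⟶ (B : SSet.{u}) where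
  app d := ↾fun x ↦ ⟨f.app _ x, h d.unop.len x⟩
  naturality d e φ := by
    ext x
    refine Subtype.ext ?_
    exact NatTrans.naturality_apply f φ x

/-- The inclusion of one of the ends of `coherentIso × K`. -/
abbrev isoEnd (ε : Bool) (K : SSet.{u}) : K ⟶ coherentIso.{u} ⊗ K :=
  CartesianMonoidalCategory.lift (SSet.const (isoConst ε 0)) (𝟙 K)

lemma word_isoEnd (ε : Bool) (K : SSet.{u}) {d : ℕ} (x : K _⦋d⦌) (k : Fin (d + 1)) :
    isoWord.word ((isoEnd ε K).app _ x).1 k = ε :=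
  (isoWord.word_map _ (isoConst ε 0) k).trans (word_isoConst _ _ _)

lemma isoEnd_app_eq (ε : Bool) (K : SSet.{u}) {d : ℕ} (z : (coherentIso.{u} ⊗ K : SSet.{u}) _⦋d⦌)
    (hz : ∀ k, isoWord.word z.1 k = ε) : (isoEnd ε K).app _ z.2 = z :=
  Prod.ext (isoWord.word_injective (funext fun k ↦ (word_isoEnd ε K z.2 k).trans (hz k).symm)) rfl

/-- The supports of the simplices of the horn `Λⁿₙ`. -/
def lastHornFamily (n : ℕ) (S : Set (Fin (n + 1))) : Prop := ∃ j, j ≠ Fin.last n ∧ j ∉ S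

lemma lastHornFamily_mono (n : ℕ) {S T : Set (Fin (n + 1))} (h : S ⊆ T) :
    lastHornFamily n T → lastHornFamily n S :=
  fun ⟨j, h₁, h₂⟩ ↦ ⟨j, h₁, fun hj ↦ h₂ (h hj)⟩

lemma mem_lastHorn_iff {n d : ℕ} (x : (Δ[n] : SSet.{u}) _⦋d⦌) :
    x ∈ (Λ[n, Fin.last n]).obj _ ↔ lastHornFamily n (Set.range x) := by
  rw [mem_horn_iff_notMem_range]
  simp only [lastHornFamily, exists_prop]

/-- In dimension at least two the vertices `0` and `1` both differ from the last one, and a single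
vertex misses one of them. -/
lemma lastHornFamily_of_subsingleton {n : ℕ} {S : Set (Fin (n + 3))} (hS : S.Subsingleton) :
    lastHornFamily (n + 2) S := by
  by_contra h
  simp only [lastHornFamily, not_exists, not_and, not_not] at h
  have h₀ := h 0 (Fin.last_pos.ne)
  have h₁ := h 1 (fun h ↦ by simpa using congr_arg Fin.val h)
  exact absurd (hS h₀ h₁) (by simp)

/-- The union of the last edge and the vertices. -/
def lastEdgeFamily (n : ℕ) (S : Set (Fin (n + 3))) : Prop :=
  (∀ j ∈ S, n + 1 ≤ j.val) ∨ S.Subsingleton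

lemma lastEdgeFamily_mono (n : ℕ) {S T : Set (Fin (n + 3))} (h : S ⊆ T) :
    lastEdgeFamily n T → lastEdgeFamily n S :=
  Or.imp (fun h' j hj ↦ h' j (h hj)) (fun h' ↦ h'.anti h)

/-- The last edge of `Δⁿ⁺²`. -/
def lastEdgeMap (n : ℕ) : (Δ[1] : SSet.{u}) ⟶ Λ[n + 2, Fin.last (n + 2)] :=
  yonedaEquiv.symm (hornLastEdge n)

lemma lastEdgeMap_apply (n : ℕ) {d : ℕ} (x : (Δ[1] : SSet.{u}) _⦋d⦌) (k : Fin (d + 1)) :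
    (((lastEdgeMap n).app _ x).1 k).val = n + 1 + (x k).val := by
  have h₁ : lastEdgeMap n ≫ (Λ[n + 2, Fin.last (n + 2)]).ι = yonedaEquiv.symm (hornLastEdge n).1 :=
    yonedaEquiv_symm_comp _ _
  have h₂ : ((lastEdgeMap n).app _ x).1 k = (hornLastEdge.{u} n).1 (x k) := by
    refine Eq.trans ?_ ((stdWord (n + 2)).word_yonedaEquiv_symm (hornLastEdge n).1 x k)
    rw [← h₁]
    rfl
  rw [h₂]
  generalize x k = y
  fin_cases y <;> rfl

lemma exists_lastEdgeMap_eq (n : ℕ) {d : ℕ} (x : (Δ[n + 2] : SSet.{u}) _⦋d⦌)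
    (hx : ∀ k, n + 1 ≤ (x k).val) : ∃ y, ((lastEdgeMap n).app _ y).1 = x := by
  refine ⟨stdSimplex.objMk ⟨fun k ↦ (⟨(x k).val - (n + 1), by omega⟩ : Fin 2), fun k l h ↦ ?_⟩,
    stdSimplex.ext _ _ fun k ↦ Fin.ext ?_⟩
  · have : (x k).val ≤ (x l).val := stdSimplex.monotone_apply x h
    exact Fin.le_def.2 (by dsimp only; omega)
  · rw [lastEdgeMap_apply]
    have := hx k
    change n + 1 + ((x k).val - (n + 1)) = _
    omega

lemma lastEdgeMap_injective (n : ℕ) {d : ℕ} {x y : (Δ[1] : SSet.{u}) _⦋d⦌}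
    (h : ((lastEdgeMap n).app _ x).1 = ((lastEdgeMap n).app _ y).1) : x = y := by
  refine stdSimplex.ext _ _ fun k ↦ Fin.ext ?_
  have h₁ := lastEdgeMap_apply n x k
  have h₂ := lastEdgeMap_apply n y k
  rw [h] at h₁
  omega

section Transport

variable {X A : SSet.{u}} (p : X ⟶ A) [InnerFibration p] {n : ℕ}

/-- Extend a homotopy of the last edge to a homotopy of the horn. -/
lemma exists_horn_iso_homotopy (a : (Λ[n + 2, Fin.last (n + 2)] : SSet.{u}) ⟶ X)
    (H : coherentIso.{u} ⊗ Δ[1] ⟶ X) (b : coherentIso.{u} ⊗ Δ[n + 2] ⟶ A)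
    (ha : a ≫ p = (Λ[n + 2, Fin.last (n + 2)]).ι ≫ isoEnd true _ ≫ b)
    (haH : lastEdgeMap n ≫ a = isoEnd true _ ≫ H)
    (hH : H ≫ p = (coherentIso ◁ (lastEdgeMap n ≫ (Λ[n + 2, Fin.last (n + 2)]).ι)) ≫ b)
    (hb : ∀ (d : ℕ) (z : (coherentIso.{u} ⊗ Δ[n + 2] : SSet.{u}) _⦋d⦌) (c : Fin (n + 3)),
      c.val ≤ n → (∀ k, z.2 k = c) → b.app _ z = b.app _ ((isoEnd true _).app _ z.2)) :
    ∃ Φ : ((isoWord.{u}.prod (stdWord (n + 2))).sub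
        (fun S ↦ lastHornFamily (n + 2) (Prod.snd '' S))
        (fun h ↦ lastHornFamily_mono _ (Set.image_mono h)) : SSet.{u}) ⟶ X,
      Φ ≫ p = Subcomplex.ι _ ≫ b ∧
      (∀ (d : ℕ) (x : (Λ[n + 2, Fin.last (n + 2)] : SSet.{u}) _⦋d⦌) (hx),
        Φ.app (op ⦋d⦌) ⟨(isoEnd true _).app _ x.1, hx⟩ = a.app _ x) ∧
      (∀ (d : ℕ) (z : (coherentIso.{u} ⊗ Δ[1] : SSet.{u}) _⦋d⦌) (hz),
        Φ.app (op ⦋d⦌) ⟨(z.1, ((lastEdgeMap n).app _ z.2).1), hz⟩ = H.app _ z) := by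
  let W := isoWord.{u}.prod (stdWord (n + 2))
  -- The part on which the homotopy is stationary: the end `true`, and the vertices that do not lie
  -- on the last edge.
  let κ₁ (S : Set (Bool × Fin (n + 3))) : Prop := lastHornFamily (n + 2) (Prod.snd '' S) ∧
    ((∀ a ∈ S, a.1 = true) ∨ ∃ c : Fin (n + 3), c.val ≤ n ∧ ∀ a ∈ S, a.2 = c)
  let K₁ := W.sub κ₁ (fun h ↦ And.imp (lastHornFamily_mono _ (Set.image_mono h))
    (Or.imp (fun h' a ha ↦ h' a (h ha)) (fun ⟨c, hc, h'⟩ ↦ ⟨c, hc, fun a ha ↦ h' a (h ha)⟩)))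
  let K := W.sub (isoBoxFamily true (lastEdgeFamily n) (lastHornFamily (n + 2)))
    (isoBoxFamily_mono true (lastEdgeFamily_mono _) (lastHornFamily_mono _))
  let e := lastEdgeMap.{u} n ≫ (Λ[n + 2, Fin.last (n + 2)]).ι
  have himage (d : ℕ) (z : (coherentIso.{u} ⊗ Δ[n + 2] : SSet.{u}) _⦋d⦌) :
      Prod.snd '' Set.range (W.word z) = Set.range z.2 := by
    rw [← Set.range_comp]
    rfl
  have hhorn (d : ℕ) (z : (coherentIso.{u} ⊗ Δ[n + 2] : SSet.{u}) _⦋d⦌) :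
      lastHornFamily (n + 2) (Prod.snd '' Set.range (W.word z)) ↔
        z.2 ∈ (Λ[n + 2, Fin.last (n + 2)]).obj _ := by
    rw [mem_lastHorn_iff, himage]
  let q : (K₁ : SSet.{u}) ⟶ Λ[n + 2, Fin.last (n + 2)] :=
    Subcomplex.factor (K₁.ι ≫ CartesianMonoidalCategory.snd _ _) _
      (fun d z ↦ (hhorn d z.1).1 z.2.1)
  have hcover (d : ℕ) (z : (coherentIso.{u} ⊗ Δ[n + 2] : SSet.{u}) _⦋d⦌) (hz : z ∈ K.obj _) :
      (∃ x, (coherentIso ◁ e).app _ x = z) ∨ ∃ y, K₁.ι.app _ y = z := by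
    have h₀ (hz' : ∀ k, n + 1 ≤ (z.2 k).val) : ∃ x, (coherentIso ◁ e).app _ x = z := by
      obtain ⟨y, hy⟩ := exists_lastEdgeMap_eq n z.2 hz'
      exact ⟨(z.1, y), Prod.ext rfl hy⟩
    obtain ⟨h, hz | hz | hz⟩ := hz
    · exact Or.inr ⟨⟨z, h, Or.inl hz⟩, rfl⟩
    · exact Or.inl (h₀ fun k ↦ hz _ ⟨_, ⟨k, rfl⟩, rfl⟩)
    · have hz' (k) : z.2 k = z.2 0 := hz ⟨_, ⟨k, rfl⟩, rfl⟩ ⟨_, ⟨0, rfl⟩, rfl⟩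
      by_cases h₁ : (z.2 0).val ≤ n
      · refine Or.inr ⟨⟨z, h, Or.inr ⟨z.2 0, h₁, ?_⟩⟩, rfl⟩
        rintro _ ⟨k, rfl⟩
        exact hz' k
      · refine Or.inl (h₀ fun k ↦ ?_)
        rw [hz']
        omega
  -- The vertices of the last edge exceed `n`, so the moving and the stationary part meet only in
  -- the end `true`.
  have hlast (d : ℕ) (y : (coherentIso.{u} ⊗ Δ[1] : SSet.{u}) _⦋d⦌) (z : (K₁ : SSet.{u}) _⦋d⦌)
      (h : (coherentIso ◁ e).app _ y = K₁.ι.app _ z) :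
      (isoEnd true _).app _ y.2 = y ∧ (lastEdgeMap n).app _ y.2 = q.app _ z := by
    obtain ⟨z, hz⟩ := z
    obtain rfl : (coherentIso ◁ e).app _ y = z := h
    refine ⟨isoEnd_app_eq _ _ _ fun k ↦ ?_, Subtype.ext rfl⟩
    obtain ⟨-, hz | ⟨c, hc, hz⟩⟩ := hz
    · exact hz _ ⟨k, rfl⟩
    · have h₁ : ((lastEdgeMap n).app _ y.2).1 0 = c := hz _ ⟨0, rfl⟩
      have h₂ := lastEdgeMap_apply n y.2 0
      rw [h₁] at h₂
      omega
  obtain ⟨f, hf₀, hf₁⟩ := K.exists_glue₂ (coherentIso ◁ e) K₁.ι H (q ≫ a) hcover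
    (fun d y z h ↦ by
      have h₁ : y.1 = z.1 :=
        congr_arg (fun q : (coherentIso.{u} ⊗ Δ[n + 2] : SSet.{u}) _⦋d⦌ ↦ q.1) h
      have h₂ : ((lastEdgeMap n).app _ y.2).1 = ((lastEdgeMap n).app _ z.2).1 :=
        congr_arg (fun q : (coherentIso.{u} ⊗ Δ[n + 2] : SSet.{u}) _⦋d⦌ ↦ q.2) h
      exact congr_arg (H.app _) (Prod.ext h₁ (lastEdgeMap_injective n h₂)))
    (fun d y z h ↦ congr_arg ((q ≫ a).app _) (Subtype.ext h)) (fun d y z h ↦ by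
      obtain ⟨h₁, h₂⟩ := hlast d y z h
      refine (congr_arg (H.app _) h₁.symm).trans ((app_app_eq haH y.2).symm.trans ?_)
      exact congr_arg (a.app _) h₂)
  obtain ⟨Φ, hΦ, hΦ'⟩ := exists_iso_homotopy_extension true (lastEdgeFamily_mono n)
    (lastHornFamily_mono (n + 2)) (fun S ↦ Or.inr) p f b (by
      refine Subcomplex.hom_ext fun d z hz ↦ ?_
      obtain ⟨y, rfl⟩ | ⟨y, rfl⟩ := hcover d z hz
      · exact (congr_arg (p.app _) (hf₀ d y hz)).trans (app_app_eq hH y)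
      · refine (congr_arg (p.app _) (hf₁ d y hz)).trans ?_
        refine (app_app_eq ha (q.app _ y)).trans ?_
        change b.app _ ((isoEnd true _).app _ y.1.2) = b.app _ y.1
        obtain ⟨-, h | ⟨c, hc, h⟩⟩ := y.2
        · exact congr_arg (b.app _) (isoEnd_app_eq _ _ _ fun k ↦ h _ ⟨k, rfl⟩)
        · exact (hb d y.1 c hc fun k ↦ h _ ⟨k, rfl⟩).symm)
  refine ⟨Φ, hΦ', fun d x hx ↦ ?_, fun d z hz ↦ ?_⟩
  · have h₁ : ∀ a ∈ Set.range (W.word ((isoEnd true _).app _ x.1)), a.1 = true := by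
      rintro _ ⟨k, rfl⟩
      exact word_isoEnd _ _ _ _
    refine (hΦ d _ ⟨hx, Or.inl h₁⟩).trans ?_
    exact hf₁ d ⟨_, hx, Or.inl h₁⟩ _
  · have h₁ : lastEdgeFamily n (Prod.snd '' Set.range (W.word ((coherentIso ◁ e).app _ z))) := by
      rw [himage]
      left
      rintro _ ⟨k, rfl⟩
      exact (Nat.le_add_right _ _).trans (lastEdgeMap_apply n z.2 k).ge
    refine (hΦ d ((coherentIso ◁ e).app _ z) ⟨hz, Or.inr h₁⟩).trans ?_
    exact hf₀ d z _

/-- A lifting problem for the horn `Λⁿₙ` can be transported along a homotopy parametrized by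
`coherentIso`. -/
theorem exists_lift_of_iso_homotopy (a : (Λ[n + 2, Fin.last (n + 2)] : SSet.{u}) ⟶ X)
    (H : coherentIso.{u} ⊗ Δ[1] ⟶ X) (b : coherentIso.{u} ⊗ Δ[n + 2] ⟶ A)
    (ha : a ≫ p = (Λ[n + 2, Fin.last (n + 2)]).ι ≫ isoEnd true _ ≫ b)
    (haH : lastEdgeMap n ≫ a = isoEnd true _ ≫ H)
    (hH : H ≫ p = (coherentIso ◁ (lastEdgeMap n ≫ (Λ[n + 2, Fin.last (n + 2)]).ι)) ≫ b)
    (hb : ∀ (d : ℕ) (z : (coherentIso.{u} ⊗ Δ[n + 2] : SSet.{u}) _⦋d⦌) (c : Fin (n + 3)),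
      c.val ≤ n → (∀ k, z.2 k = c) → b.app _ z = b.app _ ((isoEnd true _).app _ z.2))
    (hsol : ∀ a' : (Λ[n + 2, Fin.last (n + 2)] : SSet.{u}) ⟶ X,
      a' ≫ p = (Λ[n + 2, Fin.last (n + 2)]).ι ≫ isoEnd false _ ≫ b →
      lastEdgeMap n ≫ a' = isoEnd false _ ≫ H →
      ∃ l : Δ[n + 2] ⟶ X, (Λ[n + 2, Fin.last (n + 2)]).ι ≫ l = a' ∧ l ≫ p = isoEnd false _ ≫ b) :
    ∃ l : Δ[n + 2] ⟶ X, (Λ[n + 2, Fin.last (n + 2)]).ι ≫ l = a ∧ l ≫ p = isoEnd true _ ≫ b := by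
  obtain ⟨Φ, hΦ, hΦa, hΦH⟩ := exists_horn_iso_homotopy p a H b ha haH hH hb
  let W := isoWord.{u}.prod (stdWord (n + 2))
  let K' := W.sub (fun S ↦ lastHornFamily (n + 2) (Prod.snd '' S))
        (fun h ↦ lastHornFamily_mono _ (Set.image_mono h))
  have hK' (d : ℕ) (z : (coherentIso.{u} ⊗ Δ[n + 2] : SSet.{u}) _⦋d⦌) :
      z ∈ K'.obj _ ↔ z.2 ∈ (Λ[n + 2, Fin.last (n + 2)]).obj _ := by
    rw [mem_lastHorn_iff]
    change lastHornFamily (n + 2) _ ↔ _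
    rw [← Set.range_comp]
    rfl
  have hend (ε : Bool) (d : ℕ) (x : (Λ[n + 2, Fin.last (n + 2)] : SSet.{u}) _⦋d⦌) :
      ((Λ[n + 2, Fin.last (n + 2)]).ι ≫ isoEnd ε _).app _ x ∈ K'.obj _ := (hK' _ _).2 x.2
  -- The other end of the homotopy of horns is a problem that `hsol` solves.
  obtain ⟨l', hl', hl'p⟩ := hsol (Subcomplex.factor _ K' (hend false) ≫ Φ) (by
    rw [Category.assoc, hΦ]
    rfl) (by
    ext ⟨⟨d⟩⟩ x
    exact hΦH d ((isoEnd false _).app _ x) _)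
  let K := W.sub (isoBoxFamily false (lastHornFamily (n + 2)) (fun _ ↦ True))
    (isoBoxFamily_mono false (lastHornFamily_mono _) (fun _ _ ↦ trivial))
  have hcover (d : ℕ) (z : (coherentIso.{u} ⊗ Δ[n + 2] : SSet.{u}) _⦋d⦌) (hz : z ∈ K.obj _) :
      (∃ x, (isoEnd false _).app _ x = z) ∨ ∃ y, K'.ι.app _ y = z := by
    obtain ⟨-, hz | hz⟩ := hz
    · exact Or.inl ⟨z.2, isoEnd_app_eq _ _ _ fun k ↦ hz _ ⟨k, rfl⟩⟩
    · exact Or.inr ⟨⟨z, hz⟩, rfl⟩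
  obtain ⟨f, hf₀, hf₁⟩ := K.exists_glue₂ (isoEnd false _) K'.ι l' Φ hcover
    (fun d y z h ↦ congr_arg (l'.app _) (congr_arg Prod.snd h))
    (fun d y z h ↦ congr_arg (Φ.app _) (Subtype.ext h)) (fun d y z h ↦ by
      obtain ⟨z, hz⟩ := z
      obtain rfl : (isoEnd false _).app _ y = z := h
      exact Subcomplex.app_of_ι_comp_eq hl' y ((hK' _ _).1 hz))
  -- Homotopy extension, now from the end `false` to the whole simplex; its end `true` is the
  -- required lift.
  obtain ⟨l, hl, hl''⟩ := exists_iso_homotopy_extension false (lastHornFamily_mono (n + 2))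
    (fun _ _ ↦ trivial) (fun S ↦ lastHornFamily_of_subsingleton) p f b (by
      refine Subcomplex.hom_ext fun d z hz ↦ ?_
      obtain ⟨y, rfl⟩ | ⟨y, rfl⟩ := hcover d z hz
      · exact (congr_arg (p.app _) (hf₀ d y hz)).trans (app_app_eq hl'p y)
      · exact (congr_arg (p.app _) (hf₁ d y hz)).trans (app_app_eq hΦ y))
  refine ⟨Subcomplex.factor (isoEnd true _) (W.sub (fun _ ↦ True) (fun _ _ ↦ trivial))
    (fun _ _ ↦ trivial) ≫ l, ?_, ?_⟩
  · refine Subcomplex.hom_ext fun d x hx ↦ ?_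
    have hx' := hend true d ⟨x, hx⟩
    refine (hl d ((isoEnd true _).app _ x) ⟨trivial, Or.inr hx'⟩).trans ?_
    exact (hf₁ d ⟨_, hx'⟩ _).trans (hΦa d ⟨x, hx⟩ hx')
  · rw [Category.assoc, hl'']
    rfl

end Transport

end SSet

/-! ### From locally Cartesian to Cartesian edges -/

namespace SSet

lemma lastEdgeMap_comp {X : SSet.{u}} {n : ℕ} (a : (Λ[n + 2, Fin.last (n + 2)] : SSet.{u}) ⟶ X) :
    lastEdgeMap n ≫ a = yonedaEquiv.symm (a.app _ (hornLastEdge n)) :=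
  (yonedaEquiv_symm_comp _ _)

variable {X A : SSet.{u}} (p : X ⟶ A) [InnerFibration p]

/-- A locally Cartesian edge is Cartesian if there is a Cartesian edge with the same image and the
same target. -/
theorem IsLocallyCartesianEdge.isCartesianEdge {f f' : X _⦋1⦌} (hf : IsLocallyCartesianEdge p f)
    (hf' : IsCartesianEdge p f') (h : p.app _ f = p.app _ f') (hδ : X.δ 0 f = X.δ 0 f') :
    IsCartesianEdge p f := by
  intro n a b hab ha
  -- The problem is posed at the end `true`, with last edge `f`, and solved at the end `false`, with
  -- last edge `f'`. The base stays constant along the homotopy.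
  let F : Bool → X _⦋1⦌ := fun ε ↦ bif ε then f else f'
  obtain ⟨H, hH, hH'⟩ := exists_iso_homotopy p F (p.app _ f)
    (by rintro (_ | _); exacts [h.symm, rfl]) hδ
    (by rintro (_ | _); exacts [hf'.along _ _, hf])
  have hF (ε : Bool) : isoEnd ε _ ≫ H = yonedaEquiv.symm (F ε) := by
    ext ⟨⟨d⟩⟩ x
    exact hH' d _ ε (Or.inl fun k ↦ word_isoEnd ..)
  have hb (ε : Bool) : isoEnd ε _ ≫ CartesianMonoidalCategory.snd _ _ ≫ b = b := by simp
  obtain ⟨l, hl, hl'⟩ := exists_lift_of_iso_homotopy p a H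
    (CartesianMonoidalCategory.snd _ _ ≫ b) (by rw [hb, hab])
    (by rw [lastEdgeMap_comp, ha, hF]; rfl) (by
      rw [hH, ← ha, ← yonedaEquiv_symm_comp, ← lastEdgeMap_comp, Category.assoc, hab]
      simp) (fun d z c hc hz ↦ rfl) (fun a' ha' haH' ↦ by
      rw [hb] at ha' ⊢
      refine hf' n a' b ha' (yonedaEquiv.symm.injective ?_)
      rw [← lastEdgeMap_comp, haH', hF]
      rfl)
  exact ⟨l, hl, hl'.trans (hb _)⟩

/-- The edges in the image of `coherentIso` are locally Cartesian. -/
theorem isLocallyCartesianEdge_of_coherentIso (hσ : ∀ x : X _⦋0⦌, IsCartesianEdge p (X.σ 0 x))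
    (e : coherentIso.{u} ⟶ X) (j : coherentIso.{u} _⦋1⦌) :
    IsLocallyCartesianEdge p (e.app _ j) := by
  have key : IsCartesianAlong p (e ≫ p) j (e.app _ j) := by
    intro n a t hat ht ha
    let α := isoWord.{u}.word j 0
    let β := isoWord.{u}.word j 1
    have fin2_cases (x : Fin 2) : x = 0 ∨ x = 1 := by omega
    have hrel (x y : Bool) : isoWord.{u}.rel x y := trivial
    have hgood (S : Set Bool) : isoWord.{u}.good S := trivial
    -- Contracts the edge `j : α → β` to the degenerate edge at `β`: the end `true` is `j`, the end
    -- `false` is constant. Any assignment of letters is allowed, as the simplices of `J` are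
    -- arbitrary words.
    let μ : coherentIso.{u} ⊗ Δ[1] ⟶ coherentIso.{u} :=
      (isoWord.prod (stdWord 1)).hom isoWord (fun z ↦ if z.1 = true ∧ z.2 = 0 then α else β)
        (fun _ _ _ ↦ hrel _ _) (fun _ _ ↦ hgood _)
    let τ (c : Fin (n + 3)) : Bool := isoWord.{u}.word (t.app (op ⦋0⦌) (stdSimplex.const _ c _)) 0
    have hτ (d : ℕ) (x : (Δ[n + 2] : SSet.{u}) _⦋d⦌) (k : Fin (d + 1)) :
        isoWord.word (t.app _ x) k = τ (x k) := by
      have h₁ := isoWord.word_map (SimplexCategory.const ⦋0⦌ ⦋d⦌ k) (t.app _ x) 0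
      rw [← NatTrans.naturality_apply] at h₁
      refine h₁.symm.trans (congr_arg (fun z ↦ isoWord.word (t.app (op ⦋0⦌) z) 0) ?_)
      exact stdSimplex.ext _ _ fun _ ↦ rfl
    have hα : τ ⟨n + 1, by omega⟩ = α := by
      have := hτ _ (hornLastEdge n).1 0
      rw [ht, hornLastEdge_zero] at this
      exact this.symm
    have hβ : τ ⟨n + 2, by omega⟩ = β := by
      have := hτ _ (hornLastEdge n).1 1
      rw [ht, hornLastEdge_one] at this
      exact this.symm
    have hτ' (c : Fin (n + 3)) (x : Fin 2) (hc : c.val = n + 1 + x.val) :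
        τ c = if x = 0 then α else β := by
      obtain rfl | rfl := fin2_cases x
      · exact (congr_arg τ (Fin.ext hc)).trans hα
      · exact (congr_arg τ (Fin.ext hc)).trans hβ
    -- The corresponding movement of the base: only the vertex `n + 1` moves, to `β`.
    let ν : coherentIso.{u} ⊗ Δ[n + 2] ⟶ coherentIso.{u} :=
      (isoWord.prod (stdWord (n + 2))).hom isoWord
        (fun z ↦ if z.1 = false ∧ z.2.val = n + 1 then β else τ z.2)
        (fun _ _ _ ↦ hrel _ _) (fun _ _ ↦ hgood _)
    have hμ (d) (z : (coherentIso.{u} ⊗ Δ[1] : SSet.{u}) _⦋d⦌) (k) : isoWord.word (μ.app _ z) k =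
      if isoWord.word z.1 k = true ∧ z.2 k = 0 then α else β :=
        congr_fun (WordModel.word_hom ..) k
    have hν (d) (z : (coherentIso.{u} ⊗ Δ[n + 2] : SSet.{u}) _⦋d⦌) (k) :
      isoWord.word (ν.app _ z) k =
      if isoWord.word z.1 k = false ∧ (z.2 k).val = n + 1 then β else τ (z.2 k) :=
        congr_fun (WordModel.word_hom ..) k
    have hμE (ε : Bool) (d) (x : (Δ[1] : SSet.{u}) _⦋d⦌) (k) :
        isoWord.word (μ.app _ ((isoEnd ε _).app _ x)) k =
          if ε = true ∧ x k = 0 then α else β := by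
      rw [hμ, word_isoEnd]
      rfl
    have hνE (ε : Bool) (d) (x : (Δ[n + 2] : SSet.{u}) _⦋d⦌) (k) :
        isoWord.word (ν.app _ ((isoEnd ε _).app _ x)) k =
          if ε = false ∧ (x k).val = n + 1 then β else τ (x k) := by
      rw [hν, word_isoEnd]
      rfl
    have hνt : isoEnd true _ ≫ ν = t := isoWord.hom_ext fun d x k ↦ by
      refine (hνE _ _ _ _).trans ?_
      rw [hτ]
      simp
    obtain ⟨l, hl, hl'⟩ := exists_lift_of_iso_homotopy p a (μ ≫ e) (ν ≫ e ≫ p)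
      (by rw [reassoc_of% hνt, hat])
      (by
        rw [lastEdgeMap_comp, ha, ← yonedaEquiv_symm_comp, ← Category.assoc]
        congr 1
        refine isoWord.hom_ext fun d x k ↦ ?_
        refine Eq.trans ?_ (hμE _ _ _ _).symm
        rw [isoWord.word_yonedaEquiv_symm]
        obtain h | h := fin2_cases (x k) <;> simp [h, α, β])
      (by
        rw [Category.assoc, ← Category.assoc _ ν]
        congr 1
        refine isoWord.hom_ext fun d x k ↦ ?_
        refine (hμ _ _ _).trans ((hν _ _ _).trans ?_).symm
        have h := lastEdgeMap_apply n x.2 k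
        refine Eq.trans (b := if isoWord.word x.1 k = false ∧
          (((lastEdgeMap n).app _ x.2).1 k).val = n + 1 then β else
          τ (((lastEdgeMap n).app _ x.2).1 k)) rfl ?_
        rw [hτ' _ _ h, h]
        obtain h | h := fin2_cases (x.2 k) <;>
          cases isoWord.word x.1 k <;> simp [h])
      (fun d z c hc hz ↦ by
        change (e ≫ p).app _ (ν.app _ _) = (e ≫ p).app _ (ν.app _ _)
        congr 1
        refine isoWord.word_injective (funext fun k ↦ ?_)
        rw [hν, hνE, if_neg (by rw [hz]; omega), if_neg (by simp)])
      (fun a' ha' haH' ↦ by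
        -- At the end `false` the last edge has become degenerate, hence is Cartesian by `hσ`.
        refine hσ (e.app _ (isoConst β 0)) n a' _ ha' (yonedaEquiv.symm.injective ?_)
        have h₁ : isoEnd false _ ≫ μ = yonedaEquiv.symm (coherentIso.σ 0 (isoConst β 0)) :=
          isoWord.hom_ext fun d x k ↦ by
            refine (hμE _ _ _ _).trans ?_
            rw [isoWord.word_yonedaEquiv_symm, isoWord.word_σ, word_isoConst]
            simp
        rw [← lastEdgeMap_comp, haH', reassoc_of% h₁, yonedaEquiv_symm_comp]
        exact congr_arg _
          (ConcreteCategory.congr_hom (SimplicialObject.σ_naturality e (0 : Fin 1)) _))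
    refine ⟨l, hl, hl'.trans ?_⟩
    rw [reassoc_of% hνt]
  have := key.precomp (yonedaEquiv.symm j) (yonedaEquiv (𝟙 Δ[1]))
    (yonedaEquiv_symm_app_yonedaEquiv_id j)
  rwa [yonedaEquiv_symm_comp] at this

end SSet

/-! ### Lifting against boxes and the path adjunction -/

namespace FunctorialCylinder

variable {C : Type u} [Category.{v} C] (cyl : FunctorialCylinder C)

/-- The inclusion of an end of the cylinder. -/
def endMap (d : 𝟭 C ⟶ cyl.I) (K : C) : K ⟶ cyl.I.obj K := d.app K

lemma endMap_naturality (d : 𝟭 C ⟶ cyl.I) {K L : C} (i : K ⟶ L) :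
    i ≫ cyl.endMap d L = cyl.endMap d K ≫ cyl.I.map i :=
  d.naturality i

lemma _root_.CategoryTheory.HasLiftingProperty.exists_lift {K L X A : C} {i : K ⟶ L} {q : X ⟶ A}
    (_ : HasLiftingProperty i q) {f : K ⟶ X} {g : L ⟶ A} (w : f ≫ q = i ≫ g) :
    ∃ l, i ≫ l = f ∧ l ≫ q = g :=
  have sq : CommSq f i q g := ⟨w⟩
  ⟨sq.lift, sq.fac_left, sq.fac_right⟩

/-- Turns lifting problems for box maps into compatible data on the pieces, so that the pushouts
need not be computed. -/
lemma _root_.CategoryTheory.IsPushout.hasLiftingProperty_iff {K L M N Z X A : C} {f : K ⟶ L}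
    {g : K ⟶ M} {inl : L ⟶ N} {inr : M ⟶ N} (h : IsPushout f g inl inr) (m : N ⟶ Z) {l : L ⟶ Z}
    {r : M ⟶ Z} (hl : inl ≫ m = l) (hr : inr ≫ m = r) (q : X ⟶ A) :
    HasLiftingProperty m q ↔ ∀ (v : L ⟶ X) (u : M ⟶ X) (b : Z ⟶ A), f ≫ v = g ≫ u →
      u ≫ q = r ≫ b → v ≫ q = l ≫ b → ∃ t : Z ⟶ X, l ≫ t = v ∧ r ≫ t = u ∧ t ≫ q = b := by
  subst hl hr
  refine ⟨fun _ v u b h₁ h₂ h₃ ↦ ?_, fun H ↦ ⟨fun {f b} sq ↦ ?_⟩⟩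
  · have sq : CommSq (h.desc v u h₁) m q b := ⟨by
      apply h.hom_ext
      · rw [h.inl_desc_assoc, h₃, Category.assoc]
      · rw [h.inr_desc_assoc, h₂, Category.assoc]⟩
    exact ⟨sq.lift, by simp, by simp, sq.fac_right⟩
  · obtain ⟨l, h₁, h₂, h₃⟩ := H (inl ≫ f) (inr ≫ f) b (by rw [h.w_assoc]) (by simp [sq.w])
      (by simp [sq.w])
    exact ⟨⟨l, h.hom_ext (by simpa using h₁) (by simpa using h₂), h₃⟩⟩

lemma inl_boundaryMap [HasBinaryCoproducts C] (K : C) : coprod.inl ≫ cyl.boundaryMap K = cyl.endMap cyl.d₀ K :=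
  coprod.inl_desc ..

lemma inr_boundaryMap [HasBinaryCoproducts C] (K : C) : coprod.inr ≫ cyl.boundaryMap K = cyl.endMap cyl.d₁ K :=
  coprod.inr_desc ..

section

variable [HasPushouts C] {K L : C} (i : K ⟶ L)

/-- The inclusion of `{1} ⊗ L` into the source of `boxOne i`. -/
def boxOneInl : L ⟶ pushout i (cyl.d₁.app K) := pushout.inl _ _

/-- The inclusion of `I ⊗ K` into the source of `boxOne i`. -/
def boxOneInr : cyl.I.obj K ⟶ pushout i (cyl.d₁.app K) := pushout.inr _ _

lemma isPushout_boxOne :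
    IsPushout i (cyl.endMap cyl.d₁ K) (cyl.boxOneInl i) (cyl.boxOneInr i) :=
  IsPushout.of_hasPushout i (cyl.d₁.app K)

lemma boxOneInl_boxOne : cyl.boxOneInl i ≫ cyl.boxOne i = cyl.endMap cyl.d₁ L :=
  pushout.inl_desc ..

lemma boxOneInr_boxOne : cyl.boxOneInr i ≫ cyl.boxOne i = cyl.I.map i :=
  pushout.inr_desc ..

lemma hasLiftingProperty_boxOne_iff {X A : C} (q : X ⟶ A) :
    HasLiftingProperty (cyl.boxOne i) q ↔
      ∀ (v : L ⟶ X) (u : cyl.I.obj K ⟶ X) (b : cyl.I.obj L ⟶ A), i ≫ v = cyl.endMap cyl.d₁ K ≫ u →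
        u ≫ q = cyl.I.map i ≫ b → v ≫ q = cyl.endMap cyl.d₁ L ≫ b →
        ∃ l : cyl.I.obj L ⟶ X, cyl.endMap cyl.d₁ L ≫ l = v ∧ cyl.I.map i ≫ l = u ∧ l ≫ q = b :=
  (cyl.isPushout_boxOne i).hasLiftingProperty_iff _ (cyl.boxOneInl_boxOne i)
    (cyl.boxOneInr_boxOne i) q

variable [HasBinaryCoproducts C]

lemma hasLiftingProperty_boxBoundary_iff {X A : C} (q : X ⟶ A) :
    HasLiftingProperty (cyl.boxBoundary i) q ↔
      ∀ (v₀ v₁ : L ⟶ X) (u : cyl.I.obj K ⟶ X) (b : cyl.I.obj L ⟶ A),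
        i ≫ v₀ = cyl.endMap cyl.d₀ K ≫ u → i ≫ v₁ = cyl.endMap cyl.d₁ K ≫ u →
        u ≫ q = cyl.I.map i ≫ b → v₀ ≫ q = cyl.endMap cyl.d₀ L ≫ b →
        v₁ ≫ q = cyl.endMap cyl.d₁ L ≫ b →
        ∃ l : cyl.I.obj L ⟶ X, cyl.endMap cyl.d₀ L ≫ l = v₀ ∧ cyl.endMap cyl.d₁ L ≫ l = v₁ ∧
          cyl.I.map i ≫ l = u ∧ l ≫ q = b := by
  rw [(IsPushout.of_hasPushout (coprod.map i i) (cyl.boundaryMap K)).hasLiftingProperty_iff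
    (cyl.boxBoundary i) (l := cyl.boundaryMap L) (r := cyl.I.map i) (pushout.inl_desc ..)
    (pushout.inr_desc ..) q]
  refine ⟨fun h v₀ v₁ u b h₀ h₁ h₂ h₃ h₄ ↦ ?_, fun h v u b h₁ h₂ h₃ ↦ ?_⟩
  · obtain ⟨t, ht, ht', ht''⟩ := h (coprod.desc v₀ v₁) u b
      (by
        apply coprod.hom_ext
        · rw [coprod.inl_map_assoc, coprod.inl_desc, ← Category.assoc, inl_boundaryMap, h₀]
        · rw [coprod.inr_map_assoc, coprod.inr_desc, ← Category.assoc, inr_boundaryMap, h₁]) h₂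
      (by
        apply coprod.hom_ext
        · rw [coprod.inl_desc_assoc, ← Category.assoc, inl_boundaryMap, h₃]
        · rw [coprod.inr_desc_assoc, ← Category.assoc, inr_boundaryMap, h₄])
    refine ⟨t, ?_, ?_, ht', ht''⟩
    · rw [← inl_boundaryMap, Category.assoc, ht, coprod.inl_desc]
    · rw [← inr_boundaryMap, Category.assoc, ht, coprod.inr_desc]
  · obtain ⟨t, ht₀, ht₁, ht', ht''⟩ := h (coprod.inl ≫ v) (coprod.inr ≫ v) u b
      (by rw [← inl_boundaryMap, Category.assoc, ← h₁, coprod.inl_map_assoc])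
      (by rw [← inr_boundaryMap, Category.assoc, ← h₁, coprod.inr_map_assoc]) h₂
      (by rw [← inl_boundaryMap, Category.assoc, Category.assoc, ← h₃])
      (by rw [← inr_boundaryMap, Category.assoc, Category.assoc, ← h₃])
    refine ⟨t, ?_, ht', ht''⟩
    apply coprod.hom_ext
    · rw [← Category.assoc, inl_boundaryMap, ht₀]
    · rw [← Category.assoc, inr_boundaryMap, ht₁]

end

section Path

variable {cyl} {P : C ⥤ C} (adj : cyl.I ⊣ P)

/-- The evaluation of paths at an end of the cylinder. -/
def pathEval (d : 𝟭 C ⟶ cyl.I) (X : C) : P.obj X ⟶ X :=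
  cyl.endMap d (P.obj X) ≫ (adj.homEquiv _ _).symm (𝟙 _)

lemma comp_pathEval (d : 𝟭 C ⟶ cyl.I) {K X : C} (g : K ⟶ P.obj X) :
    g ≫ pathEval adj d X = cyl.endMap d K ≫ (adj.homEquiv _ _).symm g := by
  rw [pathEval, ← Category.assoc, endMap_naturality, Category.assoc,
    ← Adjunction.homEquiv_naturality_left_symm, Category.comp_id]

lemma homEquiv_pathEval (d : 𝟭 C ⟶ cyl.I) {K X : C} (l : cyl.I.obj K ⟶ X) :
    adj.homEquiv _ _ l ≫ pathEval adj d X = cyl.endMap d K ≫ l := by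
  rw [comp_pathEval, Equiv.symm_apply_apply]

lemma pathEval_naturality (d : 𝟭 C ⟶ cyl.I) {X A : C} (q : X ⟶ A) :
    pathEval adj d X ≫ q = P.map q ≫ pathEval adj d A := by
  rw [comp_pathEval, pathEval, Category.assoc, ← Adjunction.homEquiv_naturality_right_symm,
    Category.id_comp]

variable [HasPullbacks C]

/-- The map corresponding to `boxOne` under the path adjunction. -/
def pathOne {X A : C} (q : X ⟶ A) : P.obj X ⟶ pullback q (pathEval adj cyl.d₁ A) :=
  pullback.lift (pathEval adj cyl.d₁ X) (P.map q) (pathEval_naturality adj _ q)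

/-- The map corresponding to `boxBoundary` under the path adjunction. -/
def pathBoundary {X A : C} (q : X ⟶ A) :
    P.obj X ⟶ pullback (pullback.snd q (pathEval adj cyl.d₀ A) ≫ pathEval adj cyl.d₁ A) q :=
  pullback.lift (pullback.lift (pathEval adj cyl.d₀ X) (P.map q) (pathEval_naturality adj _ q))
    (pathEval adj cyl.d₁ X) (by rw [pullback.lift_snd_assoc, pathEval_naturality])

variable [HasPushouts C]

/-- Transposition: both kinds of squares consist of the same data, namely a map on the end `1`, a
cylinder on `K` and a cylinder in the base. -/
lemma hasLiftingProperty_pathOne_iff {K L X A : C} (i : K ⟶ L) (q : X ⟶ A) :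
    HasLiftingProperty i (pathOne adj q) ↔ HasLiftingProperty (cyl.boxOne i) q := by
  rw [hasLiftingProperty_boxOne_iff]
  refine ⟨fun H v u b h₁ h₂ h₃ ↦ ?_, fun h ↦ ⟨fun {f g} sq ↦ ?_⟩⟩
  · obtain ⟨l, hl, hl'⟩ := H.exists_lift (f := adj.homEquiv _ _ u)
        (g := pullback.lift v (adj.homEquiv _ _ b) (by rw [h₃, homEquiv_pathEval])) (by
      apply pullback.hom_ext
      · simp only [pathOne, homEquiv_pathEval, h₁, Category.assoc, pullback.lift_fst]
      · simp only [pathOne, ← Adjunction.homEquiv_naturality_left,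
          ← Adjunction.homEquiv_naturality_right, h₂, Category.assoc, pullback.lift_snd])
    have hl₁ := hl' =≫ pullback.fst _ _
    have hl₂ := hl' =≫ pullback.snd _ _
    simp only [pathOne, Category.assoc, pullback.lift_fst, pullback.lift_snd] at hl₁ hl₂
    refine ⟨(adj.homEquiv _ _).symm l, ?_, ?_, ?_⟩
    · rw [← comp_pathEval, hl₁]
    · rw [← Adjunction.homEquiv_naturality_left_symm, hl, Equiv.symm_apply_apply]
    · rw [← Adjunction.homEquiv_naturality_right_symm, hl₂, Equiv.symm_apply_apply]
  · have w₁ := sq.w =≫ pullback.fst _ _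
    have w₂ := sq.w =≫ pullback.snd _ _
    have hg := g ≫= pullback.condition (f := q) (g := pathEval adj cyl.d₁ A)
    simp only [pathOne, Category.assoc, pullback.lift_fst, pullback.lift_snd] at w₁ w₂
    obtain ⟨l, h₁, h₂, h₃⟩ := h (g ≫ pullback.fst _ _) ((adj.homEquiv _ _).symm f)
      ((adj.homEquiv _ _).symm (g ≫ pullback.snd _ _))
      (by rw [← w₁, comp_pathEval])
      (by rw [← Adjunction.homEquiv_naturality_right_symm, w₂,
        Adjunction.homEquiv_naturality_left_symm])
      (by rw [← comp_pathEval]; simpa using hg)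
    refine ⟨⟨adj.homEquiv _ _ l, ?_, ?_⟩⟩
    · rw [← Adjunction.homEquiv_naturality_left, h₂, Equiv.apply_symm_apply]
    · apply pullback.hom_ext
      · simp only [pathOne, Category.assoc, pullback.lift_fst, homEquiv_pathEval, h₁]
      · simp only [pathOne, Category.assoc, pullback.lift_snd,
          ← Adjunction.homEquiv_naturality_right, h₃, Equiv.apply_symm_apply]

variable [HasBinaryCoproducts C]

/-- The same transposition with both ends; the iterated pullback records lifts of the two ends of
one path in the base. -/
lemma hasLiftingProperty_pathBoundary_iff {K L X A : C} (i : K ⟶ L) (q : X ⟶ A) :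
    HasLiftingProperty i (pathBoundary adj q) ↔ HasLiftingProperty (cyl.boxBoundary i) q := by
  rw [hasLiftingProperty_boxBoundary_iff]
  refine ⟨fun H v₀ v₁ u b h₀ h₁ h₂ h₃ h₄ ↦ ?_, fun h ↦ ⟨fun {f g} sq ↦ ?_⟩⟩
  · obtain ⟨l, hl, hl'⟩ := H.exists_lift (f := adj.homEquiv _ _ u)
        (g := pullback.lift (pullback.lift v₀ (adj.homEquiv _ _ b)
          (by rw [h₃, homEquiv_pathEval])) v₁
          (by rw [pullback.lift_snd_assoc, h₄, homEquiv_pathEval])) (by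
      apply pullback.hom_ext
      · apply pullback.hom_ext
        · simp only [pathBoundary, homEquiv_pathEval, h₀, Category.assoc, pullback.lift_fst]
        · simp only [pathBoundary, ← Adjunction.homEquiv_naturality_left,
            ← Adjunction.homEquiv_naturality_right, h₂, Category.assoc, pullback.lift_fst,
            pullback.lift_snd]
      · simp only [pathBoundary, homEquiv_pathEval, h₁, Category.assoc, pullback.lift_snd])
    have hl₀ := (hl' =≫ pullback.fst _ _) =≫ pullback.fst _ _
    have hl₁ := hl' =≫ pullback.snd _ _
    have hl₂ := (hl' =≫ pullback.fst _ _) =≫ pullback.snd _ _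
    simp only [pathBoundary, Category.assoc, pullback.lift_fst, pullback.lift_snd] at hl₀ hl₁ hl₂
    refine ⟨(adj.homEquiv _ _).symm l, ?_, ?_, ?_, ?_⟩
    · rw [← comp_pathEval, hl₀]
    · rw [← comp_pathEval, hl₁]
    · rw [← Adjunction.homEquiv_naturality_left_symm, hl, Equiv.symm_apply_apply]
    · rw [← Adjunction.homEquiv_naturality_right_symm, hl₂, Equiv.symm_apply_apply]
  · have w₀ := (sq.w =≫ pullback.fst _ _) =≫ pullback.fst _ _
    have w₁ := sq.w =≫ pullback.snd _ _
    have w₂ := (sq.w =≫ pullback.fst _ _) =≫ pullback.snd _ _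
    have hg₁ := g ≫= pullback.condition
      (f := pullback.snd q (pathEval adj cyl.d₀ A) ≫ pathEval adj cyl.d₁ A) (g := q)
    have hg₀ := (g ≫ pullback.fst _ _) ≫= pullback.condition (f := q)
      (g := pathEval adj cyl.d₀ A)
    simp only [pathBoundary, Category.assoc, pullback.lift_fst, pullback.lift_snd] at w₀ w₁ w₂
    obtain ⟨l, h₀, h₁, h₂, h₃⟩ := h (g ≫ pullback.fst _ _ ≫ pullback.fst _ _)
      (g ≫ pullback.snd _ _) ((adj.homEquiv _ _).symm f)
      ((adj.homEquiv _ _).symm (g ≫ pullback.fst _ _ ≫ pullback.snd _ _))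
      (by rw [← w₀, comp_pathEval]) (by rw [← w₁, comp_pathEval])
      (by rw [← Adjunction.homEquiv_naturality_right_symm, w₂,
        Adjunction.homEquiv_naturality_left_symm])
      (by rw [← comp_pathEval]; simpa using hg₀) (by rw [← comp_pathEval]; simpa using hg₁.symm)
    refine ⟨⟨adj.homEquiv _ _ l, ?_, ?_⟩⟩
    · rw [← Adjunction.homEquiv_naturality_left, h₂, Equiv.apply_symm_apply]
    · apply pullback.hom_ext
      · apply pullback.hom_ext
        · simp only [pathBoundary, Category.assoc, pullback.lift_fst, homEquiv_pathEval, h₀]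
        · simp only [pathBoundary, Category.assoc, pullback.lift_fst, pullback.lift_snd,
            ← Adjunction.homEquiv_naturality_right, h₃, Equiv.apply_symm_apply]
      · simp only [pathBoundary, Category.assoc, pullback.lift_snd, homEquiv_pathEval, h₁]

/-- If the two coordinates of `I ⋙ I` can be exchanged, the lifting properties for
`boxBoundary (boxOne i)` are those for `boxOne (boxBoundary i)`. -/
lemma hasLiftingProperty_boxBoundary_boxOne (s : ∀ K, cyl.I.obj (cyl.I.obj K) ⟶ cyl.I.obj (cyl.I.obj K))
    (hsn : ∀ {K L : C} (i : K ⟶ L), cyl.I.map (cyl.I.map i) ≫ s L = s K ≫ cyl.I.map (cyl.I.map i))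
    (hs : ∀ K, s K ≫ s K = 𝟙 _)
    (hs₀ : ∀ K, cyl.I.map (cyl.endMap cyl.d₀ K) ≫ s K = cyl.endMap cyl.d₀ (cyl.I.obj K))
    (hs₁ : ∀ K, cyl.I.map (cyl.endMap cyl.d₁ K) ≫ s K = cyl.endMap cyl.d₁ (cyl.I.obj K))
    {K L X A : C} (i : K ⟶ L) (q : X ⟶ A)
    (hq : HasLiftingProperty (cyl.boxBoundary i) (pathOne adj q)) :
    HasLiftingProperty (cyl.boxBoundary (cyl.boxOne i)) q := by
  have hs₀' (K) : cyl.endMap cyl.d₀ (cyl.I.obj K) ≫ s K = cyl.I.map (cyl.endMap cyl.d₀ K) := by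
    rw [← hs₀, Category.assoc, hs, Category.comp_id]
  have hs₁' (K) : cyl.endMap cyl.d₁ (cyl.I.obj K) ≫ s K = cyl.I.map (cyl.endMap cyl.d₁ K) := by
    rw [← hs₁, Category.assoc, hs, Category.comp_id]
  have hsi := hsn i
  rw [hasLiftingProperty_boxBoundary_iff] at hq ⊢
  intro v₀ v₁ u b h₀ h₁ h₂ h₃ h₄
  have h₀l := cyl.boxOneInl i ≫= h₀
  have h₀r := cyl.boxOneInr i ≫= h₀
  have h₁l := cyl.boxOneInl i ≫= h₁
  have h₁r := cyl.boxOneInr i ≫= h₁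
  have h₂l := cyl.I.map (cyl.boxOneInl i) ≫= h₂
  have h₂r := cyl.I.map (cyl.boxOneInr i) ≫= h₂
  have hu := congr_arg (fun t ↦ cyl.I.map t ≫ u) (cyl.isPushout_boxOne i).w
  simp only [Functor.map_comp, Category.assoc] at hu
  rw [← Category.assoc, boxOneInl_boxOne, ← Category.assoc (cyl.boxOneInl i), endMap_naturality,
    Category.assoc] at h₀l
  rw [← Category.assoc, boxOneInr_boxOne, ← Category.assoc (cyl.boxOneInr i), endMap_naturality,
    Category.assoc] at h₀r
  rw [← Category.assoc, boxOneInl_boxOne, ← Category.assoc (cyl.boxOneInl i), endMap_naturality,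
    Category.assoc] at h₁l
  rw [← Category.assoc, boxOneInr_boxOne, ← Category.assoc (cyl.boxOneInr i), endMap_naturality,
    Category.assoc] at h₁r
  rw [← Functor.map_comp_assoc, boxOneInl_boxOne] at h₂l
  rw [← Functor.map_comp_assoc, boxOneInr_boxOne] at h₂r
  -- In the given problem the outer interval carries the two ends and the inner one the box at `1`.
  -- Transposing `pathOne` uses the opposite order, hence the exchanges `s`.
  obtain ⟨l, e₀, e₁, e₂, e₃⟩ := hq (adj.homEquiv _ _ v₀) (adj.homEquiv _ _ v₁)
    (adj.homEquiv _ _ (s K ≫ cyl.I.map (cyl.boxOneInr i) ≫ u))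
    (pullback.lift (cyl.I.map (cyl.boxOneInl i) ≫ u) (adj.homEquiv _ _ (s L ≫ b)) (by
      rw [homEquiv_pathEval, Category.assoc, h₂l, reassoc_of% hs₁']))
    (by
      rw [← Adjunction.homEquiv_naturality_left, ← Adjunction.homEquiv_naturality_left,
        reassoc_of% hs₀, h₀r])
    (by
      rw [← Adjunction.homEquiv_naturality_left, ← Adjunction.homEquiv_naturality_left,
        reassoc_of% hs₁, h₁r])
    (by
      ext
      · simp only [pathOne, Category.assoc, pullback.lift_fst, homEquiv_pathEval]
        rw [reassoc_of% hs₁', ← hu]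
      · simp only [pathOne, Category.assoc, pullback.lift_snd]
        rw [← Adjunction.homEquiv_naturality_left, ← Adjunction.homEquiv_naturality_right]
        simp only [Category.assoc]
        rw [h₂r, reassoc_of% hsi])
    (by
      ext
      · simp only [pathOne, Category.assoc, pullback.lift_fst, homEquiv_pathEval]
        exact h₀l
      · simp only [pathOne, Category.assoc, pullback.lift_snd]
        rw [← Adjunction.homEquiv_naturality_left, ← Adjunction.homEquiv_naturality_right, h₃,
          reassoc_of% hs₀])
    (by
      ext
      · simp only [pathOne, Category.assoc, pullback.lift_fst, homEquiv_pathEval]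
        exact h₁l
      · simp only [pathOne, Category.assoc, pullback.lift_snd]
        rw [← Adjunction.homEquiv_naturality_left, ← Adjunction.homEquiv_naturality_right, h₄,
          reassoc_of% hs₁])
  have e₃l := e₃ =≫ pullback.fst _ _
  have e₃r := e₃ =≫ pullback.snd _ _
  simp only [pathOne, Category.assoc, pullback.lift_fst, pullback.lift_snd] at e₃l e₃r
  refine ⟨s L ≫ (adj.homEquiv _ _).symm l, ?_, ?_, ?_, ?_⟩
  · rw [reassoc_of% hs₀', ← Adjunction.homEquiv_naturality_left_symm, e₀, Equiv.symm_apply_apply]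
  · rw [reassoc_of% hs₁', ← Adjunction.homEquiv_naturality_left_symm, e₁, Equiv.symm_apply_apply]
  -- As a left adjoint, `I` preserves the pushout defining `boxOne i`, so the equality can be tested
  -- on its two legs.
  · have := adj.leftAdjoint_preservesColimits
    apply ((cyl.isPushout_boxOne i).map cyl.I).hom_ext
    · rw [← Functor.map_comp_assoc, boxOneInl_boxOne, reassoc_of% hs₁, ← comp_pathEval, e₃l]
    · rw [← Functor.map_comp_assoc, boxOneInr_boxOne, reassoc_of% hsi,
        ← Adjunction.homEquiv_naturality_left_symm, e₂, Equiv.symm_apply_apply, reassoc_of% hs]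
  · rw [Category.assoc, ← Adjunction.homEquiv_naturality_right_symm, e₃r,
      Equiv.symm_apply_apply, reassoc_of% hs]

end Path

end FunctorialCylinder

/-! ### Marked simplicial sets: pullbacks, path objects and monomorphisms -/

namespace MarkedSSet

lemma app_σ {X Y : SSet.{u}} (f : X ⟶ Y) (x : X _⦋0⦌) :
    f.app (op ⦋1⦌) (X.σ 0 x) = Y.σ 0 (f.app (op ⦋0⦌) x) :=
  ConcreteCategory.congr_hom (SimplicialObject.σ_naturality f (0 : Fin 1)) x

/-- A map from `A^♭` is a map of the underlying simplicial sets. -/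
def flatHom {A : SSet.{u}} {X : MarkedSSet.{u}} (f : A ⟶ X.toSSet) : flat.obj A ⟶ X :=
  ⟨f, by
    rintro _ ⟨x, rfl⟩
    exact app_σ f x ▸ X.degenerate_mem _⟩

/-- The only nondegenerate edge of `Δ¹` is sent to `e`; all others have degenerate image. -/
lemma yonedaEquiv_symm_app_mem {X : MarkedSSet.{u}} {e : X.toSSet _⦋1⦌} (he : e ∈ X.marked)
    (z : (Δ[1] : SSet.{u}) _⦋1⦌) : (SSet.yonedaEquiv.symm e).app _ z ∈ X.marked := by
  have key (a b : Fin 2) (h : a ≠ b) (h' : a ≤ b) : a = 0 ∧ b = 1 := by omega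
  by_cases h : z 0 = z 1
  · have : z = (Δ[1] : SSet.{u}).σ 0 (SSet.stdSimplex.const 1 (z 0) _) :=
      SSet.stdSimplex.ext _ _ fun k ↦ by
        fin_cases k
        · rfl
        · exact h.symm
    rw [this, app_σ]
    exact X.degenerate_mem _
  · have hle : z 0 ≤ z 1 := (SSet.stdSimplex.objEquiv z).toOrderHom.monotone (Fin.zero_le 1)
    have : z = SSet.yonedaEquiv (𝟙 Δ[1]) := SSet.stdSimplex.ext _ _ fun k ↦ by
      fin_cases k
      · exact (key _ _ h hle).1
      · exact (key _ _ h hle).2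
    rw [this, SSet.yonedaEquiv_symm_app_id]
    exact he

/-- A map to `A^♯` is a map of the underlying simplicial sets. -/
def sharpHom {A : SSet.{u}} {X : MarkedSSet.{u}} (f : X.toSSet ⟶ A) : X ⟶ sharp.obj A :=
  ⟨f, fun _ _ ↦ trivial⟩

/-- The forgetful functor is left adjoint to `sharp`. -/
def forgetSharpAdjunction : forget.{u} ⊣ sharp :=
  Adjunction.mkOfHomEquiv
    { homEquiv _ _ :=
        { toFun f := sharpHom f
          invFun f := f.hom
          left_inv _ := rfl
          right_inv _ := rfl }
      homEquiv_naturality_left_symm _ _ := rfl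
      homEquiv_naturality_right _ _ := rfl }

instance : PreservesColimitsOfSize.{w, v} forget.{u} :=
  forgetSharpAdjunction.leftAdjoint_preservesColimits

section Pullback

variable {X Y Z : MarkedSSet.{u}} (f : X ⟶ Z) (g : Y ⟶ Z)

/-- The pullback of marked simplicial sets. -/
@[simps]
def pullbackObj : MarkedSSet.{u} where
  toSSet := pullback f.hom g.hom
  marked := {e | (pullback.fst f.hom g.hom).app _ e ∈ X.marked ∧
    (pullback.snd f.hom g.hom).app _ e ∈ Y.marked}
  degenerate_mem x := ⟨app_σ (pullback.fst f.hom g.hom) x ▸ X.degenerate_mem _,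
    app_σ (pullback.snd f.hom g.hom) x ▸ Y.degenerate_mem _⟩

instance : HasPullback f g where
  exists_limit := ⟨{
    cone := PullbackCone.mk (W := pullbackObj f g) ⟨pullback.fst f.hom g.hom, fun _ h ↦ h.1⟩
      ⟨pullback.snd f.hom g.hom, fun _ h ↦ h.2⟩ (hom_ext pullback.condition)
    isLimit := PullbackCone.IsLimit.mk _
      (fun s ↦ ⟨pullback.lift s.fst.hom s.snd.hom (congr_arg Hom.hom s.condition), fun e he ↦ by
        have h₁ := SSet.app_app_eq (f' := s.fst.hom) (g' := 𝟙 _) ((pullback.lift_fst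
          s.fst.hom s.snd.hom (congr_arg Hom.hom s.condition)).trans (Category.comp_id _).symm) e
        have h₂ := SSet.app_app_eq (f' := s.snd.hom) (g' := 𝟙 _) ((pullback.lift_snd
          s.fst.hom s.snd.hom (congr_arg Hom.hom s.condition)).trans (Category.comp_id _).symm) e
        exact ⟨h₁ ▸ s.fst.map_marked e he, h₂ ▸ s.snd.map_marked e he⟩⟩)
      (fun s ↦ hom_ext (pullback.lift_fst _ _ _)) (fun s ↦ hom_ext (pullback.lift_snd _ _ _))
      (fun s m h₁ h₂ ↦ hom_ext (pullback.hom_ext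
        ((congr_arg Hom.hom h₁).trans (pullback.lift_fst _ _ _).symm)
        ((congr_arg Hom.hom h₂).trans (pullback.lift_snd _ _ _).symm))) }⟩

instance : HasPullbacks MarkedSSet.{u} := hasPullbacks_of_hasLimit_cospan _

end Pullback

section Path

/-- The simplicial set of maps `(Δ¹)^♯ × (Δⁿ)^♭ ⟶ X`. -/
def pathSSet (X : MarkedSSet.{u}) : SSet.{u} :=
  (SSet.stdSimplex ⋙ flat ⋙ cylinder.I).op ⋙ yoneda.obj X

/-- The marked simplicial set of marked edges of `X`. -/
def pathObj (X : MarkedSSet.{u}) : MarkedSSet.{u} where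
  toSSet := pathSSet X
  marked := {e | ∀ z, (Hom.hom (X := cylinder.I.obj (flat.obj Δ[1])) e).app (op ⦋1⦌) z ∈ X.marked}
  degenerate_mem x z := by
    refine (x : cylinder.I.obj (flat.obj Δ[0]) ⟶ X).map_marked _ ⟨trivial, ?_⟩
    refine ⟨SSet.stdSimplex.const 0 0 _, ?_⟩
    exact SSet.stdSimplex.ext _ _ fun _ ↦ Subsingleton.elim (α := Fin 1) _ _

/-- A simplex of `pathObj X` as a map to `X`. -/
def pathHom {X : MarkedSSet.{u}} {n : SimplexCategoryᵒᵖ} (e : (pathObj X).toSSet.obj n) :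
    cylinder.I.obj (flat.obj (SSet.stdSimplex.obj n.unop)) ⟶ X := e

lemma pathHom_map {K : SSet.{u}} {X : MarkedSSet.{u}} (g : K ⟶ (pathObj X).toSSet)
    {n m : SimplexCategoryᵒᵖ} (φ : n ⟶ m) (k : K.obj n) {d : SimplexCategoryᵒᵖ}
    (z : (Δ[1] ⊗ SSet.stdSimplex.obj m.unop : SSet.{u}).obj d) :
    (pathHom (g.app m (K.map φ k))).hom.app d z =
      (pathHom (g.app n k)).hom.app d (z.1, (SSet.stdSimplex.map φ.unop).app d z.2) :=
  congr_arg (fun t ↦ (pathHom t).hom.app d z) (NatTrans.naturality_apply g φ k)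

/-- The universal property of `pathObj`. -/
def pathEquiv (K X : MarkedSSet.{u}) : (cylinder.I.obj K ⟶ X) ≃ (K ⟶ pathObj X) where
  toFun f :=
    { hom :=
        { app n := ↾fun k ↦ cylinder.I.map (flatHom (SSet.yonedaEquiv.symm k)) ≫ f
          naturality n m φ := by
            ext k
            refine hom_ext ?_
            exact congr_arg (fun t ↦ (Δ[1] ◁ t) ≫ f.hom)
              (SSet.yonedaEquiv_symm_naturality_left φ.unop k).symm }
      map_marked e he z := by
        refine f.map_marked _ ⟨trivial, ?_⟩
        exact yonedaEquiv_symm_app_mem he z.2 }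
  invFun g :=
    { hom :=
        { app n := ↾fun z ↦ (pathHom (g.hom.app n z.2)).hom.app n
            (z.1, SSet.yonedaEquiv (𝟙 (SSet.stdSimplex.obj n.unop)))
          naturality n m φ := by
            ext z
            refine (pathHom_map g.hom φ z.2 (Δ[1].map φ z.1, SSet.yonedaEquiv (𝟙 _))).trans ?_
            let z' : (Δ[1] ⊗ SSet.stdSimplex.obj n.unop : SSet.{u}).obj n :=
              (z.1, SSet.yonedaEquiv (𝟙 (SSet.stdSimplex.obj n.unop)))
            exact NatTrans.naturality_apply (pathHom (g.hom.app n z.2)).hom φ z' }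
      map_marked := by
        -- The edge in question belongs to the square `g z.2`, all of whose edges are marked by the
        -- definition of `pathObj`.
        rintro z ⟨-, hz⟩
        exact g.map_marked _ hz _ }
  left_inv f := by
    refine hom_ext ?_
    ext ⟨⟨n⟩⟩ z
    exact congr_arg (fun t ↦ f.hom.app _ (z.1, t)) (SSet.yonedaEquiv_symm_app_id z.2)
  right_inv g := by
    refine hom_ext ?_
    ext n k
    refine hom_ext ?_
    ext m z
    refine (pathHom_map g.hom (SSet.stdSimplex.objEquiv z.2).op k
      (z.1, SSet.yonedaEquiv (𝟙 _))).trans ?_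
    refine congr_arg (fun t ↦ (pathHom (g.hom.app n k)).hom.app m (z.1, t)) ?_
    apply SSet.stdSimplex.objEquiv.injective
    exact Category.id_comp (SSet.stdSimplex.objEquiv z.2)

lemma pathEquiv_naturality (K L X : MarkedSSet.{u}) (i : K ⟶ L) (f : cylinder.I.obj L ⟶ X) :
    pathEquiv K X (cylinder.I.map i ≫ f) = i ≫ pathEquiv L X f := by
  refine hom_ext ?_
  ext n k
  refine hom_ext ?_
  exact congr_arg (fun t ↦ (Δ[1] ◁ t) ≫ f.hom) (SSet.yonedaEquiv_symm_comp k i.hom)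

/-- The right adjoint of the cylinder. -/
def path : MarkedSSet.{u} ⥤ MarkedSSet.{u} :=
  Adjunction.rightAdjointOfEquiv (F := cylinder.I) pathEquiv pathEquiv_naturality

/-- The adjunction between the cylinder and the path object. -/
def pathAdjunction : cylinder.I ⊣ path.{u} := Adjunction.adjunctionOfEquivRight _ _

end Path

/-- The exchange of the coordinates of `(Δ¹)^♯ × (Δ¹)^♯ × K`. -/
def swap (K : MarkedSSet.{u}) : cylinder.I.obj (cylinder.I.obj K) ⟶ cylinder.I.obj (cylinder.I.obj K) :=
  ⟨CartesianMonoidalCategory.lift (CartesianMonoidalCategory.snd _ _ ≫ CartesianMonoidalCategory.fst _ _)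
    (CartesianMonoidalCategory.lift (CartesianMonoidalCategory.fst _ _)
      (CartesianMonoidalCategory.snd _ _ ≫ CartesianMonoidalCategory.snd _ _)),
    fun _ he ↦ ⟨trivial, trivial, he.2.2⟩⟩

lemma swap_swap (K : MarkedSSet.{u}) : swap K ≫ swap K = 𝟙 _ := rfl

lemma swap_naturality {K L : MarkedSSet.{u}} (i : K ⟶ L) :
    cylinder.I.map (cylinder.I.map i) ≫ swap L = swap K ≫ cylinder.I.map (cylinder.I.map i) := rfl

lemma map_endMap_swap₀ (K : MarkedSSet.{u}) :
    cylinder.I.map (cylinder.endMap cylinder.d₀ K) ≫ swap K =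
      cylinder.endMap cylinder.d₀ (cylinder.I.obj K) := rfl

lemma map_endMap_swap₁ (K : MarkedSSet.{u}) :
    cylinder.I.map (cylinder.endMap cylinder.d₁ K) ≫ swap K =
      cylinder.endMap cylinder.d₁ (cylinder.I.obj K) := rfl

section Mono

/-- As `forget` is left adjoint to `sharp`, the underlying simplices of a pushout are computed
levelwise. -/
lemma exists_pushout_rep {K L M : MarkedSSet.{u}} {f : K ⟶ L} {g : K ⟶ M} {N : MarkedSSet.{u}}
    {inl : L ⟶ N} {inr : M ⟶ N} (h : IsPushout f g inl inr) {d : ℕ} (x : N.toSSet _⦋d⦌) :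
    (∃ y, inl.hom.app _ y = x) ∨ ∃ y, inr.hom.app _ y = x := by
  have := (h.map forget).map ((evaluation _ _).obj (op ⦋d⦌))
  have := Types.jointly_surjective_of_isColimit this.isColimit x
  obtain ⟨_ | _ | _, y, hy⟩ := this
  · exact Or.inl ⟨f.hom.app _ y, hy⟩
  · exact Or.inl ⟨y, hy⟩
  · exact Or.inr ⟨y, hy⟩

lemma exists_coprod_rep {K L : MarkedSSet.{u}} {d : ℕ} (x : (K ⨿ L).toSSet _⦋d⦌) :
    (∃ y, (coprod.inl : K ⟶ K ⨿ L).hom.app _ y = x) ∨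
      ∃ y, (coprod.inr : L ⟶ K ⨿ L).hom.app _ y = x := by
  have := Types.jointly_surjective_of_isColimit (isColimitOfPreserves
    (forget ⋙ (evaluation _ _).obj (op ⦋d⦌)) (coprodIsCoprod K L)) x
  obtain ⟨⟨_ | _⟩, y, hy⟩ := this
  · exact Or.inl ⟨y, hy⟩
  · exact Or.inr ⟨y, hy⟩

lemma mono_hom_of_injective {K L : MarkedSSet.{u}} (f : K ⟶ L)
    (h : ∀ (d : ℕ) (x y : K.toSSet _⦋d⦌), f.hom.app _ x = f.hom.app _ y → x = y) :
    underlyingMono f := by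
  refine (NatTrans.mono_iff_mono_app _).2 ?_
  rintro ⟨⟨d⟩⟩
  exact (mono_iff_injective _).2 fun x y hxy ↦ h d x y hxy

lemma injective_of_underlyingMono {K L : MarkedSSet.{u}} {f : K ⟶ L} (h : underlyingMono f) {d : ℕ}
    {x y : K.toSSet _⦋d⦌} (hxy : f.hom.app _ x = f.hom.app _ y) : x = y :=
  (mono_iff_injective _).1 ((NatTrans.mono_iff_mono_app _).1 h (op ⦋d⦌)) hxy

lemma hom_app_app_eq {K L L' M : MarkedSSet.{u}} {f : K ⟶ L} {g : L ⟶ M} {f' : K ⟶ L'} {g' : L' ⟶ M}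
    (h : f ≫ g = f' ≫ g') {d : ℕ} (x : K.toSSet _⦋d⦌) :
    g.hom.app _ (f.hom.app _ x) = g'.hom.app _ (f'.hom.app _ x) :=
  SSet.app_app_eq (congr_arg Hom.hom h) x

lemma hom_app_eq {K L M : MarkedSSet.{u}} {f : K ⟶ L} {g : L ⟶ M} {f' : K ⟶ M}
    (h : f ≫ g = f') {d : ℕ} (x : K.toSSet _⦋d⦌) :
    g.hom.app _ (f.hom.app _ x) = f'.hom.app _ x := by
  subst h
  rfl

variable {K L : MarkedSSet.{u}} {i : K ⟶ L}

/-- `I.map i` does not change the interval coordinate. This identifies the intersection of an end of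
`I ⊗ L` with the image of `I ⊗ K`. -/
lemma eq_endMap_app (d : 𝟭 _ ⟶ cylinder.{u}.I) (hd : d = cylinder.d₀ ∨ d = cylinder.d₁) {m : ℕ}
    (x : (cylinder.I.obj K).toSSet _⦋m⦌) (y : L.toSSet _⦋m⦌)
    (h : (cylinder.I.map i).hom.app _ x = (cylinder.endMap d L).hom.app _ y) :
    x = (cylinder.endMap d K).hom.app _ x.2 ∧ y = i.hom.app _ x.2 := by
  have h₁ := congr_arg (fun q : (Δ[1] ⊗ L.toSSet : SSet.{u}) _⦋m⦌ ↦ q.1) h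
  have h₂ := congr_arg (fun q : (Δ[1] ⊗ L.toSSet : SSet.{u}) _⦋m⦌ ↦ q.2) h
  obtain rfl | rfl := hd
  · exact ⟨Prod.ext h₁ rfl, h₂.symm⟩
  · exact ⟨Prod.ext h₁ rfl, h₂.symm⟩

lemma injective_I_map (h : underlyingMono i) {m : ℕ} {x y : (cylinder.I.obj K).toSSet _⦋m⦌}
    (hxy : (cylinder.I.map i).hom.app _ x = (cylinder.I.map i).hom.app _ y) : x = y :=
  Prod.ext (congr_arg (fun q : (Δ[1] ⊗ L.toSSet : SSet.{u}) _⦋m⦌ ↦ q.1) hxy)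
    (injective_of_underlyingMono h
      (congr_arg (fun q : (Δ[1] ⊗ L.toSSet : SSet.{u}) _⦋m⦌ ↦ q.2) hxy))

/-- Both pieces of the pushout inject into the cylinder, and they meet there only in the end over
`K`, along which they are glued. -/
lemma underlyingMono_boxOne (h : underlyingMono i) : underlyingMono (cylinder.boxOne i) := by
  have key (m : ℕ) (z : (cylinder.I.obj K).toSSet _⦋m⦌) (y : L.toSSet _⦋m⦌)
      (hzy : (cylinder.I.map i).hom.app _ z = (cylinder.endMap cylinder.d₁ L).hom.app _ y) :
      (cylinder.boxOneInr i).hom.app _ z = (cylinder.boxOneInl i).hom.app _ y := by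
    obtain ⟨h₁, h₂⟩ := eq_endMap_app _ (Or.inr rfl) z y hzy
    rw [h₁, h₂]
    exact (hom_app_app_eq (cylinder.isPushout_boxOne i).w z.2).symm
  have hl := cylinder.boxOneInl_boxOne i
  have hr := cylinder.boxOneInr_boxOne i
  refine mono_hom_of_injective _ fun d x y hxy ↦ ?_
  obtain ⟨x, rfl⟩ | ⟨x, rfl⟩ := exists_pushout_rep (cylinder.isPushout_boxOne i) x <;>
  obtain ⟨y, rfl⟩ | ⟨y, rfl⟩ := exists_pushout_rep (cylinder.isPushout_boxOne i) y
  · rw [hom_app_eq hl, hom_app_eq hl] at hxy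
    exact congr_arg _ (congr_arg (fun q : (Δ[1] ⊗ L.toSSet : SSet.{u}) _⦋d⦌ ↦ q.2) hxy)
  · rw [hom_app_eq hl, hom_app_eq hr] at hxy
    exact (key _ _ _ hxy.symm).symm
  · rw [hom_app_eq hr, hom_app_eq hl] at hxy
    exact key _ _ _ hxy
  · rw [hom_app_eq hr, hom_app_eq hr] at hxy
    exact congr_arg _ (injective_I_map h hxy)

/-- As for `boxOne`, with two ends that are disjoint because the vertices of `Δ¹` are distinct. -/
lemma underlyingMono_boxBoundary (h : underlyingMono i) :
    underlyingMono (cylinder.boxBoundary i) := by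
  have hp := IsPushout.of_hasPushout (coprod.map i i) (cylinder.boundaryMap K)
  let j₀ : L ⟶ pushout (coprod.map i i) (cylinder.boundaryMap K) := coprod.inl ≫ pushout.inl _ _
  let j₁ : L ⟶ pushout (coprod.map i i) (cylinder.boundaryMap K) := coprod.inr ≫ pushout.inl _ _
  let r : cylinder.I.obj K ⟶ pushout (coprod.map i i) (cylinder.boundaryMap K) := pushout.inr _ _
  have hl : pushout.inl _ _ ≫ cylinder.boxBoundary i = cylinder.boundaryMap L :=
    pushout.inl_desc ..
  have hr : r ≫ cylinder.boxBoundary i = cylinder.I.map i := pushout.inr_desc ..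
  have hj₀ : j₀ ≫ cylinder.boxBoundary i = cylinder.endMap cylinder.d₀ L := by
    rw [Category.assoc, hl, FunctorialCylinder.inl_boundaryMap]
  have hj₁ : j₁ ≫ cylinder.boxBoundary i = cylinder.endMap cylinder.d₁ L := by
    rw [Category.assoc, hl, FunctorialCylinder.inr_boundaryMap]
  have w₀ : i ≫ j₀ = cylinder.endMap cylinder.d₀ K ≫ r := by
    rw [← FunctorialCylinder.inl_boundaryMap, Category.assoc, ← hp.w, coprod.inl_map_assoc]
  have w₁ : i ≫ j₁ = cylinder.endMap cylinder.d₁ K ≫ r := by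
    rw [← FunctorialCylinder.inr_boundaryMap, Category.assoc, ← hp.w, coprod.inr_map_assoc]
  have rep (m : ℕ) (x : (pushout (coprod.map i i) (cylinder.boundaryMap K)).toSSet _⦋m⦌) :
      (∃ y, j₀.hom.app _ y = x) ∨ (∃ y, j₁.hom.app _ y = x) ∨ ∃ y, r.hom.app _ y = x := by
    obtain ⟨x, rfl⟩ | ⟨x, rfl⟩ := exists_pushout_rep hp x
    · obtain ⟨x, rfl⟩ | ⟨x, rfl⟩ := exists_coprod_rep x
      · exact Or.inl ⟨x, rfl⟩
      · exact Or.inr (Or.inl ⟨x, rfl⟩)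
    · exact Or.inr (Or.inr ⟨x, rfl⟩)
  have key₀ (m : ℕ) (z : (cylinder.I.obj K).toSSet _⦋m⦌) (y : L.toSSet _⦋m⦌)
      (hzy : (cylinder.I.map i).hom.app _ z = (cylinder.endMap cylinder.d₀ L).hom.app _ y) :
      r.hom.app _ z = j₀.hom.app _ y := by
    obtain ⟨h₁, h₂⟩ := eq_endMap_app _ (Or.inl rfl) z y hzy
    rw [h₁, h₂]
    exact (hom_app_app_eq w₀ z.2).symm
  have key₁ (m : ℕ) (z : (cylinder.I.obj K).toSSet _⦋m⦌) (y : L.toSSet _⦋m⦌)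
      (hzy : (cylinder.I.map i).hom.app _ z = (cylinder.endMap cylinder.d₁ L).hom.app _ y) :
      r.hom.app _ z = j₁.hom.app _ y := by
    obtain ⟨h₁, h₂⟩ := eq_endMap_app _ (Or.inr rfl) z y hzy
    rw [h₁, h₂]
    exact (hom_app_app_eq w₁ z.2).symm
  have ne (m : ℕ) (x y : L.toSSet _⦋m⦌) (hxy : (cylinder.endMap cylinder.d₀ L).hom.app _ x =
      (cylinder.endMap cylinder.d₁ L).hom.app _ y) : False := by
    have h₁ : ((cylinder.endMap cylinder.d₀ L).hom.app _ x).1 =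
        ((cylinder.endMap cylinder.d₁ L).hom.app _ y).1 :=
      congr_arg (fun q : (Δ[1] ⊗ L.toSSet : SSet.{u}) _⦋m⦌ ↦ q.1) hxy
    exact Fin.zero_ne_one (congr_arg (fun q : (Δ[1] : SSet.{u}) _⦋m⦌ ↦ q 0) h₁)
  refine mono_hom_of_injective _ fun d x y hxy ↦ ?_
  obtain ⟨x, rfl⟩ | ⟨x, rfl⟩ | ⟨x, rfl⟩ := rep _ x <;>
  obtain ⟨y, rfl⟩ | ⟨y, rfl⟩ | ⟨y, rfl⟩ := rep _ y
  · rw [hom_app_eq hj₀, hom_app_eq hj₀] at hxy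
    exact congr_arg _ (congr_arg (fun q : (Δ[1] ⊗ L.toSSet : SSet.{u}) _⦋d⦌ ↦ q.2) hxy)
  · rw [hom_app_eq hj₀, hom_app_eq hj₁] at hxy
    exact (ne _ _ _ hxy).elim
  · rw [hom_app_eq hj₀, hom_app_eq hr] at hxy
    exact (key₀ _ _ _ hxy.symm).symm
  · rw [hom_app_eq hj₁, hom_app_eq hj₀] at hxy
    exact (ne _ _ _ hxy.symm).elim
  · rw [hom_app_eq hj₁, hom_app_eq hj₁] at hxy
    exact congr_arg _ (congr_arg (fun q : (Δ[1] ⊗ L.toSSet : SSet.{u}) _⦋d⦌ ↦ q.2) hxy)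
  · rw [hom_app_eq hj₁, hom_app_eq hr] at hxy
    exact (key₁ _ _ _ hxy.symm).symm
  · rw [hom_app_eq hr, hom_app_eq hj₀] at hxy
    exact key₀ _ _ _ hxy
  · rw [hom_app_eq hr, hom_app_eq hj₁] at hxy
    exact key₁ _ _ _ hxy
  · rw [hom_app_eq hr, hom_app_eq hr] at hxy
    exact congr_arg _ (injective_I_map h hxy)

end Mono

end MarkedSSet

/-! ### A small set of generators -/

namespace SSet

/-- The simplicial set whose `m`-simplices are the functions from the `n`-simplices of `Δᵐ` to
`S`. -/
@[simps]
def coinduced (n : ℕ) (S : Type u) : SSet.{u} where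
  obj m := (⦋n⦌ ⟶ m.unop) → S
  map φ := ↾fun h α ↦ h (α ≫ φ.unop)

/-- The universal property of `coinduced`. -/
def toCoinduced (n : ℕ) {S : Type u} {K : SSet.{u}} (t : K _⦋n⦌ → S) : K ⟶ coinduced n S where
  app m := ↾fun k α ↦ t (K.map α.op k)
  naturality _ _ φ := by
    ext k
    exact funext fun α ↦ congr_arg t (ConcreteCategory.congr_hom (K.map_comp φ α.op) k).symm

lemma toCoinduced_app_id {n : ℕ} {S : Type u} {K : SSet.{u}} (t : K _⦋n⦌ → S) (k : K _⦋n⦌) :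
    (show (⦋n⦌ ⟶ ⦋n⦌) → S from (toCoinduced n t).app _ k) (𝟙 _) = t k :=
  congr_arg t (ConcreteCategory.congr_hom (K.map_id _) k)

lemma eq_toCoinduced {n : ℕ} {S : Type u} {K : SSet.{u}} (f : K ⟶ coinduced n S) :
    f = toCoinduced n (fun k ↦ (show (⦋n⦌ ⟶ ⦋n⦌) → S from f.app _ k) (𝟙 _)) := by
  ext m k
  refine funext fun α ↦ ?_
  have := congr_fun (NatTrans.naturality_apply f α.op k) (𝟙 _)
  refine Eq.trans ?_ this.symm
  exact congr_arg _ (Category.id_comp α).symm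

end SSet

namespace MarkedSSet

open FunctorialCylinder

/-- Maps to `coinduced d S` are functions on `d`-simplices, and functions extend along injections.
So the test map `q` lifts against monomorphisms, and lifting the identity function of the
`d`-simplices of `K` along `i` shows that `i` is injective on them. -/
lemma le_underlyingMono_of_llp_rlp {S : MorphismProperty MarkedSSet.{u}} (hS : S ≤ underlyingMono) :
    S.rlp.llp ≤ underlyingMono := by
  intro K L i hi
  refine mono_hom_of_injective _ fun d x y hxy ↦ ?_
  let E := SSet.coinduced d (K.toSSet _⦋d⦌)
  let q : sharp.obj E ⟶ sharp.obj (SSet.coinduced d PUnit) :=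
    sharpHom (SSet.toCoinduced d fun _ ↦ PUnit.unit)
  have hq : S.rlp q := by
    intro M N j hj
    refine ⟨fun {f g} sq ↦ ?_⟩
    have : Nonempty (K.toSSet _⦋d⦌) := ⟨x⟩
    let t : M.toSSet _⦋d⦌ → K.toSSet _⦋d⦌ := fun k ↦
      (show (⦋d⦌ ⟶ ⦋d⦌) → K.toSSet _⦋d⦌ from f.hom.app _ k) (𝟙 _)
    let t' : N.toSSet _⦋d⦌ → K.toSSet _⦋d⦌ := Function.extend (j.hom.app (op ⦋d⦌)) t
      (fun _ ↦ x)
    refine ⟨⟨sharpHom (SSet.toCoinduced d t'), hom_ext ?_, hom_ext ?_⟩⟩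
    · rw [SSet.eq_toCoinduced f.hom]
      ext m k
      refine funext fun α ↦ ?_
      refine (congr_arg t' (NatTrans.naturality_apply j.hom α.op k).symm).trans ?_
      exact Function.Injective.extend_apply
        (fun x y h ↦ injective_of_underlyingMono (hS _ hj) h) _ _ _
    · ext m k
      exact funext fun α ↦ rfl
  obtain ⟨l, hl, -⟩ := (hi q hq).exists_lift (f := sharpHom (SSet.toCoinduced d id))
    (g := sharpHom (SSet.toCoinduced d fun _ ↦ PUnit.unit)) (by
      refine hom_ext ?_
      ext m k
      exact funext fun α ↦ rfl)
  refine (SSet.toCoinduced_app_id id x).symm.trans (Eq.trans ?_ (SSet.toCoinduced_app_id id y))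
  refine congr_fun ?_ _
  exact (hom_app_eq hl x).symm.trans ((congr_arg _ hxy).trans (hom_app_eq hl y))

lemma app_mem_marked {X : MarkedSSet.{u}} (f : Δ[1] ⟶ X.toSSet)
    (hf : f.app _ (SSet.yonedaEquiv (𝟙 Δ[1])) ∈ X.marked) (z) : f.app _ z ∈ X.marked := by
  obtain ⟨e, rfl⟩ := SSet.yonedaEquiv.symm.surjective f
  rw [SSet.yonedaEquiv_symm_app_id] at hf
  exact yonedaEquiv_symm_app_mem hf z

/-- Trivial fibrations of marked simplicial sets. -/
lemma hasLiftingProperty_of_underlyingMono {X A : MarkedSSet.{u}} {q : X ⟶ A}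
    (h₁ : ∀ n, HasLiftingProperty (flat.map (∂Δ[n] : (Δ[n] : SSet.{u}).Subcomplex).ι) q)
    (h₂ : HasLiftingProperty (flatToSharp Δ[1]) q) {K L : MarkedSSet.{u}} {i : K ⟶ L}
    (hi : underlyingMono i) : HasLiftingProperty i q := by
  have hq : (MorphismProperty.monomorphisms SSet.{u}).rlp q.hom := by
    rw [SSet.rlp_monomorphisms]
    rintro _ _ _ ⟨n⟩
    refine ⟨fun {f g} sq ↦ ?_⟩
    obtain ⟨l, hl, hl'⟩ := (h₁ n).exists_lift (f := flatHom f) (g := flatHom g) (hom_ext sq.w)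
    exact ⟨⟨l.hom, congr_arg Hom.hom hl, congr_arg Hom.hom hl'⟩⟩
  refine ⟨fun {f g} sq ↦ ?_⟩
  obtain ⟨l, hl, hl'⟩ := (hq _ hi).exists_lift (congr_arg Hom.hom sq.w)
  refine ⟨⟨⟨l, fun e he ↦ ?_⟩, hom_ext hl, hom_ext hl'⟩⟩
  have he' : q.hom.app _ (l.app _ e) = g.hom.app _ e :=
    ConcreteCategory.congr_hom (congr_app hl' (op ⦋1⦌)) e
  -- `flatToSharp` is the identity on simplices, so the lift `l'` is the same edge and certifies
  -- that it is marked.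
  obtain ⟨l', h, -⟩ := h₂.exists_lift (f := flatHom (SSet.yonedaEquiv.symm (l.app _ e)))
    (g := ⟨SSet.yonedaEquiv.symm (g.hom.app _ e),
      fun z _ ↦ yonedaEquiv_symm_app_mem (g.map_marked e he) z⟩)
    (hom_ext ((SSet.yonedaEquiv_symm_comp _ _).trans (congr_arg _ he')))
  have h' := hom_app_eq h (SSet.yonedaEquiv (𝟙 Δ[1]))
  have h'' := h'.trans (SSet.yonedaEquiv_symm_app_id _)
  exact (congr_arg (· ∈ X.marked) h'').mp (l'.map_marked _ trivial)

/-- Squares whose edges in the direction of the interval and the edge over `1` are marked. -/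
lemma mem_marked_of_square {X A : MarkedSSet.{u}} {q : X ⟶ A}
    (hq : HasLiftingProperty (cylinder.boxOne (flatToSharp Δ[1])) q)
    (s : cylinder.I.obj (flat.obj Δ[1]) ⟶ X)
    (hs : (cylinder.endMap cylinder.d₁ (flat.obj Δ[1]) ≫ s).hom.app _ (SSet.yonedaEquiv (𝟙 Δ[1])) ∈
      X.marked) (hb : ∀ z, q.hom.app _ (s.hom.app _ z) ∈ A.marked) (z) :
    s.hom.app _ z ∈ X.marked := by
  rw [hasLiftingProperty_boxOne_iff] at hq
  -- This box is an isomorphism of underlying simplicial sets, so the lift is `s` again, now defined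
  -- on a square with all edges marked.
  obtain ⟨l, -, hl, -⟩ := hq
    ⟨(cylinder.endMap cylinder.d₁ (flat.obj Δ[1]) ≫ s).hom, fun z _ ↦
      app_mem_marked _ hs z⟩ s
    ⟨s.hom ≫ q.hom, fun z _ ↦ hb z⟩ rfl rfl rfl
  rw [← hl]
  exact l.map_marked _ ⟨trivial, trivial⟩

/-- Only markings are at stake. An edge `z` lies on the square over `z.2`, whose side over `1` is
marked through `v₁` and whose image in the base is marked through `b`. -/
lemma hasLiftingProperty_boxBoundary_flatToSharp {X A : MarkedSSet.{u}} {q : X ⟶ A}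
    (hq : HasLiftingProperty (cylinder.boxOne (flatToSharp Δ[1])) q) (J : SSet.{u}) :
    HasLiftingProperty (cylinder.boxBoundary (flatToSharp J)) q := by
  rw [hasLiftingProperty_boxBoundary_iff]
  intro v₀ v₁ u b h₀ h₁ h₂ h₃ h₄
  refine ⟨⟨u.hom, fun z _ ↦ ?_⟩, hom_ext (congr_arg Hom.hom h₀).symm,
    hom_ext (congr_arg Hom.hom h₁).symm, rfl, hom_ext (by have := congr_arg Hom.hom h₂; exact this)⟩
  let s : cylinder.I.obj (flat.obj Δ[1]) ⟶ X :=
    cylinder.I.map (flat.map (SSet.yonedaEquiv.symm z.2)) ≫ u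
  have hz : s.hom.app _ (z.1, SSet.yonedaEquiv (𝟙 Δ[1])) ∈ X.marked := by
    refine mem_marked_of_square hq s ?_ ?_ _
    · have h := hom_app_app_eq h₁ ((SSet.yonedaEquiv.symm z.2).app _ (SSet.yonedaEquiv (𝟙 Δ[1])))
      exact (congr_arg (· ∈ X.marked) h).mp (v₁.map_marked _ trivial)
    · intro z'
      have h := hom_app_app_eq h₂
        ((cylinder.I.map (flat.map (SSet.yonedaEquiv.symm z.2))).hom.app _ z')
      exact (congr_arg (· ∈ A.marked) h.symm).mp (b.map_marked _ ⟨trivial, trivial⟩)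
  have := SSet.yonedaEquiv_symm_app_id z.2
  exact (congr_arg (fun t ↦ u.hom.app _ (z.1, t) ∈ X.marked) this).mp hz

-- The underlying map is the pushout product of an inner horn with `∂Δ¹ → Δ¹`, which is inner
-- anodyne. Markings come for free: a marked edge of `(Δ¹)^♯ × (Δⁿ⁺²)^♭` lies over a vertex, and all
-- vertices belong to the horn.
open SSet in
lemma hasLiftingProperty_boxBoundary_horn {X A : MarkedSSet.{u}} {q : X ⟶ A}
    [InnerFibration q.hom] {n : ℕ} {k : Fin (n + 3)} (h₀ : 0 < k) (h₁ : k < Fin.last (n + 2)) :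
    HasLiftingProperty
      (cylinder.boxBoundary (flat.map (Λ[n + 2, k] : (Δ[n + 2] : SSet.{u}).Subcomplex).ι)) q := by
  rw [hasLiftingProperty_boxBoundary_iff]
  intro v₀ v₁ u b e₀ e₁ e₂ e₃ e₄
  let Λ : (Δ[n + 2] : SSet.{u}).Subcomplex := Λ[n + 2, k]
  let U := Subcomplex.unionProd (∂Δ[1] : (Δ[1] : SSet.{u}).Subcomplex) Λ
  -- `none` stands for the cylinder on the horn, `some false` and `some true` for the ends `0` and
  -- `1`.
  let B (ε : Option Bool) : SSet.{u} := ε.rec (Δ[1] ⊗ (Λ : SSet.{u})) (fun _ ↦ Δ[n + 2])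
  let m (ε : Option Bool) : B ε ⟶ Δ[1] ⊗ Δ[n + 2] :=
    ε.rec (Δ[1] ◁ Λ.ι) (fun b ↦ b.rec (endInclusion 0 _) (endInclusion 1 _))
  let f (ε : Option Bool) : B ε ⟶ X.toSSet :=
    ε.rec u.hom (fun b ↦ b.rec v₀.hom v₁.hom)
  have hU (d : ℕ) (x : (Δ[1] ⊗ Δ[n + 2] : SSet.{u}) _⦋d⦌) :
      x ∈ U.obj _ ↔ x.2 ∈ Λ.obj _ ∨ x.1 ∈ (∂Δ[1] : (Δ[1] : SSet.{u}).Subcomplex).obj _ :=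
    Subcomplex.mem_unionProd_iff _ _ x
  have hcover (d : ℕ) (x : (Δ[1] ⊗ Δ[n + 2] : SSet.{u}) _⦋d⦌) (hx : x ∈ U.obj _) :
      ∃ i y, (m i).app _ y = x := by
    obtain hx | hx := (hU d x).1 hx
    · exact ⟨none, (x.1, ⟨x.2, hx⟩), rfl⟩
    · obtain ⟨j, hj⟩ := (mem_boundary_iff_notMem_range _).1 hx
      have h01 (a : Fin 2) : a = 0 ∨ a = 1 := by omega
      obtain rfl | rfl := h01 j
      · refine ⟨some true, x.2, Prod.ext (SSet.stdSimplex.ext _ _ fun k ↦ ?_) rfl⟩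
        exact (Fin.eq_one_of_ne_zero _ fun h ↦ hj ⟨k, h⟩).symm
      · refine ⟨some false, x.2, Prod.ext (SSet.stdSimplex.ext _ _ fun k ↦ ?_) rfl⟩
        have key (a : Fin 2) (ha : a ≠ 1) : 0 = a := by omega
        exact key _ fun h ↦ hj ⟨k, h⟩
  have hne (d : ℕ) (x y : (Δ[n + 2] : SSet.{u}) _⦋d⦌) (h : (endInclusion 0 _).app _ x =
      (endInclusion 1 _).app _ y) : False :=
    Fin.zero_ne_one (congr_arg (fun q : (Δ[1] ⊗ Δ[n + 2] : SSet.{u}) _⦋d⦌ ↦ q.1 0) h)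
  have hm (i : Option Bool) (d : ℕ) (y : B i _⦋d⦌) : (m i).app _ y ∈ U.obj _ := by
    obtain _ | _ | _ := i
    · exact (hU d _).2 (Or.inl y.2.2)
    · refine (hU d _).2 (Or.inr ((mem_boundary_iff_notMem_range _).2 ⟨1, ?_⟩))
      rintro ⟨k, hk⟩
      exact Fin.zero_ne_one hk
    · refine (hU d _).2 (Or.inr ((mem_boundary_iff_notMem_range _).2 ⟨0, ?_⟩))
      rintro ⟨k, hk⟩
      exact Fin.zero_ne_one hk.symm
  have hinj (d : ℕ) (y z : (Δ[1] ⊗ (Λ : SSet.{u}) : SSet.{u}) _⦋d⦌)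
      (h : (Δ[1] ◁ Λ.ι).app _ y = (Δ[1] ◁ Λ.ι).app _ z) : y = z :=
    Prod.ext (congr_arg (fun q : (Δ[1] ⊗ Δ[n + 2] : SSet.{u}) _⦋d⦌ ↦ q.1) h)
      (Subtype.ext (congr_arg (fun q : (Δ[1] ⊗ Δ[n + 2] : SSet.{u}) _⦋d⦌ ↦ q.2) h))
  have hend (ε : Fin 2) (v : Δ[n + 2] ⟶ X.toSSet) (e : Λ.ι ≫ v = endInclusion ε _ ≫ u.hom) (d : ℕ)
      (y : (Δ[1] ⊗ (Λ : SSet.{u}) : SSet.{u}) _⦋d⦌) (z : (Δ[n + 2] : SSet.{u}) _⦋d⦌)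
      (h : (Δ[1] ◁ Λ.ι).app _ y = (endInclusion ε _).app _ z) : u.hom.app _ y = v.app _ z := by
    have hz : z = Λ.ι.app _ y.2 :=
      (congr_arg (fun q : (Δ[1] ⊗ Δ[n + 2] : SSet.{u}) _⦋d⦌ ↦ q.2) h).symm
    have hy : y = (endInclusion ε _).app _ y.2 :=
      Prod.ext (congr_arg (fun q : (Δ[1] ⊗ Δ[n + 2] : SSet.{u}) _⦋d⦌ ↦ q.1) h) rfl
    exact (congr_arg (u.hom.app _) hy).trans
      ((app_app_eq e y.2).symm.trans (congr_arg (v.app _) hz.symm))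
  have hend₀ := hend 0 v₀.hom (congr_arg Hom.hom e₀)
  have hend₁ := hend 1 v₁.hom (congr_arg Hom.hom e₁)
  obtain ⟨g, hg⟩ := U.exists_glue B m f hcover (by
    rintro (_ | _ | _) (_ | _ | _) d y z h
    · exact congr_arg (u.hom.app _) (hinj d y z h)
    · exact hend₀ d y z h
    · exact hend₁ d y z h
    · exact (hend₀ d z y h.symm).symm
    · exact congr_arg (v₀.hom.app _)
        (congr_arg (fun q : (Δ[1] ⊗ Δ[n + 2] : SSet.{u}) _⦋d⦌ ↦ q.2) h)
    · exact (hne d y z h).elim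
    · exact (hend₁ d z y h.symm).symm
    · exact (hne d z y h.symm).elim
    · exact congr_arg (v₁.hom.app _)
        (congr_arg (fun q : (Δ[1] ⊗ Δ[n + 2] : SSet.{u}) _⦋d⦌ ↦ q.2) h))
  have hU' := innerAnodyneExtensions_unionProd_ι (∂Δ[1] : (Δ[1] : SSet.{u}).Subcomplex) Λ
    (innerAnodyneExtensions.horn_ι h₀ h₁)
  obtain ⟨l, hl, hl'⟩ := (hU' q.hom (mem_innerFibrations _)).exists_lift (f := g) (g := b.hom) (by
    refine Subcomplex.hom_ext fun d x hx ↦ ?_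
    obtain ⟨i, y, rfl⟩ := hcover d x hx
    refine (congr_arg (q.hom.app _) (hg i d y hx)).trans ?_
    obtain _ | _ | _ := i
    · exact hom_app_app_eq e₂ y
    · exact hom_app_app_eq e₃ y
    · exact hom_app_app_eq e₄ y)
  have hl₀ (i : Option Bool) (d : ℕ) (y : B i _⦋d⦌) : l.app _ ((m i).app _ y) = (f i).app _ y :=
    (Subcomplex.app_of_ι_comp_eq hl _ (hm i d y)).trans (hg i d y _)
  refine ⟨⟨l, ?_⟩, ?_, ?_, ?_, hom_ext hl'⟩
  · rintro ⟨z₁, _⟩ ⟨-, z₂, rfl⟩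
    have hz₂ : z₂ ∈ Λ.obj _ := by
      rw [mem_horn_iff_notMem_range]
      obtain ⟨j, hj, hj'⟩ : ∃ j : Fin (n + 3), j ≠ k ∧ j ≠ z₂ 0 := by
        by_contra! h
        have := Finset.card_le_card (s := Finset.univ) (t := {k, z₂ 0}) fun j _ ↦ by
          simpa [or_iff_not_imp_left] using h j
        have := this.trans Finset.card_le_two
        simp at this
      refine ⟨j, hj, ?_⟩
      rintro ⟨c, rfl⟩
      obtain rfl := Subsingleton.elim (α := Fin 1) c 0
      exact hj' rfl
    let z : (cylinder.I.obj (flat.obj (Λ : SSet.{u}))).toSSet _⦋1⦌ :=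
      (z₁, (Λ : SSet.{u}).σ 0 ⟨z₂, hz₂⟩)
    exact (congr_arg (· ∈ X.marked) (hl₀ none 1 z)).mpr (u.map_marked z ⟨trivial, ⟨_, rfl⟩⟩)
  · refine hom_ext ?_
    ext ⟨⟨d⟩⟩ x
    exact hl₀ (some false) d x
  · refine hom_ext ?_
    ext ⟨⟨d⟩⟩ x
    exact hl₀ (some true) d x
  · refine hom_ext ?_
    ext ⟨⟨d⟩⟩ x
    exact hl₀ none d x

/-- The index type of `basicAnodyne`. -/
inductive BasicIndex : Type where
  /-- the inner horns -/
  | horn (n : ℕ) (k : Fin (n + 3)) (h₀ : 0 < k) (h₁ : k < Fin.last (n + 2)) : BasicIndex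
  /-- the marking of the walking isomorphism -/
  | iso : BasicIndex
  /-- the boxes on the boundary inclusions -/
  | box (n : ℕ) : BasicIndex
  /-- the box on the marking of an edge -/
  | square : BasicIndex

/-- A small family of maps that generates the marked right anodyne extensions. -/
def basicArrow (x : BasicIndex) : Arrow MarkedSSet.{u} :=
  x.rec (fun n k _ _ ↦ Arrow.mk (flat.map (Λ[n + 2, k] : (Δ[n + 2] : SSet.{u}).Subcomplex).ι))
    (Arrow.mk (flatToSharp SSet.coherentIso))
    (fun n ↦ Arrow.mk
      (cylinder.boxOne (flat.map (∂Δ[n] : (Δ[n] : SSet.{u}).Subcomplex).ι)))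
    (Arrow.mk (cylinder.boxOne (flatToSharp Δ[1])))

/-- A small set of maps that generates the marked right anodyne extensions. -/
def basicAnodyne : MorphismProperty MarkedSSet.{u} :=
  MorphismProperty.ofHoms fun x : BasicIndex ↦ (basicArrow x).hom

instance : MorphismProperty.IsSmall.{u} basicAnodyne.{u} :=
  MorphismProperty.isSmall_ofHoms _

lemma basicAnodyne_le_underlyingMono : basicAnodyne.{u} ≤ underlyingMono := by
  have h₁ {A B : SSet.{u}} (f : A ⟶ B) [Mono f] : underlyingMono (flat.map f) :=
    inferInstanceAs (Mono f)
  have h₂ (A : SSet.{u}) : underlyingMono (flatToSharp A) := inferInstanceAs (Mono (𝟙 A))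
  rintro _ _ _ ⟨⟨n, k, _, _⟩ | _ | n | _⟩
  · exact h₁ _
  · exact h₂ _
  · exact underlyingMono_boxOne (h₁ _)
  · exact underlyingMono_boxOne (h₂ _)

lemma basicAnodyne_rlp_iff {X A : MarkedSSet.{u}} (q : X ⟶ A) :
    basicAnodyne.rlp q ↔ SSet.InnerFibration q.hom ∧
      HasLiftingProperty (flatToSharp SSet.coherentIso) q ∧
      (∀ n, HasLiftingProperty
        (cylinder.boxOne (flat.map (∂Δ[n] : (Δ[n] : SSet.{u}).Subcomplex).ι)) q) ∧
      HasLiftingProperty (cylinder.boxOne (flatToSharp Δ[1])) q := by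
  refine ⟨fun h ↦ ⟨?_, h _ ⟨BasicIndex.iso⟩, fun n ↦ h _ ⟨BasicIndex.box n⟩,
    h _ ⟨BasicIndex.square⟩⟩, fun ⟨h₁, h₂, h₃, h₄⟩ ↦ ?_⟩
  · rw [SSet.innerFibration_iff]
    rintro _ _ _ ⟨k, h₀, h₁⟩
    refine ⟨fun {f g} sq ↦ ?_⟩
    obtain ⟨l, hl, hl'⟩ := HasLiftingProperty.exists_lift (h _ ⟨BasicIndex.horn _ k h₀ h₁⟩)
      (f := flatHom f) (g := flatHom g) (hom_ext sq.w)
    exact ⟨⟨l.hom, congr_arg Hom.hom hl, congr_arg Hom.hom hl'⟩⟩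
  · rintro _ _ _ ⟨⟨n, k, h, h'⟩ | _ | n | _⟩
    · refine ⟨fun {f g} sq ↦ ?_⟩
      obtain ⟨l, hl, hl'⟩ := SSet.InnerFibration.exists_lift q.hom h h' f.hom g.hom
        (congr_arg Hom.hom sq.w)
      exact ⟨⟨flatHom l, hom_ext hl, hom_ext hl'⟩⟩
    · exact h₂
    · exact h₃ _
    · exact h₄

/-- For `∂₁ ⊠ -`, the transpose `pathOne q` lifts against boundaries and the marking of an edge,
hence against all monomorphisms. For `∂I ⊠ -`, transposition to `pathBoundary q` reduces to
generators; those of the form `∂₁ ⊠ j` follow from the first part, since `∂I ⊠ (∂₁ ⊠ j)` and `∂₁ ⊠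
(∂I ⊠ j)` differ by exchanging the intervals. -/
lemma isRightAnodyneClass_basicAnodyne :
    IsRightAnodyneClass.{u} cylinder.{u} underlyingMono basicAnodyne.rlp.llp := by
  have hone {X A : MarkedSSet.{u}} {q : X ⟶ A} (hq : basicAnodyne.rlp q) {K L : MarkedSSet.{u}}
      {i : K ⟶ L} (hi : underlyingMono i) : HasLiftingProperty i (pathOne pathAdjunction q) := by
    have hq := (basicAnodyne_rlp_iff q).1 hq
    refine hasLiftingProperty_of_underlyingMono (fun n ↦ ?_) ?_ hi
    · rw [hasLiftingProperty_pathOne_iff]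
      exact hq.2.2.1 n
    · rw [hasLiftingProperty_pathOne_iff]
      exact hq.2.2.2
  have hbd {K L : MarkedSSet.{u}} {i : K ⟶ L} (hi : underlyingMono i) {X A : MarkedSSet.{u}}
      {q : X ⟶ A} (hq : basicAnodyne.rlp q) :
      HasLiftingProperty (cylinder.boxBoundary (cylinder.boxOne i)) q :=
    hasLiftingProperty_boxBoundary_boxOne pathAdjunction swap swap_naturality swap_swap
      map_endMap_swap₀ map_endMap_swap₁ i q (hone hq (underlyingMono_boxBoundary hi))
  refine ⟨le_underlyingMono_of_llp_rlp basicAnodyne_le_underlyingMono,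
    ⟨_, inferInstance, basicAnodyne_le_underlyingMono, rfl⟩, fun K L i hi X A q hq ↦ ?_,
    fun K L i hi X A q hq ↦ ?_⟩
  · rw [← hasLiftingProperty_pathOne_iff pathAdjunction]
    exact hone hq hi
  · rw [← hasLiftingProperty_pathBoundary_iff pathAdjunction]
    refine hi _ ?_
    intro K L j hj
    rw [hasLiftingProperty_pathBoundary_iff]
    obtain ⟨h₁, h₂, h₃, h₄⟩ := (basicAnodyne_rlp_iff q).1 hq
    obtain ⟨⟨n, k, h, h'⟩ | _ | n | _⟩ := hj
    · exact hasLiftingProperty_boxBoundary_horn h h'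
    · exact hasLiftingProperty_boxBoundary_flatToSharp h₄ _
    · exact hbd (inferInstanceAs (Mono (SSet.boundary n).ι)) hq
    · exact hbd (inferInstanceAs (Mono (𝟙 Δ[1]))) hq

end MarkedSSet

/-! ### The box on a point, and sufficiency of the conditions -/

namespace SSet

/-- The isomorphism from `Δ¹` to `Δ¹ × Δ⁰`. -/
def intervalIso : (Δ[1] : SSet.{u}) ⟶ Δ[1] ⊗ Δ[0] :=
  CartesianMonoidalCategory.lift (𝟙 _) (stdSimplex.isTerminalObj₀.from _)

lemma fst_intervalIso : CartesianMonoidalCategory.fst _ _ ≫ intervalIso.{u} = 𝟙 _ := by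
  apply CartesianMonoidalCategory.hom_ext
  · simp [intervalIso]
  · exact stdSimplex.isTerminalObj₀.hom_ext _ _

lemma endInclusion_fst : endInclusion 1 (Δ[0] : SSet.{u}) ≫ CartesianMonoidalCategory.fst _ _ =
    stdSimplex.δ 0 := by
  simp [stdSimplex.δ_zero_eq_const]

lemma δ_intervalIso : stdSimplex.δ 0 ≫ intervalIso = endInclusion 1 (Δ[0] : SSet.{u}) := by
  rw [← endInclusion_fst, Category.assoc, fst_intervalIso, Category.comp_id]

variable {Y : SSet.{u}}

/-- The edge corresponding to a map from `Δ¹ × Δ⁰`. -/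
def intervalEdge (t : Δ[1] ⊗ Δ[0] ⟶ Y) : Y _⦋1⦌ := yonedaEquiv (intervalIso ≫ t)

lemma δ_intervalEdge (t : Δ[1] ⊗ Δ[0] ⟶ Y) :
    Y.δ 0 (intervalEdge t) = yonedaEquiv (endInclusion 1 _ ≫ t) := by
  rw [intervalEdge, ← stdSimplex.yonedaEquiv_δ_comp, ← Category.assoc, δ_intervalIso]

lemma fst_yonedaEquiv_symm_intervalEdge (t : Δ[1] ⊗ Δ[0] ⟶ Y) :
    CartesianMonoidalCategory.fst _ _ ≫ yonedaEquiv.symm (intervalEdge t) = t := by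
  rw [intervalEdge, Equiv.symm_apply_apply, ← Category.assoc, fst_intervalIso, Category.id_comp]

lemma intervalEdge_fst (g : Y _⦋1⦌) :
    intervalEdge (CartesianMonoidalCategory.fst Δ[1] Δ[0] ≫ yonedaEquiv.symm g) = g := by
  rw [intervalEdge, intervalIso, CartesianMonoidalCategory.lift_fst_assoc, Category.id_comp,
    Equiv.apply_symm_apply]

lemma endInclusion_fst_yonedaEquiv_symm (f : Y _⦋1⦌) :
    endInclusion 1 _ ≫ CartesianMonoidalCategory.fst Δ[1] Δ[0] ≫ yonedaEquiv.symm f =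
      yonedaEquiv.symm (Y.δ 0 f) := by
  rw [← Category.assoc, endInclusion_fst, stdSimplex.δ_comp_yonedaEquiv_symm]

end SSet

namespace MarkedSSet

open FunctorialCylinder

lemma isEmpty_boundary_zero (d : ℕ) : IsEmpty ((∂Δ[0] : SSet.{u}) _⦋d⦌) := by
  refine ⟨fun ⟨x, hx⟩ ↦ ?_⟩
  obtain ⟨j, hj⟩ := (SSet.mem_boundary_iff_notMem_range _).1 hx
  exact hj ⟨0, Subsingleton.elim (α := Fin 1) _ _⟩

lemma intervalEdge_mem {X : MarkedSSet.{u}} (t : cylinder.I.obj (flat.obj Δ[0]) ⟶ X) :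
    SSet.intervalEdge t.hom ∈ X.marked := by
  refine t.map_marked _ ⟨trivial, SSet.stdSimplex.const 0 0 _, ?_⟩
  exact SSet.stdSimplex.ext _ _ fun _ ↦ Subsingleton.elim (α := Fin 1) _ _

/-- The lifting property for the inclusion of `{1}` into the marked interval. -/
lemma hasLiftingProperty_boxOne_boundary_zero_iff {X A : MarkedSSet.{u}} (p : X ⟶ A) :
    HasLiftingProperty
        (cylinder.boxOne (flat.map (∂Δ[0] : (Δ[0] : SSet.{u}).Subcomplex).ι)) p ↔
      ∀ (y : X.toSSet _⦋0⦌), ∀ g ∈ A.marked, A.toSSet.δ 0 g = p.hom.app (op ⦋0⦌) y →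
        ∃ f ∈ X.marked, X.toSSet.δ 0 f = y ∧ p.hom.app (op ⦋1⦌) f = g := by
  rw [hasLiftingProperty_boxOne_iff]
  constructor
  · intro H y g hg hy
    obtain ⟨l, hl, -, hl'⟩ := H (flatHom (SSet.yonedaEquiv.symm y))
      ⟨{ app d := ↾fun x ↦ ((isEmpty_boundary_zero d.unop.len).false x.2).elim
         naturality d _ _ := by
          ext x
          exact ((isEmpty_boundary_zero d.unop.len).false x.2).elim }, fun x ↦
            ((isEmpty_boundary_zero 1).false x.2).elim⟩
      ⟨CartesianMonoidalCategory.fst _ _ ≫ SSet.yonedaEquiv.symm g,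
        fun z _ ↦ yonedaEquiv_symm_app_mem hg z.1⟩
      (hom_ext (by
        ext ⟨⟨d⟩⟩ x
        exact ((isEmpty_boundary_zero d).false x).elim))
      (hom_ext (by
        ext ⟨⟨d⟩⟩ x
        exact ((isEmpty_boundary_zero d).false x.2).elim))
      (hom_ext (by
        refine Eq.trans ?_ (SSet.endInclusion_fst_yonedaEquiv_symm g).symm
        rw [hy]
        exact SSet.yonedaEquiv_symm_comp _ _))
    refine ⟨_, intervalEdge_mem l, ?_, ?_⟩
    · exact (SSet.δ_intervalEdge l.hom).trans ((congr_arg SSet.yonedaEquiv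
        (congr_arg Hom.hom hl)).trans (SSet.yonedaEquiv.apply_symm_apply y))
    · exact (congr_arg SSet.intervalEdge (congr_arg Hom.hom hl')).trans (SSet.intervalEdge_fst g)
  · intro H v u b h₁ h₂ h₃
    obtain ⟨f, hf, hfy, hfg⟩ := H (SSet.yonedaEquiv v.hom) _ (intervalEdge_mem b)
      ((SSet.δ_intervalEdge b.hom).trans
        (congr_arg SSet.yonedaEquiv (congr_arg Hom.hom h₃)).symm)
    refine ⟨⟨CartesianMonoidalCategory.fst _ _ ≫ SSet.yonedaEquiv.symm f,
      fun z _ ↦ yonedaEquiv_symm_app_mem hf z.1⟩, hom_ext ?_, hom_ext ?_, hom_ext ?_⟩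
    · refine (SSet.endInclusion_fst_yonedaEquiv_symm f).trans ?_
      rw [hfy]
      exact SSet.yonedaEquiv.symm_apply_apply v.hom
    · ext ⟨⟨d⟩⟩ x
      exact ((isEmpty_boundary_zero d).false x.2).elim
    · refine Eq.trans ?_ (SSet.fst_yonedaEquiv_symm_intervalEdge b.hom)
      rw [← hfg]
      exact congr_arg (fun t ↦ CartesianMonoidalCategory.fst _ _ ≫ t)
        (SSet.yonedaEquiv_symm_comp f p.hom)

section

variable {X A : MarkedSSet.{u}} {p : X ⟶ A} [SSet.InnerFibration p.hom]

/-- The second condition gives a marked, hence Cartesian, edge with the same target and image, and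
comparison with it makes `f` Cartesian. -/
lemma mem_marked_of_isLocallyCartesianEdge
    (h₂ : ∀ (y : X.toSSet _⦋0⦌), ∀ g ∈ A.marked, A.toSSet.δ 0 g = p.hom.app (op ⦋0⦌) y →
        ∃ f ∈ X.marked, X.toSSet.δ 0 f = y ∧ p.hom.app (op ⦋1⦌) f = g)
    (h₃ : ∀ f : X.toSSet _⦋1⦌,
        f ∈ X.marked ↔ p.hom.app (op ⦋1⦌) f ∈ A.marked ∧ SSet.IsCartesianEdge p.hom f)
    {f : X.toSSet _⦋1⦌} (hf : SSet.IsLocallyCartesianEdge p.hom f)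
    (hf' : p.hom.app _ f ∈ A.marked) : f ∈ X.marked := by
  obtain ⟨f', hm, hδ, hp⟩ := h₂ (X.toSSet.δ 0 f) (p.hom.app _ f) hf'
    (ConcreteCategory.congr_hom (SimplicialObject.δ_naturality p.hom (0 : Fin 2)) f).symm
  exact (h₃ f).2 ⟨hf', hf.isCartesianEdge p.hom ((h₃ f').1 hm).2 hp.symm hδ.symm⟩

/-- Only the images of the edges of `J` have to be marked. Degenerate edges are marked, so they are
Cartesian, and contracting `J` makes these images locally Cartesian. -/
lemma hasLiftingProperty_flatToSharp_coherentIso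
    (h₃ : ∀ f ∈ X.marked, SSet.IsCartesianEdge p.hom f)
    (hN : ∀ f, SSet.IsLocallyCartesianEdge p.hom f → p.hom.app _ f ∈ A.marked → f ∈ X.marked) :
    HasLiftingProperty (flatToSharp SSet.coherentIso) p := by
  refine ⟨fun {f g} sq ↦ ⟨⟨⟨f.hom, fun j _ ↦ ?_⟩, rfl, ?_⟩⟩⟩
  · refine hN _ (SSet.isLocallyCartesianEdge_of_coherentIso p.hom
      (fun x ↦ h₃ _ (X.degenerate_mem x)) f.hom j) ?_
    exact (congr_arg (· ∈ A.marked) (hom_app_app_eq sq.w j)).mpr (g.map_marked _ trivial)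
  · have := congr_arg Hom.hom sq.w
    exact hom_ext this

/-- Last horns end in the edge over the last vertex of `Δⁿ⁺¹`, which is marked in the cylinder on
the boundary. All vertices lie in the boundary, so the lift preserves markings because `u` does. -/
lemma hasLiftingProperty_boxOne_boundary_succ
    (h₃ : ∀ f ∈ X.marked, SSet.IsCartesianEdge p.hom f) (n : ℕ) :
    HasLiftingProperty
      (cylinder.boxOne (flat.map (∂Δ[n + 1] : (Δ[n + 1] : SSet.{u}).Subcomplex).ι)) p := by
  rw [hasLiftingProperty_boxOne_iff]
  intro v u b e₁ e₂ e₃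
  obtain ⟨l, hl, hl', hl''⟩ := SSet.exists_lift_box p.hom u.hom v.hom b.hom
    (congr_arg Hom.hom e₁).symm (congr_arg Hom.hom e₂) (congr_arg Hom.hom e₃) (fun e _ he ↦ by
      refine h₃ _ (u.map_marked e ⟨trivial, (∂Δ[n + 1] : SSet.{u}).δ 0 e.2, ?_⟩)
      refine Subtype.ext (SSet.stdSimplex.ext _ _ fun k ↦ ?_)
      exact (he _).trans (he _).symm)
  refine ⟨⟨l, ?_⟩, hom_ext hl', hom_ext hl, hom_ext hl''⟩
  rintro ⟨z₁, _⟩ ⟨-, z₂, rfl⟩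
  have hz₂ : z₂ ∈ (∂Δ[n + 1] : (Δ[n + 1] : SSet.{u}).Subcomplex).obj _ := by
    rw [SSet.boundary_obj_eq_univ 0 (n + 1)]
    trivial
  let z : (cylinder.I.obj (flat.obj (∂Δ[n + 1] : SSet.{u}))).toSSet _⦋1⦌ :=
    (z₁, (∂Δ[n + 1] : SSet.{u}).σ 0 ⟨z₂, hz₂⟩)
  have h : l.app _ ((cylinder.I.map (flat.map (∂Δ[n + 1]).ι)).hom.app _ z) = u.hom.app _ z :=
    ConcreteCategory.congr_hom (congr_app hl (op ⦋1⦌)) z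
  exact (congr_arg (· ∈ X.marked) h).mpr (u.map_marked z ⟨trivial, ⟨_, rfl⟩⟩)

/-- Again only markings are at stake. In the square, the two sides along the interval and the side
over `1` are marked. The diagonal is a composite of such sides, and the side over `0` is obtained
from the diagonal by cancellation. -/
lemma hasLiftingProperty_boxOne_flatToSharp
    (h₃ : ∀ f ∈ X.marked, SSet.IsCartesianEdge p.hom f)
    (hN : ∀ f, SSet.IsLocallyCartesianEdge p.hom f → p.hom.app _ f ∈ A.marked → f ∈ X.marked) :
    HasLiftingProperty (cylinder.boxOne (flatToSharp Δ[1])) p := by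
  rw [hasLiftingProperty_boxOne_iff]
  intro v u b e₁ e₂ e₃
  suffices ∀ z, u.hom.app _ z ∈ X.marked from
    ⟨⟨u.hom, fun z _ ↦ this z⟩, hom_ext (congr_arg Hom.hom e₁).symm, rfl,
      hom_ext (by have := congr_arg Hom.hom e₂; exact this)⟩
  let ι : (Δ[1] : SSet.{u}) _⦋1⦌ := SSet.yonedaEquiv (𝟙 _)
  have hb (z) : p.hom.app _ (u.hom.app _ z) ∈ A.marked :=
    (congr_arg (· ∈ A.marked) (hom_app_app_eq e₂ z)).mpr (b.map_marked _ ⟨trivial, trivial⟩)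
  have hu (z₁ : (Δ[1] : SSet.{u}) _⦋1⦌) (x) : u.hom.app _ (z₁, (Δ[1] : SSet.{u}).σ 0 x) ∈ X.marked :=
    u.map_marked _ ⟨trivial, x, rfl⟩
  have hv (z₂) : u.hom.app _ (SSet.stdSimplex.const 1 1 _, z₂) ∈ X.marked :=
    (congr_arg (· ∈ X.marked) (hom_app_app_eq e₁ z₂)).mp (v.map_marked _ trivial)
  have hdeg (z : (Δ[1] : SSet.{u}) _⦋1⦌) (h : z 0 = z 1) :
      z = (Δ[1] : SSet.{u}).σ 0 (SSet.stdSimplex.const 1 (z 0) _) :=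
    SSet.stdSimplex.ext _ _ fun k ↦ by
      fin_cases k
      · rfl
      · exact h.symm
  have hid (z : (Δ[1] : SSet.{u}) _⦋1⦌) (h : z 0 ≠ z 1) : z = ι := by
    have key (a b : Fin 2) (h : a ≠ b) (h' : a ≤ b) : a = 0 ∧ b = 1 := by omega
    have hle : z 0 ≤ z 1 := (SSet.stdSimplex.objEquiv z).toOrderHom.monotone (Fin.zero_le 1)
    refine SSet.stdSimplex.ext _ _ fun k ↦ ?_
    fin_cases k
    · exact (key _ _ h hle).1
    · exact (key _ _ h hle).2
  have hδ (τ : (Δ[1] ⊗ Δ[1] : SSet.{u}) _⦋2⦌) (i : Fin 3) (z)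
      (h : (Δ[1] ⊗ Δ[1] : SSet.{u}).δ i τ = z) :
      X.toSSet.δ i (u.hom.app _ τ) = u.hom.app _ z := by
    subst h
    exact (ConcreteCategory.congr_hom (SimplicialObject.δ_naturality u.hom i) τ).symm
  have hdiag : u.hom.app _ (ι, ι) ∈ X.marked := by
    -- The triangle `(0, 0) → (1, 0) → (1, 1)`.
    let τ : (Δ[1] ⊗ Δ[1] : SSet.{u}) _⦋2⦌ := ((Δ[1] : SSet.{u}).σ 1 ι, (Δ[1] : SSet.{u}).σ 0 ι)
    have h₁ : X.toSSet.δ 1 (u.hom.app _ τ) = u.hom.app _ (ι, ι) := hδ τ 1 _ (Prod.ext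
      (SSet.stdSimplex.ext _ _ fun k ↦ by fin_cases k <;> rfl)
      (SSet.stdSimplex.ext _ _ fun k ↦ by fin_cases k <;> rfl))
    have h₀ : X.toSSet.δ 0 (u.hom.app _ τ) = u.hom.app _ (SSet.stdSimplex.const 1 1 _, ι) :=
      hδ τ 0 _ (Prod.ext
        (SSet.stdSimplex.ext _ _ fun k ↦ by fin_cases k <;> rfl)
        (SSet.stdSimplex.ext _ _ fun k ↦ by fin_cases k <;> rfl))
    have h₂ : X.toSSet.δ 2 (u.hom.app _ τ) =
        u.hom.app _ (ι, (Δ[1] : SSet.{u}).σ 0 (SSet.stdSimplex.const 1 0 _)) :=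
      hδ τ 2 _ (Prod.ext
        (SSet.stdSimplex.ext _ _ fun k ↦ by fin_cases k <;> rfl)
        (SSet.stdSimplex.ext _ _ fun k ↦ by fin_cases k <;> rfl))
    have := SSet.IsCartesianEdge.isLocallyCartesianEdge_δ_one p.hom (u.hom.app _ τ)
      (h₃ _ (h₀ ▸ hv _)) (h₃ _ (h₂ ▸ hu _ _))
    exact hN _ (h₁ ▸ this) (hb _)
  have hzero : u.hom.app _ (SSet.stdSimplex.const 1 0 _, ι) ∈ X.marked := by
    -- The triangle `(0, 0) → (0, 1) → (1, 1)`.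
    let τ : (Δ[1] ⊗ Δ[1] : SSet.{u}) _⦋2⦌ := ((Δ[1] : SSet.{u}).σ 0 ι, (Δ[1] : SSet.{u}).σ 1 ι)
    have h₁ : X.toSSet.δ 1 (u.hom.app _ τ) = u.hom.app _ (ι, ι) := hδ τ 1 _ (Prod.ext
      (SSet.stdSimplex.ext _ _ fun k ↦ by fin_cases k <;> rfl)
      (SSet.stdSimplex.ext _ _ fun k ↦ by fin_cases k <;> rfl))
    have h₀ : X.toSSet.δ 0 (u.hom.app _ τ) =
        u.hom.app _ (ι, (Δ[1] : SSet.{u}).σ 0 (SSet.stdSimplex.const 1 1 _)) :=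
      hδ τ 0 _ (Prod.ext
        (SSet.stdSimplex.ext _ _ fun k ↦ by fin_cases k <;> rfl)
        (SSet.stdSimplex.ext _ _ fun k ↦ by fin_cases k <;> rfl))
    have h₂ : X.toSSet.δ 2 (u.hom.app _ τ) = u.hom.app _ (SSet.stdSimplex.const 1 0 _, ι) :=
      hδ τ 2 _ (Prod.ext
        (SSet.stdSimplex.ext _ _ fun k ↦ by fin_cases k <;> rfl)
        (SSet.stdSimplex.ext _ _ fun k ↦ by fin_cases k <;> rfl))
    have := SSet.IsCartesianEdge.isLocallyCartesianEdge_δ_two p.hom (u.hom.app _ τ)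
      (h₃ _ (h₀ ▸ hu _ _)) (h₃ _ (h₁ ▸ hdiag))
    exact hN _ (h₂ ▸ this) (hb _)
  suffices ∀ z₁ z₂ : (Δ[1] : SSet.{u}) _⦋1⦌, u.hom.app _ (z₁, z₂) ∈ X.marked from
    fun z ↦ this z.1 z.2
  intro z₁ z₂
  by_cases h : z₂ 0 = z₂ 1
  · rw [hdeg z₂ h]
    exact hu _ _
  · rw [hid z₂ h]
    by_cases h : z₁ 0 = z₁ 1
    · have h01 (a : Fin 2) : a = 0 ∨ a = 1 := by omega
      have hz₁ : z₁ = SSet.stdSimplex.const 1 (z₁ 0) _ := SSet.stdSimplex.ext _ _ fun k ↦ by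
        fin_cases k
        · rfl
        · exact h.symm
      obtain h' | h' := h01 (z₁ 0)
      · rw [hz₁, h']
        exact hzero
      · rw [hz₁, h']
        exact hv _
    · rw [hid z₁ h]
      exact hdiag

end

end MarkedSSet

/-! ### The contraction of the last edge, and necessity of the conditions -/

namespace SSet

variable (n : ℕ)

/-- The homotopy from the identity of `Δⁿ⁺²` that moves the vertex `n + 1` to `n + 2`. -/
def lastContraction : (Δ[1] ⊗ Δ[n + 2] : SSet.{u}) ⟶ Δ[n + 2] :=
  ((stdWord 1).prod (stdWord (n + 2))).hom (stdWord (n + 2))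
    (fun z ↦ if z.1 = 1 ∧ z.2.val = n + 1 then Fin.last (n + 2) else z.2)
    (by
      rintro ⟨ε, c⟩ ⟨ε', c'⟩ ⟨h, h'⟩
      change ε ≤ ε' at h
      change c ≤ c' at h'
      change (if _ then _ else _ : Fin (n + 3)) ≤ if _ then _ else _
      dsimp only
      split_ifs with h₁ h₂ h₂
      · exact le_rfl
      · have key (a b : Fin 2) (h : a ≤ b) (ha : a = 1) : b = 1 := by omega
        simp only [key _ _ h h₁.1, true_and] at h₂
        simp only [Fin.le_def, Fin.val_last] at h' ⊢
        omega
      · exact Fin.le_last _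
      · exact h')
    (fun _ _ ↦ trivial)

variable {n}

lemma lastContraction_apply {d : ℕ} (z : (Δ[1] ⊗ Δ[n + 2] : SSet.{u}) _⦋d⦌) (k : Fin (d + 1)) :
    (lastContraction n).app _ z k =
      if z.1 k = 1 ∧ (z.2 k).val = n + 1 then Fin.last (n + 2) else z.2 k :=
  congr_fun (WordModel.word_hom ((stdWord 1).prod (stdWord (n + 2))) (stdWord (n + 2)) _ _ _ z) k

lemma lastContraction_mem_of_snd_mem {d : ℕ} (z : (Δ[1] ⊗ Δ[n + 2] : SSet.{u}) _⦋d⦌)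
    (hz : z.2 ∈ (Λ[n + 2, Fin.last (n + 2)]).obj _) :
    (lastContraction n).app _ z ∈ (Λ[n + 2, Fin.last (n + 2)]).obj _ := by
  rw [mem_lastHorn_iff] at hz ⊢
  obtain ⟨j, hj, hj'⟩ := hz
  refine ⟨j, hj, ?_⟩
  rintro ⟨k, hk⟩
  rw [lastContraction_apply] at hk
  split_ifs at hk
  · exact hj hk.symm
  · exact hj' ⟨k, hk⟩

/-- At time `1` the vertex `n + 1` is no longer hit. -/
lemma lastContraction_mem_of_fst_eq {d : ℕ} (z : (Δ[1] ⊗ Δ[n + 2] : SSet.{u}) _⦋d⦌)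
    (hz : ∀ k, z.1 k = 1) :
    (lastContraction n).app _ z ∈ (Λ[n + 2, Fin.last (n + 2)]).obj _ := by
  rw [mem_lastHorn_iff]
  refine ⟨(Fin.last (n + 1)).castSucc, (Fin.castSucc_lt_last _).ne, ?_⟩
  rintro ⟨k, hk⟩
  rw [lastContraction_apply] at hk
  split_ifs at hk with h
  · exact (Fin.castSucc_lt_last _).ne hk.symm
  · exact h ⟨hz k, by rw [hk]; rfl⟩

lemma lastContraction_endInclusion_app {d : ℕ} (x : (Δ[n + 2] : SSet.{u}) _⦋d⦌) :
    (lastContraction n).app _ ((endInclusion 0 _).app _ x) = x := by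
  refine stdSimplex.ext _ _ fun k ↦ ?_
  refine (lastContraction_apply ((endInclusion 0 _).app _ x) k).trans (if_neg ?_)
  rintro ⟨h, -⟩
  exact Fin.zero_ne_one h

lemma endInclusion_lastContraction :
    endInclusion 0 _ ≫ lastContraction n = 𝟙 (Δ[n + 2] : SSet.{u}) := by
  refine WordModel.hom_ext (stdWord (n + 2)) fun d x k ↦ ?_
  exact congr_arg (fun y ↦ (stdWord (n + 2)).word y k) (lastContraction_endInclusion_app x)

/-- The edges of `Δⁿ⁺²` that are degenerate or the last edge. -/
def IsLastOrDegenerate (e : (Δ[n + 2] : SSet.{u}) _⦋1⦌) : Prop :=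
  e 0 = e 1 ∨ (e 0).val = n + 1 ∧ (e 1).val = n + 2

/-- The path traced by the vertex `n + 1` is the last edge itself. This is why that edge has to be
marked for the contraction to be a marked map. -/
lemma IsLastOrDegenerate.lastContraction {z : (Δ[1] ⊗ Δ[n + 2] : SSet.{u}) _⦋1⦌}
    (hz : IsLastOrDegenerate z.2) : IsLastOrDegenerate ((lastContraction n).app _ z) := by
  have hle : z.1 0 ≤ z.1 1 := (stdSimplex.objEquiv z.1).toOrderHom.monotone (Fin.zero_le 1)
  have key (a b : Fin 2) (h : a ≤ b) (ha : a = 1) : b = 1 := by omega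
  unfold IsLastOrDegenerate at hz ⊢
  rw [lastContraction_apply, lastContraction_apply]
  obtain h | ⟨h, h'⟩ := hz
  · rw [h]
    split_ifs with h₁ h₂ h₂
    · exact Or.inl rfl
    · exact (h₂ ⟨key _ _ hle h₁.1, h₁.2⟩).elim
    · exact Or.inr ⟨h₂.2, rfl⟩
    · exact Or.inl rfl
  · rw [if_neg (c := z.1 1 = 1 ∧ _) (by omega)]
    split_ifs
    · exact Or.inl (Fin.ext h'.symm)
    · exact Or.inr ⟨h, h'⟩

end SSet

namespace MarkedSSet

open FunctorialCylinder

/-- The marked simplicial set `K` in which the edges over degenerate edges and over the last edge of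
`Δⁿ⁺²` are marked. -/
def lastMarked {n : ℕ} {K : SSet.{u}} (g : K ⟶ Δ[n + 2]) : MarkedSSet.{u} where
  toSSet := K
  marked := {e | SSet.IsLastOrDegenerate (g.app _ e)}
  degenerate_mem x := by
    rw [Set.mem_ofPred_eq, app_σ]
    exact Or.inl rfl

lemma app_mem_of_isLastOrDegenerate {X : MarkedSSet.{u}} {n : ℕ}
    (a : (Λ[n + 2, Fin.last (n + 2)] : SSet.{u}) ⟶ X.toSSet)
    (ha : a.app _ (SSet.hornLastEdge n) ∈ X.marked) (e : (Λ[n + 2, Fin.last (n + 2)] : SSet.{u}) _⦋1⦌)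
    (he : SSet.IsLastOrDegenerate ((Λ[n + 2, Fin.last (n + 2)]).ι.app _ e)) :
    a.app _ e ∈ X.marked := by
  obtain he | ⟨h, h'⟩ := he
  · have : e = (Λ[n + 2, Fin.last (n + 2)] : SSet.{u}).σ 0
        ((Λ[n + 2, Fin.last (n + 2)] : SSet.{u}).δ 0 e) := by
      refine Subtype.ext (SSet.stdSimplex.ext _ _ fun k ↦ ?_)
      fin_cases k
      · exact he
      · rfl
    rw [this, app_σ]
    exact X.degenerate_mem _
  · have : e = SSet.hornLastEdge n := by
      refine Subtype.ext (SSet.stdSimplex.ext _ _ fun k ↦ ?_)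
      fin_cases k
      · exact Fin.ext h
      · exact Fin.ext h'
    rw [this]
    exact ha

/-- Marked edges are Cartesian for maps with the right lifting property against `∂₁ ⊠ i` for all
monomorphisms `i`. -/
lemma isCartesianEdge_of_mem_marked {X A : MarkedSSet.{u}} {p : X ⟶ A}
    (hp : ∀ ⦃K L : MarkedSSet.{u}⦄ (i : K ⟶ L), underlyingMono i →
      HasLiftingProperty (cylinder.boxOne i) p)
    {f : X.toSSet _⦋1⦌} (hf : f ∈ X.marked) : SSet.IsCartesianEdge p.hom f := by
  rintro n a b h rfl
  let Λ : (Δ[n + 2] : SSet.{u}).Subcomplex := Λ[n + 2, Fin.last (n + 2)]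
  let r : (Δ[1] ⊗ Δ[n + 2] : SSet.{u}) ⟶ Δ[n + 2] := SSet.lastContraction n
  let K : MarkedSSet.{u} := lastMarked Λ.ι
  let L : MarkedSSet.{u} := lastMarked (𝟙 (Δ[n + 2] : SSet.{u}))
  let i : K ⟶ L := ⟨Λ.ι, fun _ he ↦ he⟩
  let rΛ : (Δ[1] ⊗ (Λ : SSet.{u})) ⟶ Λ :=
    SSet.Subcomplex.factor ((Δ[1] ◁ Λ.ι) ≫ r) Λ fun d z ↦
      SSet.lastContraction_mem_of_snd_mem ((Δ[1] ◁ Λ.ι).app _ z) z.2.2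
  let rv : Δ[n + 2] ⟶ (Λ : SSet.{u}) :=
    SSet.Subcomplex.factor (SSet.endInclusion 1 _ ≫ r) Λ fun d z ↦
      SSet.lastContraction_mem_of_fst_eq ((SSet.endInclusion 1 _).app _ z) fun _ ↦ rfl
  have ha := app_mem_of_isLastOrDegenerate a hf
  have hb (e : (Δ[n + 2] : SSet.{u}) _⦋1⦌) (he : SSet.IsLastOrDegenerate e) :
      b.app _ e ∈ A.marked := by
    -- In dimension at least two these edges lie in the horn, so their images in the base are marked
    -- because `a` and `p` preserve markings.
    have he' : e ∈ Λ.obj _ := by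
      refine (SSet.mem_lastHorn_iff e).2 ?_
      obtain he | ⟨h₀, h₁⟩ := he
      · refine SSet.lastHornFamily_of_subsingleton ?_
        have (k : Fin 2) : e k = e 0 := by
          fin_cases k
          · rfl
          · exact he.symm
        rintro _ ⟨k, rfl⟩ _ ⟨k', rfl⟩
        rw [this k, this k']
      · refine ⟨0, Fin.last_pos.ne, ?_⟩
        rintro ⟨k, hk⟩
        have hk' := congr_arg Fin.val hk
        fin_cases k
        · exact absurd (h₀.symm.trans hk') (by simp)
        · exact absurd (h₁.symm.trans hk') (by simp)
    have := SSet.app_app_eq h ⟨e, he'⟩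
    exact (congr_arg (· ∈ A.marked) this).mp (p.map_marked _ (ha ⟨e, he'⟩ he))
  -- The contraction maps both `Δ¹ × Λ` and `{1} × Δⁿ⁺²` into the horn, so `a` defines the whole
  -- box; the end `0` of its filler solves the original problem.
  obtain ⟨l, -, hl, hl'⟩ := (hasLiftingProperty_boxOne_iff cylinder i p).1
    (hp i (inferInstanceAs (Mono Λ.ι)))
    ⟨rv ≫ a, fun e he ↦ ha _ (SSet.IsLastOrDegenerate.lastContraction
      (z := (SSet.endInclusion 1 _).app _ e) he)⟩
    ⟨rΛ ≫ a, fun e he ↦ ha _ (SSet.IsLastOrDegenerate.lastContraction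
      (z := (Δ[1] ◁ Λ.ι).app _ e) he.2)⟩
    ⟨r ≫ b, fun e he ↦ hb _ (SSet.IsLastOrDegenerate.lastContraction he.2)⟩
    (hom_ext (by
      ext ⟨⟨d⟩⟩ x
      rfl))
    (hom_ext (by
      ext ⟨⟨d⟩⟩ x
      exact SSet.app_app_eq h (rΛ.app _ x)))
    (hom_ext (by
      ext ⟨⟨d⟩⟩ x
      exact SSet.app_app_eq h (rv.app _ x)))
  refine ⟨SSet.endInclusion 0 _ ≫ l.hom, ?_, ?_⟩
  · ext ⟨⟨d⟩⟩ x
    have h₁ := hom_app_eq hl ((SSet.endInclusion 0 _).app _ x)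
    refine h₁.trans (congr_arg (a.app _) (Subtype.ext ?_))
    exact SSet.lastContraction_endInclusion_app x.1
  · have h₁ : l.hom ≫ p.hom = r ≫ b := congr_arg Hom.hom hl'
    have h₂ : (SSet.endInclusion 0 _ ≫ r) ≫ b = b := by
      rw [SSet.endInclusion_lastContraction, Category.id_comp]
    refine (Category.assoc _ _ _).trans ?_
    exact (congr_arg (SSet.endInclusion 0 _ ≫ ·) h₁).trans ((Category.assoc _ _ _).symm.trans h₂)

/-- Cartesian edges over marked edges are marked. -/
lemma mem_marked_of_isCartesianEdge {X A : MarkedSSet.{u}} {p : X ⟶ A} [SSet.InnerFibration p.hom]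
    (hJ : HasLiftingProperty (flatToSharp SSet.coherentIso) p)
    (hsq : HasLiftingProperty (cylinder.boxOne (flatToSharp Δ[1])) p)
    {f f' : X.toSSet _⦋1⦌} (hf : SSet.IsCartesianEdge p.hom f)
    (hf' : SSet.IsCartesianEdge p.hom f') (hpf : p.hom.app _ f ∈ A.marked) (hm : f' ∈ X.marked)
    (hδ : X.toSSet.δ 0 f = X.toSSet.δ 0 f') (hp : p.hom.app _ f' = p.hom.app _ f) :
    f ∈ X.marked := by
  obtain ⟨H, hH, hH'⟩ := SSet.exists_iso_homotopy p.hom (fun ε ↦ bif ε then f else f')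
    (p.hom.app _ f) (by rintro (_ | _); exacts [hp, rfl]) hδ
    (by rintro (_ | _); exacts [hf'.along _ _, hf.along _ _])
  -- The homotopy restricted to the sources. It lies over a single vertex of `A`, so its edges have
  -- degenerate image and lifting against `J^♭ → J^♯` marks them.
  let e : SSet.coherentIso.{u} ⟶ X.toSSet :=
    CartesianMonoidalCategory.lift (𝟙 _) (SSet.const (SSet.stdSimplex.obj₀Equiv.symm 0)) ≫ H
  have he (j : SSet.coherentIso.{u} _⦋1⦌) : e.app _ j ∈ X.marked := by
    obtain ⟨l, hl, -⟩ := hJ.exists_lift (f := flatHom e) (g := ⟨e ≫ p.hom, fun j _ ↦ by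
      have h := SSet.app_app_eq hH ((CartesianMonoidalCategory.lift (𝟙 _)
        (SSet.const (SSet.stdSimplex.obj₀Equiv.symm 0))).app _ j)
      exact (congr_arg (· ∈ A.marked) h).mpr (yonedaEquiv_symm_app_mem hpf _)⟩) rfl
    exact (congr_arg (· ∈ X.marked) (hom_app_eq hl j)).mp (l.map_marked _ trivial)
  -- Runs from `true` to `false`, so that the square `s` has `f` at time `0` and the marked edge
  -- `f'` at time `1`.
  let w : (Δ[1] : SSet.{u}) ⟶ SSet.coherentIso :=
    (SSet.stdWord 1).hom SSet.isoWord (fun ε ↦ decide (ε = 0)) (fun _ _ _ ↦ trivial)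
      (fun _ _ ↦ trivial)
  have hw {d : ℕ} (z : (Δ[1] : SSet.{u}) _⦋d⦌) (k) :
      SSet.isoWord.word (w.app _ z) k = decide (z k = 0) :=
    congr_fun (SSet.WordModel.word_hom (SSet.stdWord 1) SSet.isoWord _ _ _ z) k
  have h01 (a : Fin 2) : a = 0 ∨ a = 1 := by omega
  let s : cylinder.I.obj (flat.obj Δ[1]) ⟶ X := ⟨(w ▷ Δ[1]) ≫ H, by
    rintro ⟨z₁, _⟩ ⟨-, z₂, rfl⟩
    obtain h | h := h01 (z₂ 0)
    · have hz₂ : (Δ[1] : SSet.{u}).σ 0 z₂ = SSet.stdSimplex.const 1 0 _ :=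
        SSet.stdSimplex.ext _ _ fun k ↦ by fin_cases k <;> exact h
      refine (congr_arg (fun t ↦ H.app _ (w.app _ z₁, t) ∈ X.marked) hz₂).mpr ?_
      exact he (w.app _ z₁)
    · have := hH' 1 (w.app _ z₁, (Δ[1] : SSet.{u}).σ 0 z₂) true
        (Or.inr fun k ↦ by fin_cases k <;> exact h)
      refine (congr_arg (· ∈ X.marked) this).mpr ?_
      exact (congr_arg (· ∈ X.marked) (app_σ _ z₂)).mpr (X.degenerate_mem _)⟩
  have hmem := mem_marked_of_square hsq s (by
      have := hH' 1 (w.app _ (SSet.stdSimplex.const 1 1 _), SSet.yonedaEquiv (𝟙 Δ[1])) false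
        (Or.inl fun k ↦ (hw _ k).trans (by rfl))
      refine (congr_arg (· ∈ X.marked) this).mpr ?_
      exact (congr_arg (· ∈ X.marked) (SSet.yonedaEquiv_symm_app_id f')).mpr hm)
    (fun z ↦ by
      have h := SSet.app_app_eq hH ((w ▷ Δ[1]).app _ z)
      exact (congr_arg (· ∈ A.marked) h).mpr (yonedaEquiv_symm_app_mem hpf _))
    (SSet.stdSimplex.const 1 0 _, SSet.yonedaEquiv (𝟙 Δ[1]))
  have := hH' 1 (w.app _ (SSet.stdSimplex.const 1 0 _), SSet.yonedaEquiv (𝟙 Δ[1])) true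
    (Or.inl fun k ↦ (hw _ k).trans (by rfl))
  exact (congr_arg (· ∈ X.marked) (this.trans (SSet.yonedaEquiv_symm_app_id f))).mp hmem

lemma basicAnodyne_le_markedRightAnodyne : basicAnodyne.{u} ≤ markedRightAnodyne := by
  rintro _ _ _ ⟨⟨n, k, h₀, h₁⟩ | _ | n | _⟩ An hAn hS
  · exact hS _ (Or.inl ⟨n, k, h₀, h₁⟩)
  · exact hS _ (Or.inr ⟨()⟩)
  · exact hAn.boxOne_mem _ (inferInstanceAs (Mono (SSet.boundary n).ι))
  · exact hAn.boxOne_mem _ (inferInstanceAs (Mono (𝟙 Δ[1])))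

lemma markedRightAnodyne_le : markedRightAnodyne.{u} ≤ basicAnodyne.rlp.llp := by
  have hx (x : BasicIndex) : basicAnodyne.{u} (basicArrow x).hom := ⟨x⟩
  have h : generators.{u} ≤ basicAnodyne := by
    rintro _ _ _ (⟨n, k, h₀, h₁⟩ | h)
    · exact hx (BasicIndex.horn n k h₀ h₁)
    · obtain ⟨⟩ := h
      exact hx BasicIndex.iso
  exact fun K L f hf ↦ hf _ isRightAnodyneClass_basicAnodyne
    (h.trans (MorphismProperty.le_llp_rlp _))

/-- `markedRightAnodyne` lies between `basicAnodyne` and `basicAnodyne.rlp.llp`, and these two have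
the same right lifting property. -/
lemma isMarkedRightFibration_iff {X A : MarkedSSet.{u}} (p : X ⟶ A) :
    IsMarkedRightFibration p ↔ basicAnodyne.rlp p :=
  ⟨fun hp _ _ f hf ↦ hp f (basicAnodyne_le_markedRightAnodyne _ hf),
    fun hp _ _ _ hf ↦ markedRightAnodyne_le _ hf _ hp⟩

lemma IsMarkedRightFibration.hasLiftingProperty_boxOne {X A : MarkedSSet.{u}} {p : X ⟶ A}
    (hp : IsMarkedRightFibration p) ⦃K L : MarkedSSet.{u}⦄ (i : K ⟶ L) (hi : underlyingMono i) :
    HasLiftingProperty (cylinder.boxOne i) p :=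
  hp _ fun _ hAn _ ↦ hAn.boxOne_mem i hi

end MarkedSSet

end

/-! ### The characterization of marked right fibrations -/

theorem mainTheorem7 {X A : MarkedSSet.{u}} (p : X ⟶ A) :
    MarkedSSet.IsMarkedRightFibration p ↔
      SSet.InnerFibration p.hom ∧
      (∀ (y : X.toSSet _⦋0⦌), ∀ g ∈ A.marked,
        A.toSSet.δ 0 g = p.hom.app (op ⦋0⦌) y →
          ∃ f ∈ X.marked, X.toSSet.δ 0 f = y ∧ p.hom.app (op ⦋1⦌) f = g) ∧
      (∀ f : X.toSSet _⦋1⦌,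
        f ∈ X.marked ↔ p.hom.app (op ⦋1⦌) f ∈ A.marked ∧ SSet.IsCartesianEdge p.hom f) := by
  rw [MarkedSSet.isMarkedRightFibration_iff, MarkedSSet.basicAnodyne_rlp_iff]
  constructor
  · rintro ⟨h₁, hJ, hbox, hsq⟩
    have hp := (MarkedSSet.isMarkedRightFibration_iff p).2
      ((MarkedSSet.basicAnodyne_rlp_iff p).2 ⟨h₁, hJ, hbox, hsq⟩)
    have h₂ := (MarkedSSet.hasLiftingProperty_boxOne_boundary_zero_iff p).1 (hbox 0)
    have h₃ {f : X.toSSet _⦋1⦌} (hf : f ∈ X.marked) : SSet.IsCartesianEdge p.hom f :=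
      MarkedSSet.isCartesianEdge_of_mem_marked hp.hasLiftingProperty_boxOne hf
    refine ⟨h₁, h₂, fun f ↦ ⟨fun hf ↦ ⟨p.map_marked f hf, h₃ hf⟩, fun ⟨hpf, hf⟩ ↦ ?_⟩⟩
    -- A marked lift of `p f` with the same target, against which `f` is compared.
    obtain ⟨f', hm, hδ, hpf'⟩ := h₂ (X.toSSet.δ 0 f) _ hpf
      (ConcreteCategory.congr_hom (SimplicialObject.δ_naturality p.hom (0 : Fin 2)) f).symm
    exact MarkedSSet.mem_marked_of_isCartesianEdge hJ hsq hf (h₃ hm) hpf hm hδ.symm hpf'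
  · rintro ⟨h₁, h₂, h₃⟩
    have hC (f) (hf : f ∈ X.marked) : SSet.IsCartesianEdge p.hom f := ((h₃ f).1 hf).2
    have hN (f) (hf : SSet.IsLocallyCartesianEdge p.hom f) (hf' : p.hom.app _ f ∈ A.marked) :
        f ∈ X.marked := MarkedSSet.mem_marked_of_isLocallyCartesianEdge h₂ h₃ hf hf'
    refine ⟨h₁, MarkedSSet.hasLiftingProperty_flatToSharp_coherentIso hC hN, ?_,
      MarkedSSet.hasLiftingProperty_boxOne_flatToSharp hC hN⟩
    rintro (_ | n)
    · exact (MarkedSSet.hasLiftingProperty_boxOne_boundary_zero_iff p).2 h₂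
    · exact MarkedSSet.hasLiftingProperty_boxOne_boundary_succ hC n
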